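/- Let $\mathfrak g=\mathfrak g_{\bar 0}\oplus\mathfrak g_{\bar 1}$ be a finite-dimensional simple Lie superalgebra over $\mathbb C$ with a nondegenerate invariant even supersymmetric bilinear form $(\,|\,)$ and an even $\mathfrak{sl}_2$-triple $(e,h,f)$ with $(e|f)=\tfrac12(h|h)=1$, and let $k\in\mathbb C$. Write $\mathfrak g(i)$ for the eigenspace of $\mathrm{ad}\,\tfrac h2$ with eigenvalue $i\in\tfrac12\mathbb Z$, and put $$\mathfrak n=\bigoplus_{i\ge 1/2}\mathfrak g(i),\quad \mathfrak m=\bigoplus_{i\ge 1}\mathfrak g(i),\quad \mathfrak p=\bigoplus_{i\le 1/2}\mathfrak g(i),\quad \mathfrak m^\perp=\{w\in\mathfrak g : (w|v)=0\ \text{for all } v\in\mathfrak m\}.$$ For a vector superspace $M$ let $S(\mathbb C[\partial]\otimes M)$ be the supersymmetric algebra generated by $\mathbb C[\partial]\otimes M$, with the even derivation $\partial$ extending multiplication by $\partial$. On $\mathcal P=S(\mathbb C[\partial]\otimes\mathfrak g)$ and for homogeneous $a\in\mathfrak g$, let $\{a_\lambda\,\cdot\,\}:\mathcal P\to\mathcal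 P[\lambda]$ be the linear map determined by $\{a_\lambda b\}=[a,b]+k\lambda(a|b)$ for $b\in\mathfrak g$, by $\{a_\lambda\,\partial F\}=(\lambda+\partial)\{a_\lambda F\}$, and by $\{a_\lambda FG\}=\{a_\lambda F\}G+(-1)^{p(a)p(F)}F\{a_\lambda G\}$. Let $\mathcal I\subset\mathcal P$ be the differential ideal generated by $m+(f|m)$, $m\in\mathfrak m$, let $\mathcal V_{\mathcal I}(\mathfrak p)=\mathcal P/\mathcal I$, and let $$\mathcal W(\mathfrak g,f,k)=\{F+\mathcal I : \{a_\lambda F\}\in\mathcal I[\lambda]\ \text{for all homogeneous } a\in\mathfrak n\}\subset\mathcal V_{\mathcal I}(\mathfrak p).$$ Equip $\mathbb C\partial\ltimes(\mathfrak g\otimes\mathcal V_{\mathcal I}(\mathfrak p))$ with the bracket given by $[a\otimes F,b\otimes G]=(-1)^{p(b)p(F)}[a,b]\otimes FG$ and $[\partial,a\otimes F]=a\otimes\partial F$. Let $$\mathcal L=k\partial+\sum_{i\in I}q_i\otimes q^i-f\otimes 1,$$ where $\{q_i\}_{i\in I}$ and $\{q^i\}_{i\in I}$ are bases of $\mathfrak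 m^\perp$ and $\mathfrak p$ with $(q_i|q^j)=\delta_{ij}$. Finally, let $V_f$ be an $\mathrm{ad}\,h$-invariant sub-superspace of $\mathfrak m^\perp$ with $\mathfrak m^\perp=V_f\oplus[f,\mathfrak n]$, and let $\{v_j\}_{j\in\mathcal J}$ be a basis of $V_f$ consisting of homogeneous elements. Then there are a unique even $X\in\mathfrak n\otimes\mathcal V_{\mathcal I}(\mathfrak p)$ and a unique family $(w^j)_{j\in\mathcal J}$ in $\mathcal V_{\mathcal I}(\mathfrak p)$ such that $$e^{\mathrm{ad}X}\mathcal L=k\partial+\sum_{j\in\mathcal J}v_j\otimes w^j-f\otimes 1.$$ Each $w^j$ is homogeneous with $p(w^j)=p(v_j)$, and $\mathcal W(\mathfrak g,f,k)$ is the superalgebra of differential polynomials freely generated by the $w^j$: if $x_j$ denotes a variable of parity $p(v_j)$, there is an injective homomorphism of differential superalgebras $\mathbb C_{\mathrm{diff}}[x_j\,|\,j\in\mathcal J]\to\mathcal V_{\mathcal I}(\mathfrak p)$ with $x_j\mapsto w^j$ whose image is $\mathcal W(\mathfrak g,f,k)$. -/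

import Mathlib

open scoped TensorProduct Polynomial

/-! ### Vector superspaces -/

/-- A vector superspace: a complex vector space `M = M₀ ⊕ M₁` graded by `ℤ/2`.
`part i` is the subspace of elements of parity `i`. -/
class Superspace (M : Type*) [AddCommGroup M] [Module ℂ M] where
  part : ZMod 2 → Submodule ℂ M
  isCompl : IsCompl (part 0) (part 1)

theorem zmod2_cases (i : ZMod 2) : i = 0 ∨ i = 1 := by
  revert i; decide

namespace Superspace

section Basic

variable (M : Type*) [AddCommGroup M] [Module ℂ M] [Superspace M]

/-- The projection of `M = M₀ ⊕ M₁` to the even part. -/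
noncomputable def projEven : M →ₗ[ℂ] M := Submodule.projection _ _ (isCompl (M := M))

/-- The projection of `M = M₀ ⊕ M₁` to the odd part. -/
noncomputable def projOdd : M →ₗ[ℂ] M := Submodule.projection _ _ (isCompl (M := M)).symm

/-- The parity involution `x ↦ (-1)^{p(x)} x`. -/
noncomputable def sgn : M →ₗ[ℂ] M := projEven M - projOdd M

variable {M}

theorem projEven_mem (x : M) : projEven M x ∈ part (M := M) 0 :=
  Submodule.projection_apply_mem _ x

theorem projOdd_mem (x : M) : projOdd M x ∈ part (M := M) 1 :=
  Submodule.projection_apply_mem _ x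

theorem projEven_add_projOdd (x : M) : projEven M x + projOdd M x = x :=
  Submodule.projection_add_projection_eq_self _ x

theorem sgn_even {x : M} (hx : x ∈ part (M := M) 0) : sgn M x = x := by
  have h1 : projEven M x = x :=
    Submodule.projection_apply_left (isCompl (M := M)) ⟨x, hx⟩
  have h2 : projOdd M x = 0 :=
    (Submodule.projection_apply_eq_zero_iff (isCompl (M := M)).symm).2 hx
  simp [sgn, h1, h2]

theorem sgn_odd {x : M} (hx : x ∈ part (M := M) 1) : sgn M x = -x := by
  have h1 : projOdd M x = x :=
    Submodule.projection_apply_left (isCompl (M := M)).symm ⟨x, hx⟩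
  have h2 : projEven M x = 0 :=
    (Submodule.projection_apply_eq_zero_iff (isCompl (M := M))).2 hx
  simp [sgn, h1, h2]

theorem sgn_part {i : ZMod 2} {x : M} (hx : x ∈ part (M := M) i) :
    sgn M x = (-1 : ℂ) ^ i.val • x := by
  rcases zmod2_cases i with rfl | rfl
  · simpa using sgn_even hx
  · have := sgn_odd hx
    simpa [ZMod.val_one] using this

theorem mem_part_iff {i : ZMod 2} {x : M} :
    x ∈ part (M := M) i ↔ sgn M x = (-1 : ℂ) ^ i.val • x := by
  refine ⟨sgn_part, fun h => ?_⟩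
  have hs : sgn M x = projEven M x - projOdd M x := rfl
  have ha := projEven_add_projOdd x
  rcases zmod2_cases i with rfl | rfl
  · have h' : sgn M x = x := by simpa using h
    have h0 : (2 : ℂ) • projOdd M x = 0 := by
      rw [two_smul]
      have : projEven M x - projOdd M x = projEven M x + projOdd M x := by rw [← hs, h', ha]
      have h3 := sub_eq_iff_eq_add.1 this
      rw [add_assoc] at h3
      exact left_eq_add.1 h3
    have h1 : projOdd M x = 0 := by simpa using h0
    rw [← ha, h1, add_zero]
    exact projEven_mem x
  · have h' : sgn M x = -x := by simpa [ZMod.val_one] using h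
    have h0 : (2 : ℂ) • projEven M x = 0 := by
      rw [two_smul]
      have h4 : projEven M x - projOdd M x = -(projEven M x + projOdd M x) := by
        rw [← hs, h', ha]
      have : projEven M x + projEven M x
          = (projEven M x - projOdd M x) + (projEven M x + projOdd M x) := by abel
      rw [this, h4, neg_add_cancel]
    have h1 : projEven M x = 0 := by simpa using h0
    rw [← ha, h1, zero_add]
    exact projOdd_mem x

theorem sgn_sgn (x : M) : sgn M (sgn M x) = x := by
  have h : sgn M x = projEven M x - projOdd M x := rfl
  rw [h, map_sub, sgn_even (projEven_mem x), sgn_odd (projOdd_mem x), sub_neg_eq_add,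
    projEven_add_projOdd]

end Basic

/-- The superspace structure whose even and odd parts are the eigenspaces of a linear involution
`τ` for the eigenvalues `1` and `-1`. -/
@[reducible] def ofInvolution {M : Type*} [AddCommGroup M] [Module ℂ M] (τ : M →ₗ[ℂ] M)
    (hτ : ∀ x, τ (τ x) = x) : Superspace M where
  part i := LinearMap.ker (τ - (-1 : ℂ) ^ i.val • LinearMap.id)
  isCompl := by
    refine IsCompl.of_eq ?_ ?_
    · rw [eq_bot_iff]
      rintro x ⟨h0, h1⟩
      have h0' : τ x = x := by simpa [sub_eq_zero] using h0
      have h1' : τ x = -x := by simpa [ZMod.val_one, add_eq_zero_iff_eq_neg] using h1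
      have h2 : (2 : ℂ) • x = 0 := by
        rw [two_smul]
        nth_rewrite 1 [← h0']
        rw [h1', neg_add_cancel]
      simpa using h2
    · rw [eq_top_iff]
      intro x _
      have hx : x = (1 / 2 : ℂ) • (x + τ x) + (1 / 2 : ℂ) • (x - τ x) := by
        rw [← smul_add, add_add_sub_cancel, ← two_smul ℂ x, smul_smul]
        norm_num
      rw [hx]
      refine Submodule.add_mem_sup ?_ ?_
      · refine Submodule.smul_mem _ _ ?_
        simp [hτ]
        abel
      · refine Submodule.smul_mem _ _ ?_
        simp [hτ, ZMod.val_one]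

theorem mem_part_ofInvolution {M : Type*} [AddCommGroup M] [Module ℂ M] (τ : M →ₗ[ℂ] M)
    (hτ : ∀ x, τ (τ x) = x) (i : ZMod 2) (x : M) :
    x ∈ (ofInvolution τ hτ).part i ↔ τ x = (-1 : ℂ) ^ i.val • x := by
  change x ∈ LinearMap.ker (τ - (-1 : ℂ) ^ i.val • LinearMap.id) ↔ _
  simp [sub_eq_zero]

theorem sgn_ofInvolution {M : Type*} [AddCommGroup M] [Module ℂ M] (τ : M →ₗ[ℂ] M)
    (hτ : ∀ x, τ (τ x) = x) : @sgn M _ _ (ofInvolution τ hτ) = τ := by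
  let _ := ofInvolution τ hτ
  ext x
  have h0 := (mem_part_ofInvolution τ hτ 0 _).1 (projEven_mem x)
  have h1 := (mem_part_ofInvolution τ hτ 1 _).1 (projOdd_mem x)
  have h2 : τ x = τ (projEven M x) + τ (projOdd M x) := by
    rw [← map_add, projEven_add_projOdd]
  rw [h2, h0, h1]
  simp [sgn, ZMod.val_one, sub_eq_add_neg]

/-- `ℂ[∂]` is purely even. -/
noncomputable instance : Superspace ℂ[X] where
  part i := if i = 0 then ⊤ else ⊥
  isCompl := by simpa using isCompl_top_bot

theorem sgn_polynomial (P : ℂ[X]) : sgn ℂ[X] P = P :=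
  sgn_even (by simp [part])

theorem map_sgn_sgn {M N : Type*} [AddCommGroup M] [Module ℂ M] [Superspace M]
    [AddCommGroup N] [Module ℂ N] [Superspace N] (x : M ⊗[ℂ] N) :
    TensorProduct.map (sgn M) (sgn N) (TensorProduct.map (sgn M) (sgn N) x) = x := by
  induction x with
  | zero => simp
  | tmul a b => simp [sgn_sgn]
  | add a b ha hb => simp only [map_add, ha, hb]

/-- The tensor product of two superspaces, with `p(a ⊗ b) = p(a) + p(b)`. -/
noncomputable instance {M N : Type*} [AddCommGroup M] [Module ℂ M] [Superspace M]
    [AddCommGroup N] [Module ℂ N] [Superspace N] : Superspace (M ⊗[ℂ] N) :=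
  ofInvolution (TensorProduct.map (sgn M) (sgn N)) map_sgn_sgn

theorem sgn_tensor {M N : Type*} [AddCommGroup M] [Module ℂ M] [Superspace M]
    [AddCommGroup N] [Module ℂ N] [Superspace N] :
    sgn (M ⊗[ℂ] N) = TensorProduct.map (sgn M) (sgn N) :=
  sgn_ofInvolution _ map_sgn_sgn

end Superspace

open Superspace

/-- The vector superspace with basis `w_j`, `j ∈ J`, where `w_j` has parity `par j`. -/
def SuperFree {J : Type*} (_par : J → ZMod 2) : Type _ := J →₀ ℂ

namespace SuperFree

variable {J : Type*} (par : J → ZMod 2)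

noncomputable instance : AddCommGroup (SuperFree par) := inferInstanceAs (AddCommGroup (J →₀ ℂ))

noncomputable instance : Module ℂ (SuperFree par) := inferInstanceAs (Module ℂ (J →₀ ℂ))

/-- The basis vector `w_j`. -/
noncomputable def single (j : J) : SuperFree par := Finsupp.single j 1

/-- The elements of parity `i` are the combinations of the `w_j` with `par j = i`. -/
noncomputable instance : Superspace (SuperFree par) where
  part i := Finsupp.supported ℂ ℂ {j | par j = i}
  isCompl := by
    refine IsCompl.of_eq ?_ ?_
    · refine Disjoint.eq_bot (Finsupp.disjoint_supported_supported ?_)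
      rw [Set.disjoint_left]
      intro j h0 h1
      exact zero_ne_one (h0.symm.trans h1)
    · change Finsupp.supported ℂ ℂ {j | par j = 0} ⊔ Finsupp.supported ℂ ℂ {j | par j = 1} = ⊤
      rw [← Finsupp.supported_union, ← Finsupp.supported_univ]
      congr 1
      ext j
      simpa using zmod2_cases (par j)

end SuperFree

/-! ### The supersymmetric algebra -/

section SuperSym

variable (M : Type*) [AddCommGroup M] [Module ℂ M] [Superspace M]

/-- The relations `a b = (-1)^{p(a)p(b)} b a` for homogeneous `a, b ∈ M`. -/
inductive SuperSym.Rel : TensorAlgebra ℂ M → TensorAlgebra ℂ M → Prop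
  | swap (i j : ZMod 2) (a b : M) (ha : a ∈ part (M := M) i) (hb : b ∈ part (M := M) j) :
      Rel (TensorAlgebra.ι ℂ a * TensorAlgebra.ι ℂ b)
        ((-1 : ℂ) ^ (i.val * j.val) • (TensorAlgebra.ι ℂ b * TensorAlgebra.ι ℂ a))

/-- The supersymmetric algebra `S(M)`, the quotient of the tensor algebra of `M` by the relations
`a b = (-1)^{p(a)p(b)} b a`; it is the tensor product of the symmetric algebra of the even part
and the exterior algebra of the odd part. -/
def SuperSym : Type _ := RingQuot (SuperSym.Rel M)

namespace SuperSym

instance : Ring (SuperSym M) := inferInstanceAs (Ring (RingQuot (SuperSym.Rel M)))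

instance : Algebra ℂ (SuperSym M) := inferInstanceAs (Algebra ℂ (RingQuot (SuperSym.Rel M)))

/-- The inclusion of the generators. -/
noncomputable def ι : M →ₗ[ℂ] SuperSym M :=
  (RingQuot.mkAlgHom ℂ (SuperSym.Rel M)).toLinearMap ∘ₗ TensorAlgebra.ι ℂ

variable {M}

theorem ι_mul_ι {i j : ZMod 2} {a b : M} (ha : a ∈ part (M := M) i) (hb : b ∈ part (M := M) j) :
    ι M a * ι M b = (-1 : ℂ) ^ (i.val * j.val) • (ι M b * ι M a) := by
  have h := RingQuot.mkAlgHom_rel ℂ (Rel.swap i j a b ha hb)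
  rw [map_mul, map_smul, map_mul] at h
  exact h

/-- The algebra map out of `S(M)` extending a linear map with supercommuting values. -/
noncomputable def lift {B : Type*} [Ring B] [Algebra ℂ B] (d : M →ₗ[ℂ] B)
    (hd : ∀ (i j : ZMod 2) (a b : M), a ∈ part (M := M) i → b ∈ part (M := M) j →
      d a * d b = (-1 : ℂ) ^ (i.val * j.val) • (d b * d a)) : SuperSym M →ₐ[ℂ] B :=
  RingQuot.liftAlgHom ℂ ⟨TensorAlgebra.lift ℂ d, by
    rintro _ _ ⟨i, j, a, b, ha, hb⟩
    simpa using hd i j a b ha hb⟩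

theorem lift_ι {B : Type*} [Ring B] [Algebra ℂ B] (d : M →ₗ[ℂ] B)
    (hd : ∀ (i j : ZMod 2) (a b : M), a ∈ part (M := M) i → b ∈ part (M := M) j →
      d a * d b = (-1 : ℂ) ^ (i.val * j.val) • (d b * d a)) (a : M) :
    lift d hd (ι M a) = d a := by
  have := RingQuot.liftAlgHom_mkAlgHom_apply ℂ (TensorAlgebra.lift ℂ d) (s := Rel M) (by
    rintro _ _ ⟨i, j, a, b, ha, hb⟩
    simpa using hd i j a b ha hb) (TensorAlgebra.ι ℂ a)
  rw [TensorAlgebra.lift_ι_apply] at this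
  exact this

@[elab_as_elim]
theorem induction {motive : SuperSym M → Prop}
    (algebraMap : ∀ r, motive (algebraMap ℂ (SuperSym M) r)) (ι : ∀ x, motive (ι M x))
    (mul : ∀ a b, motive a → motive b → motive (a * b))
    (add : ∀ a b, motive a → motive b → motive (a + b)) (a : SuperSym M) : motive a := by
  obtain ⟨a, rfl⟩ := RingQuot.mkAlgHom_surjective ℂ (Rel M) a
  induction a using TensorAlgebra.induction with
  | algebraMap r => rw [AlgHom.commutes]; exact algebraMap r
  | ι x => exact ι x
  | mul x y hx hy => rw [map_mul]; exact mul _ _ hx hy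
  | add x y hx hy => rw [map_add]; exact add _ _ hx hy

/-- The parity involution of `S(M)` as an algebra map. -/
noncomputable def inv : SuperSym M →ₐ[ℂ] SuperSym M :=
  lift (ι M ∘ₗ sgn M) (by
    intro i j a b ha hb
    simp only [LinearMap.comp_apply, sgn_part ha, sgn_part hb, map_smul, smul_mul_smul_comm,
      ι_mul_ι ha hb]
    rw [smul_comm, mul_comm ((-1 : ℂ) ^ i.val)])

theorem inv_ι (a : M) : inv (ι M a) = ι M (sgn M a) := lift_ι _ _ a

theorem inv_inv (x : SuperSym M) : inv (inv x) = x := by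
  induction x using induction with
  | algebraMap r => simp
  | ι a => rw [inv_ι, inv_ι, sgn_sgn]
  | mul a b ha hb => rw [map_mul, map_mul, ha, hb]
  | add a b ha hb => rw [map_add, map_add, ha, hb]

/-- The `ℤ/2`-grading of the superalgebra `S(M)` induced by that of `M`. -/
noncomputable instance : Superspace (SuperSym M) := ofInvolution inv.toLinearMap inv_inv

theorem sgn_eq (x : SuperSym M) : sgn (SuperSym M) x = inv x := by
  have h : sgn (SuperSym M) = inv.toLinearMap := sgn_ofInvolution _ inv_inv
  rw [h]; rfl

/-- Multiplication by a homogeneous generator supercommutes. -/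
theorem mul_ι (j : ZMod 2) {b : M} (hb : b ∈ part (M := M) j) (x : SuperSym M) :
    x * ι M b = ι M b * (inv ^ j.val : SuperSym M →ₐ[ℂ] SuperSym M) x := by
  induction x using induction with
  | algebraMap r => rw [AlgHom.commutes, Algebra.commutes]
  | ι a =>
    have key : ∀ (i : ZMod 2) (a : M), a ∈ part (M := M) i →
        ι M a * ι M b = ι M b * (inv ^ j.val : SuperSym M →ₐ[ℂ] SuperSym M) (ι M a) := by
      intro i a ha
      rw [ι_mul_ι ha hb]
      rcases zmod2_cases j with rfl | rfl
      · simp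
      · simp [ZMod.val_one, inv_ι, sgn_part ha]
    rw [← projEven_add_projOdd a, map_add, map_add, add_mul, mul_add,
      key 0 _ (projEven_mem a), key 1 _ (projOdd_mem a)]
  | mul x y hx hy => rw [mul_assoc, hy, ← mul_assoc, hx, mul_assoc, map_mul]
  | add x y hx hy => rw [add_mul, map_add, mul_add, hx, hy]

/-- The twisted derivation `D : S(M) → B`, `D(xy) = D(x) φ(y) + ψ(x) D(y)`, that extends
the linear map `d` on the generators: the algebra map
`x ↦ (ψ(x), D(x); 0, φ(x))` to the triangular matrices is determined by `d`. -/
noncomputable def extMat {B : Type*} [Ring B] [Algebra ℂ B] (φ ψ : SuperSym M →ₐ[ℂ] B)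
    (d : M →ₗ[ℂ] B)
    (hd : ∀ (i j : ZMod 2) (a b : M), a ∈ part (M := M) i → b ∈ part (M := M) j →
      d a * φ (ι M b) + ψ (ι M a) * d b
        = (-1 : ℂ) ^ (i.val * j.val) • (d b * φ (ι M a) + ψ (ι M b) * d a)) :
    SuperSym M →ₐ[ℂ] Matrix (Fin 2) (Fin 2) B :=
  lift
    { toFun := fun a => !![ψ (ι M a), d a; 0, φ (ι M a)]
      map_add' := fun a b => by
        ext i j; fin_cases i <;> fin_cases j <;> simp
      map_smul' := fun c a => by
        ext i j; fin_cases i <;> fin_cases j <;> simp } (by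
    intro i j a b ha hb
    have h1 := congrArg φ (ι_mul_ι ha hb)
    have h2 := congrArg ψ (ι_mul_ι ha hb)
    have h3 := hd i j a b ha hb
    simp only [map_mul, map_smul] at h1 h2
    ext s t
    fin_cases s <;> fin_cases t
    · simpa [Matrix.mul_apply, Fin.sum_univ_two] using h2
    · simpa [Matrix.mul_apply, Fin.sum_univ_two, add_comm] using h3
    · simp [Matrix.mul_apply, Fin.sum_univ_two]
    · simpa [Matrix.mul_apply, Fin.sum_univ_two] using h1)

section

variable {B : Type*} [Ring B] [Algebra ℂ B] (φ ψ : SuperSym M →ₐ[ℂ] B) (d : M →ₗ[ℂ] B)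
    (hd : ∀ (i j : ZMod 2) (a b : M), a ∈ part (M := M) i → b ∈ part (M := M) j →
      d a * φ (ι M b) + ψ (ι M a) * d b
        = (-1 : ℂ) ^ (i.val * j.val) • (d b * φ (ι M a) + ψ (ι M b) * d a))

/-- The upper right entry of `extMat`. -/
noncomputable def ext : SuperSym M →ₗ[ℂ] B where
  toFun x := extMat φ ψ d hd x 0 1
  map_add' x y := by simp
  map_smul' c x := by simp

theorem extMat_ι (a : M) : extMat φ ψ d hd (ι M a) = !![ψ (ι M a), d a; 0, φ (ι M a)] :=
  lift_ι _ _ a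

theorem extMat_eq (x : SuperSym M) : extMat φ ψ d hd x = !![ψ x, ext φ ψ d hd x; 0, φ x] := by
  have key : extMat φ ψ d hd x 0 0 = ψ x ∧ extMat φ ψ d hd x 1 0 = 0
      ∧ extMat φ ψ d hd x 1 1 = φ x := by
    induction x using induction with
    | algebraMap r => simp [Matrix.algebraMap_matrix_apply]
    | ι a => simp [extMat_ι]
    | mul a b ha hb =>
      obtain ⟨h1, h2, h3⟩ := ha
      obtain ⟨k1, k2, k3⟩ := hb
      simp [Matrix.mul_apply, Fin.sum_univ_two, h1, h2, h3, k1, k2, k3]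
    | add a b ha hb =>
      obtain ⟨h1, h2, h3⟩ := ha
      obtain ⟨k1, k2, k3⟩ := hb
      simp [h1, h2, h3, k1, k2, k3]
  obtain ⟨h1, h2, h3⟩ := key
  ext s t
  fin_cases s <;> fin_cases t
  · simpa using h1
  · simp [ext]
  · simpa using h2
  · simpa using h3

theorem ext_ι (a : M) : ext φ ψ d hd (ι M a) = d a := by
  simp [ext, extMat_ι]

theorem ext_mul (x y : SuperSym M) :
    ext φ ψ d hd (x * y) = ext φ ψ d hd x * φ y + ψ x * ext φ ψ d hd y := by
  have h := congrArg (fun m => m 0 1) (map_mul (extMat φ ψ d hd) x y)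
  simp only [extMat_eq, Matrix.mul_apply, Fin.sum_univ_two] at h
  simpa [add_comm] using h

theorem ext_algebraMap (r : ℂ) : ext φ ψ d hd (algebraMap ℂ _ r) = 0 := by
  simp [ext, Matrix.algebraMap_matrix_apply]

end

end SuperSym

end SuperSym

/-! ### Superalgebras of differential polynomials -/

section DiffSym

variable (M : Type*) [AddCommGroup M] [Module ℂ M] [Superspace M]

/-- The superalgebra of differential polynomials `S(ℂ[∂] ⊗ M)`. -/
abbrev DiffSym : Type _ := SuperSym (ℂ[X] ⊗[ℂ] M)

/-- `ℂ_diff[w_j | j ∈ J]`, where `w_j` has parity `par j`. -/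
abbrev DiffPoly {J : Type*} (par : J → ZMod 2) : Type _ := DiffSym (SuperFree par)

namespace DiffSym

/-- The inclusion of the differential generators, `a ↦ 1 ⊗ a`. -/
noncomputable def gen : M →ₗ[ℂ] DiffSym M :=
  SuperSym.ι _ ∘ₗ TensorProduct.mk ℂ ℂ[X] M 1

/-- Multiplication by `∂` on `ℂ[∂] ⊗ M`. -/
noncomputable def shift : ℂ[X] ⊗[ℂ] M →ₗ[ℂ] ℂ[X] ⊗[ℂ] M :=
  LinearMap.rTensor M (LinearMap.mulLeft ℂ (Polynomial.X : ℂ[X]))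

variable {M}

theorem sgn_shift (x : ℂ[X] ⊗[ℂ] M) : sgn _ (shift M x) = shift M (sgn _ x) := by
  rw [sgn_tensor]
  induction x with
  | zero => simp
  | tmul P a => simp [shift, sgn_polynomial]
  | add a b ha hb => simp only [map_add, ha, hb]

theorem shift_mem {i : ZMod 2} {x : ℂ[X] ⊗[ℂ] M} (hx : x ∈ part (M := ℂ[X] ⊗[ℂ] M) i) :
    shift M x ∈ part (M := ℂ[X] ⊗[ℂ] M) i := by
  rw [mem_part_iff] at hx ⊢
  rw [sgn_shift, hx, map_smul]

variable (M)

/-- The even derivation `∂` of `S(ℂ[∂] ⊗ M)`, with `∂(xy) = ∂(x) y + x ∂(y)`. -/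
noncomputable def der : DiffSym M →ₗ[ℂ] DiffSym M :=
  SuperSym.ext (AlgHom.id ℂ _) (AlgHom.id ℂ _) (SuperSym.ι _ ∘ₗ shift M) (by
    intro i j a b ha hb
    simp only [LinearMap.comp_apply, AlgHom.coe_id, id_eq]
    rw [SuperSym.ι_mul_ι (shift_mem ha) hb, SuperSym.ι_mul_ι ha (shift_mem hb), smul_add,
      add_comm])

variable {M}

theorem der_ι (x : ℂ[X] ⊗[ℂ] M) : der M (SuperSym.ι _ x) = SuperSym.ι _ (shift M x) :=
  SuperSym.ext_ι _ _ _ _ x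

theorem der_mul (x y : DiffSym M) : der M (x * y) = der M x * y + x * der M y :=
  SuperSym.ext_mul _ _ _ _ x y

theorem der_algebraMap (r : ℂ) : der M (algebraMap ℂ _ r) = 0 :=
  SuperSym.ext_algebraMap _ _ _ _ r

theorem inv_der (x : DiffSym M) : SuperSym.inv (der M x) = der M (SuperSym.inv x) := by
  induction x using SuperSym.induction with
  | algebraMap r => simp [der_algebraMap]
  | ι a => rw [der_ι, SuperSym.inv_ι, SuperSym.inv_ι, der_ι, sgn_shift]
  | mul a b ha hb => simp [der_mul, ha, hb]
  | add a b ha hb => simp only [map_add, ha, hb]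

theorem inv_gen (a : M) : SuperSym.inv (gen M a) = gen M (sgn M a) := by
  simp [gen, SuperSym.inv_ι, sgn_tensor, sgn_polynomial]

end DiffSym

end DiffSym

/-! ### Lie superalgebras -/

/-- A Lie superalgebra structure on a complex vector superspace. -/
class LieSuperalg (g : Type*) [AddCommGroup g] [Module ℂ g] [Superspace g] where
  br : g →ₗ[ℂ] g →ₗ[ℂ] g
  br_mem : ∀ {i j : ZMod 2} {a b : g}, a ∈ part (M := g) i → b ∈ part (M := g) j →
    br a b ∈ part (M := g) (i + j)
  br_skew : ∀ {i j : ZMod 2} {a b : g}, a ∈ part (M := g) i → b ∈ part (M := g) j →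
    br a b = -((-1 : ℂ) ^ (i.val * j.val) • br b a)
  br_jacobi : ∀ {i j : ZMod 2} {a b : g} (c : g), a ∈ part (M := g) i → b ∈ part (M := g) j →
    br a (br b c) = br (br a b) c + (-1 : ℂ) ^ (i.val * j.val) • br b (br a c)

open LieSuperalg

/-- A Lie superalgebra is simple if it is not abelian and has no graded ideals except
zero and itself. -/
def LieSuperalg.IsSimple (g : Type*) [AddCommGroup g] [Module ℂ g] [Superspace g]
    [LieSuperalg g] : Prop :=
  (∃ a b : g, br a b ≠ 0) ∧
    ∀ U : Submodule ℂ g, (∀ x ∈ U, sgn g x ∈ U) → (∀ a : g, ∀ x ∈ U, br a x ∈ U) →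
      U = ⊥ ∨ U = ⊤

/-- A nondegenerate invariant even supersymmetric bilinear form `( | )` on `g` together with an
even `sl₂`-triple `(e, h, f)` such that `(e | f) = 1`; then `(h | h) = 2` by invariance. -/
structure SlTriple (g : Type*) [AddCommGroup g] [Module ℂ g] [Superspace g]
    [LieSuperalg g] where
  form : LinearMap.BilinForm ℂ g
  form_nondegenerate : form.Nondegenerate
  form_even : ∀ {i j : ZMod 2} {a b : g}, a ∈ part (M := g) i → b ∈ part (M := g) j →
    i ≠ j → form a b = 0
  form_supersymm : ∀ {i j : ZMod 2} {a b : g}, a ∈ part (M := g) i → b ∈ part (M := g) j →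
    form a b = (-1 : ℂ) ^ (i.val * j.val) * form b a
  form_invariant : ∀ a b c : g, form (br a b) c = form a (br b c)
  e : g
  h : g
  f : g
  e_even : e ∈ part (M := g) 0
  h_even : h ∈ part (M := g) 0
  f_even : f ∈ part (M := g) 0
  br_h_e : br h e = (2 : ℂ) • e
  br_h_f : br h f = -((2 : ℂ) • f)
  br_e_f : br e f = h
  form_e_f : form e f = 1

namespace SlTriple

variable {g : Type*} [AddCommGroup g] [Module ℂ g] [Superspace g] [LieSuperalg g]
  (D : SlTriple g)

/-- The eigenspace `g(j/2)` of `ad (h/2)` for the eigenvalue `j/2`. -/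
def grade (j : ℤ) : Submodule ℂ g := LinearMap.ker (br D.h - (j : ℂ) • LinearMap.id)

/-- `n = ⨁_{i ≥ 1/2} g(i)`. -/
def n : Submodule ℂ g := ⨆ j ∈ {j : ℤ | 1 ≤ j}, D.grade j

/-- `m = ⨁_{i ≥ 1} g(i)`. -/
def m : Submodule ℂ g := ⨆ j ∈ {j : ℤ | 2 ≤ j}, D.grade j

/-- `p = ⨁_{i ≤ 1/2} g(i)`. -/
def p : Submodule ℂ g := ⨆ j ∈ {j : ℤ | j ≤ 1}, D.grade j

/-- `m^⊥ = {w | (w | v) = 0 for all v ∈ m}`. -/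
def mPerp : Submodule ℂ g where
  carrier := {w | ∀ v ∈ D.m, D.form w v = 0}
  add_mem' hx hy v hv := by simp [hx v hv, hy v hv]
  zero_mem' v _ := by simp
  smul_mem' c x hx v hv := by simp [hx v hv]

theorem sgn_br_h (x : g) : sgn g (br D.h x) = br D.h (sgn g x) := by
  have key : ∀ (i : ZMod 2) (x : g), x ∈ part (M := g) i →
      sgn g (br D.h x) = br D.h (sgn g x) := by
    intro i x hx
    have h := br_mem D.h_even hx
    rw [zero_add] at h
    rw [sgn_part h, sgn_part hx, map_smul]
  rw [← projEven_add_projOdd x]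
  simp only [map_add, key 0 _ (projEven_mem x), key 1 _ (projOdd_mem x)]

theorem sgn_mem_m {x : g} (hx : x ∈ D.m) : sgn g x ∈ D.m := by
  have h : D.m ≤ D.m.comap (sgn g) := by
    refine iSup₂_le fun j hj x hx => ?_
    refine Submodule.mem_iSup_of_mem j (Submodule.mem_iSup_of_mem hj ?_)
    have hx' : br D.h x = (j : ℂ) • x := by simpa [grade, sub_eq_zero] using hx
    simp [grade, ← sgn_br_h, hx']
  exact h hx

theorem form_f_sgn (x : g) : D.form D.f (sgn g x) = D.form D.f x := by
  have h1 : D.form D.f (projOdd g x) = 0 :=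
    D.form_even D.f_even (projOdd_mem x) (by decide)
  have h2 := congrArg (D.form D.f) (projEven_add_projOdd x)
  rw [← h2]
  simp [sgn, h1]

end SlTriple

/-! ### The affine Poisson vertex algebra -/

section Lambda

/-- A linear map on `B`, applied to the coefficients of elements of `B[λ]`. -/
noncomputable def mapCoeff {B : Type*} [Ring B] [Algebra ℂ B] (T : B →ₗ[ℂ] B) :
    B[X] →ₗ[ℂ] B[X] :=
  Polynomial.lsum fun n => ((Polynomial.monomial n).restrictScalars ℂ) ∘ₗ T

theorem mapCoeff_monomial {B : Type*} [Ring B] [Algebra ℂ B] (T : B →ₗ[ℂ] B) (n : ℕ) (b : B) :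
    mapCoeff T (Polynomial.monomial n b) = Polynomial.monomial n (T b) := by
  simp [mapCoeff, Polynomial.lsum_apply, Polynomial.sum_monomial_index]

variable {g : Type*} [AddCommGroup g] [Module ℂ g] [Superspace g] [LieSuperalg g]
  (D : SlTriple g) (k : ℂ)

/-- The operator `λ + ∂` on `S(ℂ[∂] ⊗ g)[λ]`. -/
noncomputable def lamAddDer : Module.End ℂ (DiffSym g)[X] :=
  LinearMap.mulLeft ℂ (Polynomial.X : (DiffSym g)[X]) + mapCoeff (DiffSym.der g)

/-- `[a_λ b] = [a, b] + λ k (a | b)` for `b ∈ g`. -/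
noncomputable def lamGen (a : g) : g →ₗ[ℂ] (DiffSym g)[X] where
  toFun b := Polynomial.C (DiffSym.gen g (br a b))
    + Polynomial.X * Polynomial.C (algebraMap ℂ (DiffSym g) (k * D.form a b))
  map_add' b c := by simp [mul_add, add_add_add_comm]
  map_smul' c b := by
    simp only [map_smul, smul_eq_mul, RingHom.id_apply, smul_add]
    congr 1
    · rw [Polynomial.smul_C]
    · rw [← mul_smul_comm, Polynomial.smul_C, Algebra.smul_def c, ← map_mul]
      ring_nf

/-- `[a_λ P(∂) b] = P(λ + ∂) [a_λ b]` on the generators `P(∂) ⊗ b ∈ ℂ[∂] ⊗ g`. -/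
noncomputable def lamLin (a : g) : ℂ[X] ⊗[ℂ] g →ₗ[ℂ] (DiffSym g)[X] :=
  TensorProduct.lift ((LinearMap.lcomp ℂ _ (lamGen D k a)) ∘ₗ
    (Polynomial.aeval (lamAddDer (g := g))).toLinearMap)

theorem lamLin_tmul (a : g) (P : ℂ[X]) (b : g) :
    lamLin D k a (P ⊗ₜ b) = Polynomial.aeval (lamAddDer (g := g)) P (lamGen D k a b) := by
  simp [lamLin]

/-- The parity involution on `S(ℂ[∂] ⊗ g)[λ]`, `λ` being even. -/
noncomputable def invPoly : (DiffSym g)[X] →ₐ[ℂ] (DiffSym g)[X] :=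
  Polynomial.mapAlgHom SuperSym.inv

theorem invPoly_lamAddDer (x : (DiffSym g)[X]) :
    invPoly (lamAddDer x) = lamAddDer (invPoly x) := by
  induction x using Polynomial.induction_on' with
  | add p q hp hq => simp only [map_add, hp, hq]
  | monomial n b =>
    simp [invPoly, lamAddDer, mapCoeff_monomial, DiffSym.inv_der, Polynomial.map_monomial]

theorem invPoly_aeval (P : ℂ[X]) (x : (DiffSym g)[X]) :
    invPoly (Polynomial.aeval (lamAddDer (g := g)) P x)
      = Polynomial.aeval (lamAddDer (g := g)) P (invPoly x) := by
  induction P using Polynomial.induction_on generalizing x with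
  | C c => simp [Module.algebraMap_end_apply]
  | add P Q hP hQ => simp [hP, hQ]
  | monomial n c h =>
    rw [pow_succ, ← mul_assoc, map_mul, Polynomial.aeval_X, Module.End.mul_apply,
      Module.End.mul_apply, h, invPoly_lamAddDer]

theorem invPoly_lamLin {i : ZMod 2} {a : g} (ha : a ∈ part (M := g) i) (x : ℂ[X] ⊗[ℂ] g) :
    invPoly (lamLin D k a x) = (-1 : ℂ) ^ i.val • lamLin D k a (sgn _ x) := by
  have key : ∀ (j : ZMod 2) (b : g), b ∈ part (M := g) j →
      invPoly (lamGen D k a b) = (-1 : ℂ) ^ i.val • lamGen D k a (sgn g b) := by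
    intro j b hb
    have h1 := sgn_part (br_mem ha hb)
    have hs : (-1 : ℂ) ^ (i + j).val = (-1 : ℂ) ^ i.val * (-1 : ℂ) ^ j.val := by
      have h11 : (1 + 1 : ZMod 2) = 0 := by decide
      rcases zmod2_cases i with rfl | rfl <;> rcases zmod2_cases j with rfl | rfl <;>
        simp [ZMod.val_one, h11]
    have h2 : D.form a b = (-1 : ℂ) ^ i.val * ((-1 : ℂ) ^ j.val * D.form a b) := by
      by_cases hij : i = j
      · subst hij
        rw [← mul_assoc, ← mul_pow]
        simp
      · simp [D.form_even ha hb hij]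
    have h3 : invPoly (lamGen D k a b) = Polynomial.C (DiffSym.gen g (sgn g (br a b)))
        + Polynomial.X * Polynomial.C (algebraMap ℂ (DiffSym g) (k * D.form a b)) := by
      simp [invPoly, lamGen, DiffSym.inv_gen]
    have h4 : (lamGen D k a) (sgn g b) = (-1 : ℂ) ^ j.val • lamGen D k a b := by
      rw [sgn_part hb, map_smul]
    rw [h3, h1, hs, h4, smul_smul]
    simp only [lamGen, LinearMap.coe_mk, AddHom.coe_mk, smul_add]
    congr 1
    · rw [map_smul, ← Polynomial.smul_C]
    · rw [← mul_smul_comm, Polynomial.smul_C, Algebra.smul_def (_ * _ : ℂ), ← map_mul]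
      congr 3
      nth_rewrite 1 [h2]
      ring
  rw [sgn_tensor]
  induction x with
  | zero => simp
  | tmul P b =>
    rw [TensorProduct.map_tmul, sgn_polynomial, lamLin_tmul, lamLin_tmul, invPoly_aeval,
      ← map_smul]
    congr 1
    rw [← projEven_add_projOdd b]
    simp only [map_add, smul_add, key 0 _ (projEven_mem b), key 1 _ (projOdd_mem b)]
  | add a b ha hb => simp only [map_add, smul_add, ha, hb]

theorem mul_C_ι (j : ZMod 2) {b : ℂ[X] ⊗[ℂ] g} (hb : b ∈ part (M := ℂ[X] ⊗[ℂ] g) j)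
    (x : (DiffSym g)[X]) :
    x * Polynomial.C (SuperSym.ι _ b) = Polynomial.C (SuperSym.ι _ b)
      * (invPoly ^ j.val : (DiffSym g)[X] →ₐ[ℂ] (DiffSym g)[X]) x := by
  induction x using Polynomial.induction_on' with
  | add p q hp hq => simp only [map_add, add_mul, mul_add, hp, hq]
  | monomial n c =>
    have h := SuperSym.mul_ι j hb c
    rcases zmod2_cases j with rfl | rfl
    · simp only [ZMod.val_zero, pow_zero, AlgHom.one_apply] at h ⊢
      rw [Polynomial.monomial_mul_C, Polynomial.C_mul_monomial, h]
    · simp only [ZMod.val_one, pow_one] at h ⊢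
      rw [Polynomial.monomial_mul_C, h]
      simp [invPoly, Polynomial.map_monomial, Polynomial.C_mul_monomial]

theorem lamLin_supercomm (i : ZMod 2) (a : g) (ha : a ∈ part (M := g) i) (s t : ZMod 2)
    (x y : ℂ[X] ⊗[ℂ] g) (hx : x ∈ part (M := ℂ[X] ⊗[ℂ] g) s)
    (hy : y ∈ part (M := ℂ[X] ⊗[ℂ] g) t) :
    lamLin D k a x * Polynomial.CAlgHom (R := ℂ) (SuperSym.ι _ y)
      + (Polynomial.CAlgHom.comp (SuperSym.inv ^ i.val : DiffSym g →ₐ[ℂ] DiffSym g))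
        (SuperSym.ι _ x) * lamLin D k a y
      = (-1 : ℂ) ^ (s.val * t.val) • (lamLin D k a y * Polynomial.CAlgHom (R := ℂ) (SuperSym.ι _ x)
      + (Polynomial.CAlgHom.comp (SuperSym.inv ^ i.val : DiffSym g →ₐ[ℂ] DiffSym g))
        (SuperSym.ι _ y) * lamLin D k a x) := by
  have hx' := mul_C_ι s hx (lamLin D k a y)
  have hy' := mul_C_ι t hy (lamLin D k a x)
  have ix := invPoly_lamLin D k ha x
  have iy := invPoly_lamLin D k ha y
  have jx := SuperSym.inv_ι x
  have jy := SuperSym.inv_ι y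
  rw [sgn_part hx] at ix jx
  rw [sgn_part hy] at iy jy
  simp only [AlgHom.comp_apply]
  change lamLin D k a x * Polynomial.C (SuperSym.ι _ y) + Polynomial.C
      ((SuperSym.inv ^ i.val : DiffSym g →ₐ[ℂ] DiffSym g) (SuperSym.ι _ x)) * lamLin D k a y
    = (-1 : ℂ) ^ (s.val * t.val) • (lamLin D k a y * Polynomial.C (SuperSym.ι _ x)
      + Polynomial.C
      ((SuperSym.inv ^ i.val : DiffSym g →ₐ[ℂ] DiffSym g) (SuperSym.ι _ y)) * lamLin D k a x)
  rw [hx', hy']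
  rcases zmod2_cases i with rfl | rfl <;> rcases zmod2_cases s with rfl | rfl <;>
    rcases zmod2_cases t with rfl | rfl <;>
    simp [ZMod.val_one, ix, iy, jx, jy] <;> abel

/-- The operator `{a_λ ·}` of the affine Poisson vertex algebra `S(ℂ[∂] ⊗ g)`, for `a ∈ g` of
parity `i`. It is determined by `{a_λ b} = [a, b] + λ k (a | b)` for `b ∈ g`, by sesquilinearity
`{a_λ ∂F} = (λ + ∂) {a_λ F}` on the generators, and by the Leibniz rule
`{a_λ FG} = {a_λ F} G + (-1)^{p(a)p(F)} F {a_λ G}`. -/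
noncomputable def lamBracket (i : ZMod 2) (a : g) (ha : a ∈ part (M := g) i) :
    DiffSym g →ₗ[ℂ] (DiffSym g)[X] :=
  SuperSym.ext Polynomial.CAlgHom
    (Polynomial.CAlgHom.comp (SuperSym.inv ^ i.val : DiffSym g →ₐ[ℂ] DiffSym g))
    (lamLin D k a) (lamLin_supercomm D k i a ha)

theorem lamBracket_mul (i : ZMod 2) (a : g) (ha : a ∈ part (M := g) i) (x y : DiffSym g) :
    lamBracket D k i a ha (x * y) = lamBracket D k i a ha x * Polynomial.C y
      + Polynomial.C ((SuperSym.inv ^ i.val : DiffSym g →ₐ[ℂ] DiffSym g) x)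
        * lamBracket D k i a ha y :=
  SuperSym.ext_mul _ _ _ _ x y

theorem lamBracket_gen (i : ZMod 2) (a : g) (ha : a ∈ part (M := g) i) (b : g) :
    lamBracket D k i a ha (DiffSym.gen g b) = Polynomial.C (DiffSym.gen g (br a b))
      + Polynomial.X * Polynomial.C (algebraMap ℂ (DiffSym g) (k * D.form a b)) := by
  have h := SuperSym.ext_ι Polynomial.CAlgHom
    (Polynomial.CAlgHom.comp (SuperSym.inv ^ i.val : DiffSym g →ₐ[ℂ] DiffSym g))
    (lamLin D k a) (lamLin_supercomm D k i a ha) ((1 : ℂ[X]) ⊗ₜ[ℂ] b)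
  rw [lamLin_tmul, map_one] at h
  exact h

end Lambda

/-! ### The W-superalgebra -/

section W

variable {g : Type*} [AddCommGroup g] [Module ℂ g] [Superspace g] [LieSuperalg g]
  (D : SlTriple g)

/-- The relations `∂^t (v + (f | v)) = 0` for `v ∈ m`; they generate the differential ideal `I`. -/
inductive VI.Rel : DiffSym g → DiffSym g → Prop
  | mk (t : ℕ) (v : g) (hv : v ∈ D.m) :
      Rel ((DiffSym.der g ^ t) (DiffSym.gen g v + algebraMap ℂ _ (D.form D.f v))) 0

/-- The differential superalgebra `V_I(p) = S(ℂ[∂] ⊗ g) / I`, where `I` is the differential ideal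
generated by the elements `v + (f | v)`, `v ∈ m`. -/
def VI : Type _ := RingQuot (VI.Rel D)

namespace VI

noncomputable instance : Ring (VI D) := inferInstanceAs (Ring (RingQuot (VI.Rel D)))

noncomputable instance : Algebra ℂ (VI D) := inferInstanceAs (Algebra ℂ (RingQuot (VI.Rel D)))

/-- The quotient map `S(ℂ[∂] ⊗ g) → V_I(p)`. -/
noncomputable def π : DiffSym g →ₐ[ℂ] VI D := RingQuot.mkAlgHom ℂ (VI.Rel D)

theorem π_surjective : Function.Surjective (π D) := RingQuot.mkAlgHom_surjective ℂ (VI.Rel D)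

theorem π_rel {x y : DiffSym g} (h : Rel D x y) : π D x = π D y := RingQuot.mkAlgHom_rel ℂ h

/-- Algebra maps out of `V_I(p)`. -/
noncomputable def lift {B : Type*} [Ring B] [Algebra ℂ B] (φ : DiffSym g →ₐ[ℂ] B)
    (hφ : ∀ ⦃x y⦄, Rel D x y → φ x = φ y) : VI D →ₐ[ℂ] B :=
  RingQuot.liftAlgHom ℂ ⟨φ, hφ⟩

theorem lift_π {B : Type*} [Ring B] [Algebra ℂ B] (φ : DiffSym g →ₐ[ℂ] B)
    (hφ : ∀ ⦃x y⦄, Rel D x y → φ x = φ y) (x : DiffSym g) : lift D φ hφ (π D x) = φ x :=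
  RingQuot.liftAlgHom_mkAlgHom_apply ℂ φ hφ x

/-- The parity involution of `V_I(p)` as an algebra map. -/
noncomputable def inv : VI D →ₐ[ℂ] VI D :=
  lift D ((π D).comp SuperSym.inv) (by
    rintro _ _ ⟨t, v, hv⟩
    have h : ∀ (t : ℕ) (x : DiffSym g), SuperSym.inv ((DiffSym.der g ^ t) x)
        = (DiffSym.der g ^ t) (SuperSym.inv x) := by
      intro t
      induction t with
      | zero => simp
      | succ t ih =>
        intro x
        rw [pow_succ, Module.End.mul_apply, ih, DiffSym.inv_der, Module.End.mul_apply]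
    rw [AlgHom.comp_apply, h, map_add, DiffSym.inv_gen, AlgHom.commutes, ← D.form_f_sgn,
      π_rel D (Rel.mk t _ (D.sgn_mem_m hv))]
    simp)

theorem inv_π (x : DiffSym g) : inv D (π D x) = π D (SuperSym.inv x) := lift_π D _ _ x

theorem inv_inv (x : VI D) : inv D (inv D x) = x := by
  obtain ⟨x, rfl⟩ := π_surjective D x
  rw [inv_π, inv_π, SuperSym.inv_inv]

/-- The `ℤ/2`-grading of `V_I(p)` induced by that of `S(ℂ[∂] ⊗ g)`. -/
noncomputable instance : Superspace (VI D) := ofInvolution (inv D).toLinearMap (inv_inv D)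

theorem sgn_π (x : DiffSym g) : sgn (VI D) (π D x) = π D (sgn _ x) := by
  have h : sgn (VI D) = (inv D).toLinearMap := sgn_ofInvolution _ (inv_inv D)
  rw [h, SuperSym.sgn_eq]
  exact inv_π D x

/-- The algebra map `F ↦ (π(F), π(∂F); 0, π(F))`. -/
noncomputable def derMatAux : DiffSym g →ₐ[ℂ] Matrix (Fin 2) (Fin 2) (VI D) :=
  AlgHom.ofLinearMap
    { toFun := fun x => !![π D x, π D (DiffSym.der g x); 0, π D x]
      map_add' := fun a b => by
        ext i j; fin_cases i <;> fin_cases j <;> simp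
      map_smul' := fun c a => by
        ext i j; fin_cases i <;> fin_cases j <;> simp }
    (by
      have h := DiffSym.der_algebraMap (M := g) 1
      rw [map_one] at h
      ext i j; fin_cases i <;> fin_cases j <;> simp [h])
    (by
      intro x y
      ext i j
      fin_cases i <;> fin_cases j <;>
        simp [Matrix.mul_apply, Fin.sum_univ_two, DiffSym.der_mul, add_comm])

theorem derMatAux_rel ⦃x y : DiffSym g⦄ (h : Rel D x y) : derMatAux D x = derMatAux D y := by
  obtain ⟨t, v, hv⟩ := h
  have h1 := π_rel D (Rel.mk t v hv)
  have h2 := π_rel D (Rel.mk (t + 1) v hv)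
  rw [pow_succ', Module.End.mul_apply] at h2
  rw [map_zero] at h1 h2
  ext i j
  fin_cases i <;> fin_cases j <;> simp only [derMatAux, AlgHom.ofLinearMap_apply, LinearMap.coe_mk,
    AddHom.coe_mk, h1, h2, map_zero] <;> rfl

/-- The algebra map on `V_I(p)` induced by `derMatAux`. -/
noncomputable def derMat : VI D →ₐ[ℂ] Matrix (Fin 2) (Fin 2) (VI D) :=
  lift D (derMatAux D) (derMatAux_rel D)

/-- The derivation `∂` of `V_I(p)` induced by that of `S(ℂ[∂] ⊗ g)`. -/
noncomputable def der : VI D →ₗ[ℂ] VI D where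
  toFun x := derMat D x 0 1
  map_add' x y := by simp
  map_smul' c x := by simp

theorem der_π (x : DiffSym g) : der D (π D x) = π D (DiffSym.der g x) := by
  have h := lift_π D _ (derMatAux_rel D) x
  exact congrArg (fun m => m 0 1) h

end VI

/-- The classical affine W-superalgebra `W(g, f, k) = (S(ℂ[∂] ⊗ g) / I)^{ad_λ n}`: the classes of
those `F` for which `{a_λ F} ∈ I[λ]` for all `a ∈ n`. Here `a` runs over the homogeneous elements
of `n`, which span `n`. -/
noncomputable def WAlg (k : ℂ) : Subalgebra ℂ (VI D) :=
  Subalgebra.map (VI.π D)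
    { carrier := {F | ∀ (i : ZMod 2) (a : g) (ha : a ∈ part (M := g) i), a ∈ D.n →
        Polynomial.map (VI.π D).toRingHom (lamBracket D k i a ha F) = 0}
      mul_mem' := fun {x y} hx hy i a ha hn => by
        rw [lamBracket_mul, Polynomial.map_add, Polynomial.map_mul, Polynomial.map_mul,
          hx i a ha hn, hy i a ha hn, zero_mul, mul_zero, add_zero]
      add_mem' := fun {x y} hx hy i a ha hn => by
        rw [map_add, Polynomial.map_add, hx i a ha hn, hy i a ha hn, add_zero]
      algebraMap_mem' := fun r i a ha _ => by
        have h : lamBracket D k i a ha (algebraMap ℂ _ r) = 0 :=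
          SuperSym.ext_algebraMap _ _ _ _ r
        rw [h, Polynomial.map_zero] }

end W

/-! ### Lax operators -/

section Lax

variable {g : Type*} [AddCommGroup g] [Module ℂ g] [Superspace g] [LieSuperalg g]

/-- The bracket `[a ⊗ F, b ⊗ G] = (-1)^{p(b)p(F)} [a, b] ⊗ FG` on `g ⊗ B`, for a superalgebra `B`:
`b` is split into its even and odd part, and `F` is replaced by `(-1)^{p(F)} F` for the odd one. -/
noncomputable def tensorBr (g : Type*) [AddCommGroup g] [Module ℂ g] [Superspace g] [LieSuperalg g]
    (B : Type*) [Ring B] [Algebra ℂ B] [Superspace B] :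
    g ⊗[ℂ] B →ₗ[ℂ] g ⊗[ℂ] B →ₗ[ℂ] g ⊗[ℂ] B :=
  TensorProduct.map₂ ((br (g := g)).compl₂ (projEven g)) (LinearMap.mul ℂ B)
    + TensorProduct.map₂ ((br (g := g)).compl₂ (projOdd g)) (LinearMap.mul ℂ B ∘ₗ sgn B)

theorem tensorBr_tmul {B : Type*} [Ring B] [Algebra ℂ B] [Superspace B] {i j : ZMod 2}
    (a : g) {b : g} {F : B} (G : B) (hb : b ∈ part (M := g) i) (hF : F ∈ part (M := B) j) :
    tensorBr g B (a ⊗ₜ F) (b ⊗ₜ G) = (-1 : ℂ) ^ (i.val * j.val) • (br a b ⊗ₜ (F * G)) := by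
  have hs := sgn_part hF
  rcases zmod2_cases i with rfl | rfl
  · have h1 : projEven g b = b :=
      Submodule.projection_apply_left (isCompl (M := g)) ⟨b, hb⟩
    have h2 : projOdd g b = 0 :=
      (Submodule.projection_apply_eq_zero_iff (isCompl (M := g)).symm).2 hb
    simp [tensorBr, h1, h2]
  · have h1 : projOdd g b = b :=
      Submodule.projection_apply_left (isCompl (M := g)).symm ⟨b, hb⟩
    have h2 : projEven g b = 0 :=
      (Submodule.projection_apply_eq_zero_iff (isCompl (M := g))).2 hb
    simp [tensorBr, h1, h2, hs, ZMod.val_one, TensorProduct.tmul_smul]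

variable (D : SlTriple g)

/-- The underlying space of `ℂ∂ ⋉ (g ⊗ V_I(p))`; the pair `(c, x)` stands for `c ∂ + x`. -/
abbrev SemiDir : Type _ := ℂ × (g ⊗[ℂ] VI D)

/-- For `X ∈ g ⊗ V_I(p)`, the operator `ad X` on `ℂ∂ ⋉ (g ⊗ V_I(p))`,
`[X, c ∂ + x] = -c ∂(X) + [X, x]`, where `∂(a ⊗ F) = a ⊗ ∂F`. -/
noncomputable def adOp (X : g ⊗[ℂ] VI D) : Module.End ℂ (SemiDir D) :=
  LinearMap.inr ℂ ℂ (g ⊗[ℂ] VI D) ∘ₗ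
    (tensorBr g (VI D) X ∘ₗ LinearMap.snd ℂ ℂ (g ⊗[ℂ] VI D)
      - (LinearMap.fst ℂ ℂ (g ⊗[ℂ] VI D)).smulRight ((VI.der D).lTensor g X))

/-- `e^{ad X} L = ∑ (1/t!) (ad X)^t L`. The sum is finite for `X ∈ n ⊗ V_I(p)`, when `ad X` is
nilpotent. -/
noncomputable def expAd (X : g ⊗[ℂ] VI D) (L : SemiDir D) : SemiDir D :=
  ∑ᶠ t : ℕ, ((t.factorial : ℂ)⁻¹) • ((adOp D X ^ t) L)

/-- The subspace `U ⊗ V_I(p)` of `g ⊗ V_I(p)`. -/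
noncomputable def tensorSub (U : Submodule ℂ g) : Submodule ℂ (g ⊗[ℂ] VI D) :=
  LinearMap.range (U.subtype.rTensor (VI D))

/-- The operator `k ∂ + q - f ⊗ 1`. -/
noncomputable def lax (k : ℂ) (q : g ⊗[ℂ] VI D) : SemiDir D := (k, q - D.f ⊗ₜ 1)

/-- `q_univ = ∑ q_i ⊗ q^i` for bases `{q_i}` of `m^⊥` and `{q^i}` of `p`. -/
noncomputable def qUniv {I : Type*} [Fintype I] (b : Module.Basis I ℂ D.mPerp)
    (b' : Module.Basis I ℂ D.p) : g ⊗[ℂ] VI D :=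
  ∑ i, (b i : g) ⊗ₜ[ℂ] VI.π D (DiffSym.gen g (b' i : g))

end Lax

set_option linter.unusedSectionVars false

/-! ### Differential superalgebras -/

namespace Superspace

variable {M : Type*} [AddCommGroup M] [Module ℂ M] [Superspace M]

/-! The argument is gauge fixing by degree. Let `q ∈ m^⊥ ⊗ B` be even, for any supercommutative
differential algebra `B`, and let `e^{ad X}`, with `X ∈ n ⊗ B` even, act on `k∂ + q - f ⊗ 1`.
Changing `X` in degrees `≥ d` changes the result by the bracket of `f ⊗ 1` with the change of `X`,
up to terms of degree `≥ d - 1` (`truncExp_sub_mem`). By `sl₂`-theory `ad f` is injective on `n`, so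
`m^⊥ = V_f ⊕ [f, n]` yields a linear map `ρ` that inverts `ad f` on `[f, n]`, kills `V_f` and raises
degrees by two (`SlTriple.exists_homotopy`). Hence `X ↦ X - ρ(q^X)`, where `q^X` is the transformed
`q`, gains one degree on differences. As the grading is bounded, iteration reaches a fixed point,
and fixed points are exactly the `X` with `q^X ∈ V_f ⊗ B`. This gives existence and uniqueness
(`SlTriple.Homotopy.exists_canonical`, `SlTriple.Homotopy.eq_of_canonical`).

The rest uses this over several algebras `B`, together with the fact that `V_I(p)` represents Lax
operators: an even `q ∈ m^⊥ ⊗ B` is the image of the universal one under a homomorphism `V_I(p) → B`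
(`VI.exists_evalHom`).

Freeness: take `B = ℂ_diff[x_j]` and `q = ∑ v_j ⊗ x_j`, which is already canonical. The homomorphism
`ψ` that it defines sends the universal `X` to an element that brings `q` to canonical form, so to
zero by uniqueness. Thus `ψ(w^j) = x_j`, and `ψ` is a left inverse of `x_j ↦ w^j`.

The `w^j` lie in `W`: adjoin `ε` of parity `p(a)` with `∂ε = ελ`. Then `F ↦ ε {a_λ F}` becomes an
even derivation commuting with `∂`, and on the universal Lax operator it acts as `ad(-a ⊗ ε)`.
Conjugation by `e^{ad X}` makes it act on the canonical form as some `ad U` with `U ∈ n ⊗ B`. An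
infinitesimal gauge transformation that stays in `V_f ⊗ B` is zero, so `{a_λ w^j}` vanishes
(`derivation_canonical_eq_zero`, `lamVI_canonical`).

Nothing else lies in `W`: the path `e^{t ad X} L` defines a homomorphism `τ : V_I(p) → V_I(p)[t]`.
Its `t`-derivative is the gauge derivation of `X`, which is assembled from the brackets `{a_λ ·}`
with `a ∈ n` and so kills `W`. For `F ∈ W` the polynomial `τ(F)` is therefore constant. Its value at
`t = 0` is `F`, and at `t = 1` it is a differential polynomial in the `w^j` (`exists_gaugePath`,
`exists_gaugeDerivation`, `mem_of_mem_WAlg`). -/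

theorem projEven_eq (x : M) : projEven M x = (1 / 2 : ℂ) • (x + sgn M x) := by
  have h1 := projEven_add_projOdd x
  have h2 : sgn M x = projEven M x - projOdd M x := rfl
  rw [h2]
  nth_rewrite 2 [← h1]
  module

theorem projOdd_eq (x : M) : projOdd M x = (1 / 2 : ℂ) • (x - sgn M x) := by
  have h1 := projEven_add_projOdd x
  have h2 : sgn M x = projEven M x - projOdd M x := rfl
  rw [h2]
  nth_rewrite 2 [← h1]
  module

theorem mem_part_zero {x : M} : x ∈ part (M := M) 0 ↔ sgn M x = x := by
  simp [mem_part_iff]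

theorem mem_part_of_sgn_comm {N : Type*} [AddCommGroup N] [Module ℂ N] [Superspace N]
    (T : M →ₗ[ℂ] N) (hT : ∀ x, sgn N (T x) = T (sgn M x)) {i : ZMod 2} {x : M}
    (hx : x ∈ part (M := M) i) : T x ∈ part (M := N) i := by
  rw [mem_part_iff] at hx ⊢
  rw [hT, hx, map_smul]

theorem sgn_tmul {N : Type*} [AddCommGroup N] [Module ℂ N] [Superspace N] (a : M) (b : N) :
    sgn (M ⊗[ℂ] N) (a ⊗ₜ b) = sgn M a ⊗ₜ sgn N b := by
  rw [sgn_tensor, TensorProduct.map_tmul]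

theorem tmul_mem_even {N : Type*} [AddCommGroup N] [Module ℂ N] [Superspace N] {i : ZMod 2}
    {a : M} {b : N} (ha : a ∈ part (M := M) i) (hb : b ∈ part (M := N) i) :
    sgn (M ⊗[ℂ] N) (a ⊗ₜ b) = a ⊗ₜ b := by
  rw [sgn_tmul, sgn_part ha, sgn_part hb, TensorProduct.smul_tmul_smul, ← mul_pow]
  simp

end Superspace

/-- A supercommutative algebra with an even derivation. The supercommutativity
`x y = (-1)^{p(x)p(y)} y x` is written for `y = y₀ + y₁` in terms of the parity involution. -/
class DiffSuperalg (B : Type*) [Ring B] [Algebra ℂ B] [Superspace B] where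
  der : B →ₗ[ℂ] B
  der_mul : ∀ x y : B, der (x * y) = der x * y + x * der y
  sgn_mul : ∀ x y : B, sgn B (x * y) = sgn B x * sgn B y
  sgn_one : sgn B (1 : B) = 1
  sgn_der : ∀ x : B, sgn B (der x) = der (sgn B x)
  supercomm : ∀ x y : B, (2 : ℂ) • (x * y) = (y + sgn B y) * x + (y - sgn B y) * sgn B x

namespace DiffSuperalg

variable {B : Type*} [Ring B] [Algebra ℂ B] [Superspace B] [DiffSuperalg B]

theorem der_one : der (1 : B) = 0 := by
  have h := der_mul (1 : B) 1
  simpa using h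

theorem der_algebraMap (r : ℂ) : der (algebraMap ℂ B r) = 0 := by
  rw [Algebra.algebraMap_eq_smul_one, map_smul, der_one, smul_zero]

theorem sgn_algebraMap (r : ℂ) : sgn B (algebraMap ℂ B r) = algebraMap ℂ B r := by
  rw [Algebra.algebraMap_eq_smul_one, map_smul, sgn_one]

variable (B) in
/-- The parity involution as an algebra map. -/
noncomputable def sgnHom : B →ₐ[ℂ] B := AlgHom.ofLinearMap (sgn B) sgn_one sgn_mul

theorem sgnHom_apply (x : B) : sgnHom B x = sgn B x := rfl

theorem mul_even (x : B) {y : B} (hy : y ∈ part (M := B) 0) : x * y = y * x := by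
  have h := supercomm x y
  rw [sgn_even hy, sub_self, zero_mul, add_zero, ← two_smul ℂ y, smul_mul_assoc] at h
  exact smul_right_injective B (two_ne_zero' ℂ) h

theorem mul_odd (x : B) {y : B} (hy : y ∈ part (M := B) 1) : x * y = y * sgn B x := by
  have h := supercomm x y
  rw [sgn_odd hy, add_neg_cancel, zero_mul, zero_add, sub_neg_eq_add, ← two_smul ℂ y,
    smul_mul_assoc] at h
  exact smul_right_injective B (two_ne_zero' ℂ) h

theorem mul_comm_of_mem {i j : ZMod 2} {x y : B} (hx : x ∈ part (M := B) i)
    (hy : y ∈ part (M := B) j) : x * y = (-1 : ℂ) ^ (i.val * j.val) • (y * x) := by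
  rcases zmod2_cases j with rfl | rfl
  · simp [mul_even x hy]
  · rw [mul_odd x hy, sgn_part hx]
    simp [ZMod.val_one]

theorem mul_mem_part {i j : ZMod 2} {x y : B} (hx : x ∈ part (M := B) i)
    (hy : y ∈ part (M := B) j) : x * y ∈ part (M := B) (i + j) := by
  rw [mem_part_iff, sgn_mul, sgn_part hx, sgn_part hy, smul_mul_smul_comm]
  have h11 : (1 + 1 : ZMod 2) = 0 := by decide
  rcases zmod2_cases i with rfl | rfl <;> rcases zmod2_cases j with rfl | rfl <;>
    simp [ZMod.val_one, h11]

theorem one_mem_part : (1 : B) ∈ part (M := B) 0 := mem_part_zero.2 sgn_one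

theorem der_mem_part {i : ZMod 2} {x : B} (hx : x ∈ part (M := B) i) :
    der x ∈ part (M := B) i :=
  mem_part_of_sgn_comm (M := B) (N := B) (der (B := B)) sgn_der hx

end DiffSuperalg

/-- Homomorphisms of differential superalgebras. -/
def IsDiffSuperHom {B B' : Type*} [Ring B] [Algebra ℂ B] [Superspace B] [DiffSuperalg B]
    [Ring B'] [Algebra ℂ B'] [Superspace B'] [DiffSuperalg B'] (φ : B →ₐ[ℂ] B') : Prop :=
  (∀ x : B, φ ((DiffSuperalg.der : B →ₗ[ℂ] B) x) = (DiffSuperalg.der : B' →ₗ[ℂ] B') (φ x)) ∧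
    ∀ x : B, φ (sgn B x) = sgn B' (φ x)

open DiffSuperalg

/-! ### The subspaces `U ⊗ B` -/

section TSub

variable {M : Type*} [AddCommGroup M] [Module ℂ M] (B : Type*) [AddCommGroup B] [Module ℂ B]

/-- The subspace `U ⊗ B` of `M ⊗ B`. -/
noncomputable def tSub (U : Submodule ℂ M) : Submodule ℂ (M ⊗[ℂ] B) :=
  LinearMap.range (U.subtype.rTensor B)

variable {B}

theorem tmul_mem_tSub {U : Submodule ℂ M} {u : M} (hu : u ∈ U) (G : B) : u ⊗ₜ G ∈ tSub B U :=
  ⟨(⟨u, hu⟩ : U) ⊗ₜ G, by simp⟩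

@[elab_as_elim]
theorem tSub_induction {U : Submodule ℂ M} {motive : ∀ x : M ⊗[ℂ] B, x ∈ tSub B U → Prop}
    (zero : motive 0 (zero_mem _))
    (add : ∀ x y hx hy, motive x hx → motive y hy → motive (x + y) (add_mem hx hy))
    (tmul : ∀ u (hu : u ∈ U) (G : B), motive (u ⊗ₜ G) (tmul_mem_tSub hu G))
    {x : M ⊗[ℂ] B} (hx : x ∈ tSub B U) : motive x hx := by
  suffices h : ∃ h, motive x h from h.2
  obtain ⟨x, rfl⟩ := hx
  induction x with
  | zero => simpa using zero
  | tmul u G => exact ⟨_, tmul u u.2 G⟩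
  | add a b ha hb =>
    obtain ⟨h1, h2⟩ := ha
    obtain ⟨h3, h4⟩ := hb
    simp only [map_add]
    exact ⟨add_mem h1 h3, add _ _ h1 h3 h2 h4⟩

theorem tSub_mono {U U' : Submodule ℂ M} (h : U ≤ U') : tSub B U ≤ tSub B U' := by
  intro x hx
  induction hx using tSub_induction with
  | zero => exact zero_mem _
  | add x y _ _ hx hy => exact add_mem hx hy
  | tmul u hu G => exact tmul_mem_tSub (h hu) G

theorem tSub_top : tSub B (⊤ : Submodule ℂ M) = ⊤ := by
  rw [eq_top_iff]
  intro x _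
  induction x with
  | zero => exact zero_mem _
  | tmul u G => exact tmul_mem_tSub Submodule.mem_top G
  | add a b ha hb => exact add_mem (ha trivial) (hb trivial)

theorem tSub_bot : tSub B (⊥ : Submodule ℂ M) = ⊥ := by
  rw [eq_bot_iff]
  intro x hx
  induction hx using tSub_induction with
  | zero => exact zero_mem _
  | add x y _ _ hx hy => exact add_mem hx hy
  | tmul u hu G => simp [(Submodule.mem_bot ℂ).1 hu]

theorem rTensor_mem_tSub {M' : Type*} [AddCommGroup M'] [Module ℂ M'] {U : Submodule ℂ M}
    {U' : Submodule ℂ M'} (T : M →ₗ[ℂ] M') (hT : ∀ u ∈ U, T u ∈ U') {x : M ⊗[ℂ] B}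
    (hx : x ∈ tSub B U) : T.rTensor B x ∈ tSub B U' := by
  induction hx using tSub_induction with
  | zero => simp
  | add x y _ _ hx hy => rw [map_add]; exact add_mem hx hy
  | tmul u hu G => exact tmul_mem_tSub (hT u hu) G

theorem lTensor_mem_tSub {B' : Type*} [AddCommGroup B'] [Module ℂ B'] {U : Submodule ℂ M}
    (T : B →ₗ[ℂ] B') {x : M ⊗[ℂ] B} (hx : x ∈ tSub B U) : T.lTensor M x ∈ tSub B' U := by
  induction hx using tSub_induction with
  | zero => simp
  | add x y _ _ hx hy => rw [map_add]; exact add_mem hx hy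
  | tmul u hu G => exact tmul_mem_tSub hu _

theorem exists_sum_of_mem_tSub {J : Type*} [Fintype J] {U : Submodule ℂ M}
    (q : Module.Basis J ℂ U) {x : M ⊗[ℂ] B} (hx : x ∈ tSub B U) :
    ∃ w : J → B, x = ∑ j, (q j : M) ⊗ₜ w j := by
  induction hx using tSub_induction with
  | zero => exact ⟨0, by simp⟩
  | add x y _ _ hx hy =>
    obtain ⟨w, rfl⟩ := hx
    obtain ⟨w', rfl⟩ := hy
    exact ⟨w + w', by simp [TensorProduct.tmul_add, Finset.sum_add_distrib]⟩
  | tmul u hu G =>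
    refine ⟨fun j => q.repr ⟨u, hu⟩ j • G, ?_⟩
    have h := congrArg (fun y : U => (y : M)) (q.sum_repr ⟨u, hu⟩)
    simp only [Submodule.coe_sum, Submodule.coe_smul] at h
    simp only [TensorProduct.tmul_smul]
    conv_lhs => rw [← h]
    simp [TensorProduct.sum_tmul, TensorProduct.smul_tmul']

/-- A left inverse of the map `c ↦ ∑ c_j v_j` extracts the coefficient of each `v_j`, also after
tensoring with `B`. -/
theorem sum_tmul_injective {J : Type*} [Fintype J] {v : J → M} (hv : LinearIndependent ℂ v)
    {w w' : J → B} (h : ∑ j, v j ⊗ₜ[ℂ] w j = ∑ j, v j ⊗ₜ[ℂ] w' j) : w = w' := by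
  classical
  obtain ⟨T, hT⟩ := (Fintype.linearCombination ℂ v).exists_leftInverse_of_injective
    (LinearMap.ker_eq_bot.2 hv.fintypeLinearCombination_injective)
  have hTv : ∀ j i, T (v j) i = if j = i then 1 else 0 := by
    intro j i
    have h1 := congrArg (fun f => f i) (LinearMap.congr_fun hT (Pi.single j 1))
    simpa [Fintype.linearCombination_apply, Pi.single_apply, eq_comm] using h1
  funext i
  have h2 := congrArg (TensorProduct.lid ℂ B ∘ (LinearMap.proj i ∘ₗ T).rTensor B) h
  simpa [hTv, ite_smul] using h2

end TSub

/-! ### Even elements of a tensor product. -/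

section EvenInduction

variable {M : Type*} [AddCommGroup M] [Module ℂ M] [Superspace M]
  {B : Type*} [AddCommGroup B] [Module ℂ B] [Superspace B]

/-- The average `½ (y + sgn y)` of a pure tensor is `u₀ ⊗ G₀ + u₁ ⊗ G₁`, and an even element is its
own average. So even elements are sums of `a ⊗ F` with `p(a) = p(F)`, and stability of `U` under
parity keeps the factors `a` in `U`. -/
theorem even_tSub_induction {U : Submodule ℂ M} (hU : ∀ u ∈ U, sgn M u ∈ U)
    {motive : M ⊗[ℂ] B → Prop} (zero : motive 0)
    (add : ∀ x y, motive x → motive y → motive (x + y))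
    (tmul : ∀ (i : ZMod 2) (a : M) (F : B), a ∈ U → a ∈ part (M := M) i → F ∈ part (M := B) i →
      motive (a ⊗ₜ F)) {x : M ⊗[ℂ] B} (hx : x ∈ tSub B U) (he : sgn _ x = x) : motive x := by
  have key : ∀ y ∈ tSub B U, motive ((1 / 2 : ℂ) • (y + sgn _ y)) := by
    intro y hy
    induction hy using tSub_induction with
    | zero => simpa using zero
    | add x y _ _ hx hy =>
      have := add _ _ hx hy
      rw [← smul_add] at this
      rwa [map_add, add_add_add_comm]
    | tmul u hu G =>
      have h : (1 / 2 : ℂ) • (u ⊗ₜ[ℂ] G + sgn _ (u ⊗ₜ[ℂ] G))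
          = projEven M u ⊗ₜ projEven B G + projOdd M u ⊗ₜ projOdd B G := by
        have h1 := projEven_add_projOdd u
        have h2 := projEven_add_projOdd G
        have h3 : sgn M u = projEven M u - projOdd M u := rfl
        have h4 : sgn B G = projEven B G - projOdd B G := rfl
        rw [sgn_tmul, h3, h4]
        nth_rewrite 1 [← h1]
        nth_rewrite 1 [← h2]
        simp only [TensorProduct.add_tmul, TensorProduct.tmul_add, TensorProduct.sub_tmul,
          TensorProduct.tmul_sub]
        module
      rw [h]
      refine add _ _ (tmul 0 _ _ ?_ (projEven_mem u) (projEven_mem G))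
        (tmul 1 _ _ ?_ (projOdd_mem u) (projOdd_mem G))
      · rw [projEven_eq]
        exact U.smul_mem _ (U.add_mem hu (hU u hu))
      · rw [projOdd_eq]
        exact U.smul_mem _ (U.sub_mem hu (hU u hu))
  have h := key x hx
  rw [he] at h
  convert h using 1
  module

@[elab_as_elim]
theorem even_induction {motive : ∀ x : M ⊗[ℂ] B, sgn _ x = x → Prop} (zero : motive 0 (map_zero _))
    (add : ∀ x y hx hy, motive x hx → motive y hy → motive (x + y) (by rw [map_add, hx, hy]))
    (tmul : ∀ (i : ZMod 2) (a : M) (F : B) (ha : a ∈ part (M := M) i) (hF : F ∈ part (M := B) i),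
      motive (a ⊗ₜ F) (tmul_mem_even ha hF)) {x : M ⊗[ℂ] B} (he : sgn _ x = x) : motive x he := by
  suffices h : ∃ h, motive x h from h.2
  exact even_tSub_induction (U := ⊤) (motive := fun x => ∃ h, motive x h) (fun _ _ => trivial)
    ⟨_, zero⟩ (fun x y hx hy => ⟨_, add x y hx.1 hy.1 hx.2 hy.2⟩)
    (fun i a F _ ha hF => ⟨_, tmul i a F ha hF⟩) (by rw [tSub_top]; trivial) he

theorem homogeneous_left_induction {motive : M ⊗[ℂ] B → Prop} (zero : motive 0)
    (add : ∀ x y, motive x → motive y → motive (x + y))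
    (tmul : ∀ (i : ZMod 2) (a : M) (F : B), a ∈ part (M := M) i → motive (a ⊗ₜ F))
    (x : M ⊗[ℂ] B) : motive x := by
  induction x with
  | zero => exact zero
  | tmul a F =>
    rw [← projEven_add_projOdd a, TensorProduct.add_tmul]
    exact add _ _ (tmul 0 _ _ (projEven_mem a)) (tmul 1 _ _ (projOdd_mem a))
  | add x y hx hy => exact add _ _ hx hy

theorem sgn_lTensor {B' : Type*} [AddCommGroup B'] [Module ℂ B'] [Superspace B']
    (T : B →ₗ[ℂ] B') (hT : ∀ x, T (sgn B x) = sgn B' (T x)) (x : M ⊗[ℂ] B) :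
    sgn _ (T.lTensor M x) = T.lTensor M (sgn _ x) := by
  induction x with
  | zero => simp
  | tmul a F => simp [sgn_tmul, hT]
  | add x y hx hy => simp only [map_add, hx, hy]

end EvenInduction

/-! ### The Lie superalgebra `ℂ∂ ⋉ (g ⊗ B)` -/

section TensorBr

variable {g : Type*} [AddCommGroup g] [Module ℂ g] [Superspace g] [LieSuperalg g]
  {B : Type*} [Ring B] [Algebra ℂ B] [Superspace B] [DiffSuperalg B]

theorem sgn_tensorBr {X Y : g ⊗[ℂ] B} (hX : sgn _ X = X) (hY : sgn _ Y = Y) :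
    sgn _ (tensorBr g B X Y) = tensorBr g B X Y := by
  induction hX using even_induction with
  | zero => simp
  | add x y _ _ hx hy => simp only [map_add, LinearMap.add_apply, hx, hy]
  | tmul i a F ha hF =>
    induction hY using even_induction with
    | zero => simp
    | add x y _ _ hx hy => simp only [map_add, hx, hy]
    | tmul j b G hb hG =>
      rw [tensorBr_tmul a G hb hF, map_smul, tmul_mem_even (br_mem ha hb) (mul_mem_part hF hG)]

theorem tensorBr_skew {X Y : g ⊗[ℂ] B} (hX : sgn _ X = X) (hY : sgn _ Y = Y) :
    tensorBr g B X Y = -tensorBr g B Y X := by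
  induction hX using even_induction with
  | zero => simp
  | add x y _ _ hx hy => simp only [map_add, LinearMap.add_apply, hx, hy, neg_add]
  | tmul i a F ha hF =>
    induction hY using even_induction with
    | zero => simp
    | add x y _ _ hx hy => simp only [map_add, LinearMap.add_apply, hx, hy, neg_add]
    | tmul j b G hb hG =>
      rw [tensorBr_tmul a G hb hF, tensorBr_tmul b F ha hG, br_skew ha hb,
        mul_comm_of_mem hF hG]
      rcases zmod2_cases i with rfl | rfl <;> rcases zmod2_cases j with rfl | rfl <;>
        simp [ZMod.val_one, TensorProduct.neg_tmul, TensorProduct.tmul_neg]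

/-- Only `X` and `Y` need to be even. Then `p(a) = p(F)` in each summand, so the Koszul signs of `g`
and of `B` cancel and the ordinary Jacobi identity remains. -/
theorem tensorBr_jacobi {X Y : g ⊗[ℂ] B} (hX : sgn _ X = X) (hY : sgn _ Y = Y) (z : g ⊗[ℂ] B) :
    tensorBr g B (tensorBr g B X Y) z
      = tensorBr g B X (tensorBr g B Y z) - tensorBr g B Y (tensorBr g B X z) := by
  induction hX using even_induction with
  | zero => simp
  | add x y _ _ hx hy => simp only [map_add, LinearMap.add_apply, hx, hy]; abel
  | tmul i a F ha hF =>
    induction hY using even_induction with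
    | zero => simp
    | add x y _ _ hx hy => simp only [map_add, LinearMap.add_apply, hx, hy]; abel
    | tmul j b G hb hG =>
      induction z using homogeneous_left_induction with
      | zero => simp
      | add x y hx hy => simp only [map_add, hx, hy]; abel
      | tmul l c H hc =>
        rw [tensorBr_tmul a G hb hF, tensorBr_tmul b H hc hG, tensorBr_tmul a H hc hF]
        simp only [map_smul, LinearMap.smul_apply]
        rw [tensorBr_tmul _ H hc (mul_mem_part hF hG), tensorBr_tmul a _ (br_mem hb hc) hF,
          tensorBr_tmul b _ (br_mem ha hc) hG, ← mul_assoc G F H, mul_comm_of_mem hG hF,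
          br_jacobi c ha hb]
        have h11 : (1 + 1 : ZMod 2) = 0 := by decide
        rcases zmod2_cases i with rfl | rfl <;> rcases zmod2_cases j with rfl | rfl <;>
          rcases zmod2_cases l with rfl | rfl <;>
          simp [ZMod.val_one, h11, TensorProduct.neg_tmul, TensorProduct.tmul_neg,
            TensorProduct.add_tmul, mul_assoc]

/-- An even derivation of `B` acts on `g ⊗ B` by derivations. -/
theorem lTensor_tensorBr (δ : B →ₗ[ℂ] B) (hδ : ∀ x y, δ (x * y) = δ x * y + x * δ y)
    (hs : ∀ x, δ (sgn B x) = sgn B (δ x)) {X : g ⊗[ℂ] B} (hX : sgn _ X = X) (z : g ⊗[ℂ] B) :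
    δ.lTensor g (tensorBr g B X z)
      = tensorBr g B (δ.lTensor g X) z + tensorBr g B X (δ.lTensor g z) := by
  induction hX using even_induction with
  | zero => simp
  | add x y _ _ hx hy => simp only [map_add, LinearMap.add_apply, hx, hy]; abel
  | tmul i a F ha hF =>
    induction z using homogeneous_left_induction with
    | zero => simp
    | add x y hx hy => simp only [map_add, hx, hy]; abel
    | tmul l c H hc =>
      have hF' := mem_part_of_sgn_comm δ (fun x => (hs x).symm) hF
      simp only [LinearMap.lTensor_tmul]
      rw [tensorBr_tmul a H hc hF, tensorBr_tmul a H hc hF', tensorBr_tmul a _ hc hF, map_smul,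
        LinearMap.lTensor_tmul, hδ, TensorProduct.tmul_add, smul_add]

theorem map_tensorBr {B' : Type*} [Ring B'] [Algebra ℂ B'] [Superspace B']
    (φ : B →ₐ[ℂ] B') (hs : ∀ x, φ (sgn B x) = sgn B' (φ x)) (X z : g ⊗[ℂ] B) :
    φ.toLinearMap.lTensor g (tensorBr g B X z)
      = tensorBr g B' (φ.toLinearMap.lTensor g X) (φ.toLinearMap.lTensor g z) := by
  induction X with
  | zero => simp
  | add x y hx hy => simp only [map_add, LinearMap.add_apply, hx, hy]
  | tmul a F =>
    induction z with
    | zero => simp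
    | add x y hx hy => simp only [map_add, hx, hy]
    | tmul c H => simp [tensorBr, hs]

theorem tensorBr_mem {U U' U'' : Submodule ℂ g} (h : ∀ x ∈ U, ∀ y ∈ U', br x y ∈ U'')
    (hU' : ∀ y ∈ U', sgn g y ∈ U') {X z : g ⊗[ℂ] B} (hX : X ∈ tSub B U) (hz : z ∈ tSub B U') :
    tensorBr g B X z ∈ tSub B U'' := by
  induction hX using tSub_induction with
  | zero => simp
  | add x y _ _ hx hy => simp only [map_add, LinearMap.add_apply]; exact add_mem hx hy
  | tmul a ha F =>
    induction hz using tSub_induction with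
    | zero => simp
    | add x y _ _ hx hy => simp only [map_add]; exact add_mem hx hy
    | tmul c hc H =>
      have h0 : projEven g c ∈ U' := by
        rw [projEven_eq]; exact U'.smul_mem _ (U'.add_mem hc (hU' c hc))
      have h1 : projOdd g c ∈ U' := by
        rw [projOdd_eq]; exact U'.smul_mem _ (U'.sub_mem hc (hU' c hc))
      simp only [tensorBr, LinearMap.add_apply, TensorProduct.map₂_apply_tmul]
      exact add_mem (tmul_mem_tSub (h _ ha _ h0) _) (tmul_mem_tSub (h _ ha _ h1) _)

theorem tensorBr_tmul_one (a : g) (z : g ⊗[ℂ] B) :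
    tensorBr g B (a ⊗ₜ 1) z = (br a).rTensor B z := by
  induction z using homogeneous_left_induction with
  | zero => simp
  | add x y hx hy => simp only [map_add, hx, hy]
  | tmul l c H hc => rw [tensorBr_tmul a H hc one_mem_part]; simp

/-- For `X ∈ g ⊗ B`, the operator `ad X` on `ℂ∂ ⋉ (g ⊗ B)`. -/
noncomputable def adG (X : g ⊗[ℂ] B) : Module.End ℂ (ℂ × (g ⊗[ℂ] B)) :=
  LinearMap.inr ℂ ℂ (g ⊗[ℂ] B) ∘ₗ
    (tensorBr g B X ∘ₗ LinearMap.snd ℂ ℂ (g ⊗[ℂ] B)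
      - (LinearMap.fst ℂ ℂ (g ⊗[ℂ] B)).smulRight ((der (B := B)).lTensor g X))

theorem adG_apply (X : g ⊗[ℂ] B) (v : ℂ × (g ⊗[ℂ] B)) :
    adG X v = (0, tensorBr g B X v.2 - v.1 • (der (B := B)).lTensor g X) := by
  simp [adG]

theorem adG_add (X Y : g ⊗[ℂ] B) : adG (X + Y) = adG X + adG Y := by
  ext v <;> simp [adG_apply]; abel

theorem adG_sub (X Y : g ⊗[ℂ] B) : adG (X - Y) = adG X - adG Y := by
  refine LinearMap.ext fun v => ?_
  rw [LinearMap.sub_apply]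
  simp only [adG_apply, map_sub, LinearMap.sub_apply, smul_sub, Prod.mk_sub_mk, sub_zero]
  congr 1
  abel

theorem adG_smul (c : ℂ) (X : g ⊗[ℂ] B) : adG (c • X) = c • adG X := by
  refine LinearMap.ext fun v => ?_
  rw [LinearMap.smul_apply]
  simp only [adG_apply, map_smul, LinearMap.smul_apply, Prod.smul_mk, smul_zero, smul_sub]
  rw [smul_comm]

theorem sgn_lTensor_der {X : g ⊗[ℂ] B} (hX : sgn _ X = X) :
    sgn _ ((der (B := B)).lTensor g X) = (der (B := B)).lTensor g X := by
  rw [sgn_lTensor _ (fun x => (sgn_der x).symm), hX]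

theorem adG_tensorBr {X Y : g ⊗[ℂ] B} (hX : sgn _ X = X) (hY : sgn _ Y = Y) :
    adG (tensorBr g B X Y) = adG X * adG Y - adG Y * adG X := by
  refine LinearMap.ext fun v => ?_
  have h1 := lTensor_tensorBr (der (B := B)) der_mul (fun x => (sgn_der x).symm) hX Y
  have h2 := tensorBr_skew (sgn_lTensor_der hX) hY
  simp only [LinearMap.sub_apply, Module.End.mul_apply, adG_apply, tensorBr_jacobi hX hY, h1, h2,
    Prod.mk_sub_mk, map_sub, map_smul, sub_zero, zero_smul, smul_add]
  congr 1
  module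

/-- `c ∂ + z ↦ δ z` for a linear map `δ` of `B`. -/
noncomputable def derG (g : Type*) [AddCommGroup g] [Module ℂ g] (δ : B →ₗ[ℂ] B) :
    Module.End ℂ (ℂ × (g ⊗[ℂ] B)) :=
  LinearMap.inr ℂ ℂ (g ⊗[ℂ] B) ∘ₗ δ.lTensor g ∘ₗ LinearMap.snd ℂ ℂ (g ⊗[ℂ] B)

theorem derG_apply (δ : B →ₗ[ℂ] B) (v : ℂ × (g ⊗[ℂ] B)) : derG g δ v = (0, δ.lTensor g v.2) := by
  simp [derG]

/-- A derivation of the bracket satisfies `[δ, ad X] = ad(δX)`. That `δ` commutes with `∂` is needed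
for the component `c ∂` of the semidirect product. -/
theorem derG_mul_adG (δ : B →ₗ[ℂ] B) (hδ : ∀ x y, δ (x * y) = δ x * y + x * δ y)
    (hs : ∀ x, δ (sgn B x) = sgn B (δ x)) (hd : ∀ x, δ (der x) = der (δ x))
    {X : g ⊗[ℂ] B} (hX : sgn _ X = X) :
    derG g δ * adG X - adG X * derG g δ = adG (δ.lTensor g X) := by
  refine LinearMap.ext fun v => ?_
  have h1 : δ.lTensor g ((der (B := B)).lTensor g X) = (der (B := B)).lTensor g (δ.lTensor g X) :=
      by
    rw [← LinearMap.lTensor_comp_apply, ← LinearMap.lTensor_comp_apply]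
    congr 2
    ext x
    exact hd x
  simp only [LinearMap.sub_apply, Module.End.mul_apply, adG_apply, derG_apply,
    lTensor_tensorBr δ hδ hs hX, h1, Prod.mk_sub_mk, map_sub, map_smul, sub_zero, zero_smul]
  congr 1
  abel

/-- The map of `ℂ∂ ⋉ (g ⊗ B)` induced by a map of `B`. -/
noncomputable def mapG {B B' : Type*} [Ring B] [Algebra ℂ B] [Ring B'] [Algebra ℂ B'] (g : Type*)
    [AddCommGroup g] [Module ℂ g] (φ : B →ₐ[ℂ] B') :
    ℂ × (g ⊗[ℂ] B) →ₗ[ℂ] ℂ × (g ⊗[ℂ] B') :=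
  LinearMap.prodMap LinearMap.id (φ.toLinearMap.lTensor g)

theorem mapG_adG {B' : Type*} [Ring B'] [Algebra ℂ B'] [Superspace B'] [DiffSuperalg B']
    {φ : B →ₐ[ℂ] B'} (hφ : IsDiffSuperHom φ) (X : g ⊗[ℂ] B) (v : ℂ × (g ⊗[ℂ] B)) :
    mapG g φ (adG X v) = adG (φ.toLinearMap.lTensor g X) (mapG g φ v) := by
  have h1 : φ.toLinearMap.lTensor g ((der (B := B)).lTensor g X)
      = (der (B := B')).lTensor g (φ.toLinearMap.lTensor g X) := by
    rw [← LinearMap.lTensor_comp_apply, ← LinearMap.lTensor_comp_apply]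
    congr 2
    ext x
    exact hφ.1 x
  simp [mapG, adG_apply, map_tensorBr φ hφ.2, h1]

end TensorBr

/-! ### Pairing with elements of `g` -/

section Pairing

variable {g : Type*} [AddCommGroup g] [Module ℂ g] [Superspace g] [LieSuperalg g]
  (D : SlTriple g) {B : Type*} [Ring B] [Algebra ℂ B]

/-- `c ⊗ G ↦ (c | y) G`. -/
noncomputable def pairing (y : g) : g ⊗[ℂ] B →ₗ[ℂ] B :=
  (TensorProduct.lid ℂ B).toLinearMap ∘ₗ (D.form.flip y).rTensor B

@[simp]
theorem pairing_tmul (y c : g) (G : B) : pairing D y (c ⊗ₜ G) = D.form c y • G := by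
  simp [pairing]

variable (B) in
/-- `pairing` as a linear map in the element of `g`. -/
noncomputable def pairingL : g →ₗ[ℂ] g ⊗[ℂ] B →ₗ[ℂ] B where
  toFun y := pairing D y
  map_add' x y := by
    ext c G; simp [add_smul]
  map_smul' a x := by
    ext c G; simp [mul_smul]

theorem pairingL_apply (y : g) (x : g ⊗[ℂ] B) : pairingL D B y x = pairing D y x := rfl

theorem pairing_lTensor {B' : Type*} [Ring B'] [Algebra ℂ B'] (T : B →ₗ[ℂ] B') (y : g)
    (x : g ⊗[ℂ] B) : pairing D y (T.lTensor g x) = T (pairing D y x) := by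
  induction x with
  | zero => simp
  | tmul c G => simp
  | add a b ha hb => simp only [map_add, ha, hb]

theorem pairing_eq_zero {y : g} {U : Submodule ℂ g} (hU : ∀ u ∈ U, D.form u y = 0)
    {x : g ⊗[ℂ] B} (hx : x ∈ tSub B U) : pairing D y x = 0 := by
  induction hx using tSub_induction with
  | zero => simp
  | add x y _ _ hx hy => simp [hx, hy]
  | tmul u hu G => simp [hU u hu]

theorem form_sgn (x y : g) : D.form (sgn g x) y = D.form x (sgn g y) := by
  have h01 := D.form_even (projEven_mem x) (projOdd_mem y) (by decide)
  have h10 := D.form_even (projOdd_mem x) (projEven_mem y) (by decide)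
  have h3 : sgn g x = projEven g x - projOdd g x := rfl
  have h4 : sgn g y = projEven g y - projOdd g y := rfl
  rw [h3, h4]
  conv_lhs => rw [← projEven_add_projOdd y]
  conv_rhs => rw [← projEven_add_projOdd x]
  simp [h01, h10, sub_eq_add_neg]

theorem pairing_sgn_apply [Superspace B] (y : g) (x : g ⊗[ℂ] B) :
    pairing D (sgn g y) x = sgn B (pairing D y (sgn _ x)) := by
  induction x with
  | zero => simp
  | tmul c G => simp [sgn_tmul, sgn_sgn, form_sgn]
  | add a b ha hb => simp only [map_add, ha, hb]

theorem pairing_sgn [Superspace B] (y : g) {x : g ⊗[ℂ] B} (hx : sgn _ x = x) :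
    pairing D (sgn g y) x = sgn B (pairing D y x) := by
  rw [pairing_sgn_apply, hx]

/-- With `b` the dual basis of `c` under the form, `x = ∑ b_i ⊗ (x | c_i)`, so the pairings recover
`x`. Identities in `g ⊗ B` can thus be tested on the generators of `V_I(p)`. -/
theorem eq_of_pairing_eq [FiniteDimensional ℂ g] {x x' : g ⊗[ℂ] B}
    (h : ∀ y, pairing D y x = pairing D y x') : x = x' := by
  let c := Module.finBasis ℂ g
  let b := D.form.dualBasis D.form_nondegenerate c
  have key : ∀ x : g ⊗[ℂ] B, ∑ i, b i ⊗ₜ[ℂ] pairing D (c i) x = x := by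
    intro x
    induction x with
    | zero => simp
    | add x y hx hy =>
      simp only [map_add, TensorProduct.tmul_add, Finset.sum_add_distrib, hx, hy]
    | tmul u G =>
      have h1 := b.sum_repr u
      simp only [b, LinearMap.BilinForm.dualBasis_repr_apply] at h1
      simp only [pairing_tmul, TensorProduct.tmul_smul, TensorProduct.smul_tmul', b,
        ← TensorProduct.sum_tmul, h1]
  rw [← key x, ← key x']
  simp only [h]

/-- Invariance of the form moves `ad a` to the other argument. The sign of skew-symmetry and the
sign in the bracket of `g ⊗ B` cancel. This identity matches the gauge action on Lax operators with
the bracket `{a_λ y}` on generators. -/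
theorem pairing_tensorBr [Superspace B] [DiffSuperalg B] {i : ZMod 2} {a : g} {ε : B}
    (ha : a ∈ part (M := g) i) (hε : ε ∈ part (M := B) i) (y : g) (x : g ⊗[ℂ] B) :
    pairing D y (tensorBr g B (a ⊗ₜ ε) x) = -(ε * pairing D (br a y) x) := by
  induction x using homogeneous_left_induction with
  | zero => simp
  | add a b ha hb => simp only [map_add, ha, hb, mul_add, neg_add]
  | tmul l c G hc =>
    rw [tensorBr_tmul a G hc hε, br_skew ha hc, map_smul, pairing_tmul, pairing_tmul, map_neg,
      LinearMap.neg_apply, map_smul, LinearMap.smul_apply, D.form_invariant]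
    rcases zmod2_cases i with rfl | rfl <;> rcases zmod2_cases l with rfl | rfl <;>
      simp [ZMod.val_one]

end Pairing

/-! ### The grading of `g` -/

section Grading

variable {g : Type*} [AddCommGroup g] [Module ℂ g] [Superspace g] [LieSuperalg g]

theorem br_even_jacobi {a : g} (ha : a ∈ part (M := g) 0) (b c : g) :
    br a (br b c) = br (br a b) c + br b (br a c) := by
  have h0 := br_jacobi c ha (projEven_mem b)
  have h1 := br_jacobi c ha (projOdd_mem b)
  rw [← projEven_add_projOdd b]
  simp only [map_add, LinearMap.add_apply, h0, h1, ZMod.val_zero, zero_mul, pow_zero, one_smul]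
  abel

theorem br_even_skew {a : g} (ha : a ∈ part (M := g) 0) (b : g) : br a b = -br b a := by
  have h0 := br_skew ha (projEven_mem b)
  have h1 := br_skew ha (projOdd_mem b)
  rw [← projEven_add_projOdd b]
  simp only [map_add, LinearMap.add_apply, h0, h1, ZMod.val_zero, zero_mul, pow_zero, one_smul]
  abel

theorem sgn_br_even {a : g} (ha : a ∈ part (M := g) 0) (x : g) :
    sgn g (br a x) = br a (sgn g x) := by
  have key : ∀ (i : ZMod 2) (x : g), x ∈ part (M := g) i →
      sgn g (br a x) = br a (sgn g x) := by
    intro i x hx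
    have h := br_mem ha hx
    rw [zero_add] at h
    rw [sgn_part h, sgn_part hx, map_smul]
  rw [← projEven_add_projOdd x]
  simp only [map_add, key 0 _ (projEven_mem x), key 1 _ (projOdd_mem x)]

namespace SlTriple

variable (D : SlTriple g)

theorem mem_grade {j : ℤ} {x : g} : x ∈ D.grade j ↔ br D.h x = (j : ℂ) • x := by
  simp [grade, sub_eq_zero]

theorem br_mem_grade {i j : ℤ} {x y : g} (hx : x ∈ D.grade i) (hy : y ∈ D.grade j) :
    br x y ∈ D.grade (i + j) := by
  rw [mem_grade] at hx hy ⊢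
  rw [br_even_jacobi D.h_even, hx, hy]
  simp [add_smul]

theorem sgn_mem_grade {j : ℤ} {x : g} (hx : x ∈ D.grade j) : sgn g x ∈ D.grade j := by
  rw [mem_grade] at hx ⊢
  rw [← D.sgn_br_h, hx, map_smul]

/-- `ad h` is skew for the form, so `(i + j)(x | y) = 0`. -/
theorem form_grade {i j : ℤ} {x y : g} (hx : x ∈ D.grade i) (hy : y ∈ D.grade j)
    (hij : i + j ≠ 0) : D.form x y = 0 := by
  rw [mem_grade] at hx hy
  have h1 := D.form_invariant x D.h y
  have h2 := br_even_skew D.h_even x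
  rw [← neg_eq_iff_eq_neg] at h2
  rw [← h2, hx, hy] at h1
  simp only [map_neg, map_smul, LinearMap.neg_apply, LinearMap.smul_apply, smul_eq_mul] at h1
  have h3 : ((i + j : ℤ) : ℂ) * D.form x y = 0 := by
    push_cast
    linear_combination -h1
  exact (mul_eq_zero.1 h3).resolve_left (by exact_mod_cast hij)

theorem f_mem_grade : D.f ∈ D.grade (-2) := by
  rw [mem_grade, D.br_h_f]
  simp

/-- `g_{≥ d}`, the sum of the eigenspaces of `ad h` for the eigenvalues `j ≥ d`. -/
def gradeGE (d : ℤ) : Submodule ℂ g := ⨆ j ∈ {j : ℤ | d ≤ j}, D.grade j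

variable {D}

theorem grade_le_gradeGE {d j : ℤ} (h : d ≤ j) : D.grade j ≤ D.gradeGE d :=
  le_iSup₂_of_le j h le_rfl

theorem gradeGE_le {d : ℤ} {U : Submodule ℂ g} (h : ∀ j, d ≤ j → D.grade j ≤ U) :
    D.gradeGE d ≤ U :=
  iSup₂_le fun j hj => h j hj

theorem gradeGE_anti {d d' : ℤ} (h : d ≤ d') : D.gradeGE d' ≤ D.gradeGE d :=
  gradeGE_le fun _ hj => grade_le_gradeGE (h.trans hj)

theorem sgn_mem_gradeGE {d : ℤ} {x : g} (hx : x ∈ D.gradeGE d) : sgn g x ∈ D.gradeGE d := by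
  have h : D.gradeGE d ≤ (D.gradeGE d).comap (sgn g) :=
    gradeGE_le fun j hj x hx => grade_le_gradeGE hj (D.sgn_mem_grade hx)
  exact h hx

theorem br_mem_gradeGE {i j : ℤ} {x y : g} (hx : x ∈ D.gradeGE i) (hy : y ∈ D.gradeGE j) :
    br x y ∈ D.gradeGE (i + j) := by
  have h1 : ∀ s, i ≤ s → ∀ x ∈ D.grade s, D.gradeGE j ≤ (D.gradeGE (i + j)).comap (br x) :=
    fun s hs x hx => gradeGE_le fun t ht y hy =>
      grade_le_gradeGE (add_le_add hs ht) (D.br_mem_grade hx hy)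
  have h2 : D.gradeGE i ≤ (D.gradeGE (i + j)).comap (br.flip y) :=
    gradeGE_le fun s hs x hx => h1 s hs x hx hy
  exact h2 hx

theorem form_gradeGE {i j : ℤ} (hij : 0 < i + j) {x y : g} (hx : x ∈ D.gradeGE i)
    (hy : y ∈ D.gradeGE j) : D.form x y = 0 := by
  have h1 : ∀ s, i ≤ s → ∀ x ∈ D.grade s, D.gradeGE j ≤ LinearMap.ker (D.form x) :=
    fun s hs x hx => gradeGE_le fun t ht y hy => D.form_grade hx hy (by omega)
  have h2 : D.gradeGE i ≤ LinearMap.ker (D.form.flip y) :=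
    gradeGE_le fun s hs x hx => h1 s hs x hx hy
  exact h2 hx

theorem gradeGE_neg_one_le_mPerp : D.gradeGE (-1) ≤ D.mPerp :=
  fun _ hx _ hv => form_gradeGE (by norm_num) hx hv

theorem f_mem_gradeGE : D.f ∈ D.gradeGE (-2) := grade_le_gradeGE le_rfl D.f_mem_grade

theorem form_f_p {y : g} (hy : y ∈ D.p) : D.form D.f y = 0 := by
  have h : D.p ≤ LinearMap.ker (D.form D.f) := iSup₂_le fun j hj y hy =>
    D.form_grade D.f_mem_grade hy (by have : j ≤ 1 := hj; omega)
  exact h hy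

/-! ### Injectivity of `ad f` on `n`, and the decomposition of `g` by `ad h`. -/

section FiniteDimensional

variable [FiniteDimensional ℂ g]

attribute [local instance] LieRing.ofAssociativeRing in
/-- A vector of positive weight that is killed by `ad f` is zero. -/
theorem eq_zero_of_br_f_eq_zero_of_mem_grade {j : ℤ} (hj : 1 ≤ j) {z : g} (hz : z ∈ D.grade j)
    (hf : br D.f z = 0) : z = 0 := by
  by_contra hne
  rw [mem_grade] at hz
  have hj0 : (j : ℂ) ≠ 0 := by exact_mod_cast (by omega : j ≠ 0)
  have comm : ∀ a ∈ part (M := g) 0, ∀ b : g, ⁅(br a : Module.End ℂ g), br b⁆ = br (br a b) := by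
    intro a ha b
    ext c
    simp [Ring.lie_def, br_even_jacobi ha b c]
  -- In the reversed triple `ad f` is the raising operator, so `z` is a primitive vector of weight
  -- `-j`. Such a weight is a natural number in finite dimension, against `j ≥ 1`.
  have t : IsSl2Triple (L := Module.End ℂ g) (-br D.h) (br D.f) (br D.e) :=
    { h_ne_zero := fun h0 => by
        have h1 := LinearMap.congr_fun h0 z
        simp [hz, hj0, hne] at h1
      lie_e_f := by rw [comm _ D.f_even, br_even_skew D.f_even, D.br_e_f, map_neg]
      lie_h_e_nsmul := by
        rw [neg_lie, comm _ D.h_even, D.br_h_f, map_neg, neg_neg, map_smul, two_smul, two_nsmul]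
      lie_h_f_nsmul := by
        rw [neg_lie, comm _ D.h_even, D.br_h_e, map_smul, two_smul, two_nsmul] }
  have hp : IsSl2Triple.HasPrimitiveVectorWith t z (-(j : ℂ)) :=
    { ne_zero := hne
      lie_h := by simp [hz]
      lie_e := by simpa using hf }
  obtain ⟨n, hn⟩ := hp.exists_nat
  have h1 : (-j : ℤ) = n := by exact_mod_cast hn
  omega

/-- The elements of `n` killed by `ad f` form an `ad h`-stable space. If it were nonzero it would
contain an eigenvector of `ad h`, which reduces the claim to vectors of a single weight. -/
theorem eq_zero_of_br_f_eq_zero {z : g} (hz : z ∈ D.n) (hf : br D.f z = 0) : z = 0 := by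
  set K : Submodule ℂ g := LinearMap.ker (br D.f) ⊓ D.gradeGE 1 with hK
  suffices h : K = ⊥ by
    have : z ∈ K := ⟨hf, hz⟩
    simpa [h] using this
  by_contra hne
  have hinv : ∀ x ∈ K, br D.h x ∈ K := by
    rintro x ⟨hx1, hx2⟩
    refine ⟨?_, ?_⟩
    · have hx1' : br D.f x = 0 := hx1
      have h1 := br_even_jacobi D.h_even D.f x
      rw [hx1', D.br_h_f] at h1
      have h2 : br D.f (br D.h x) = 0 := by
        simpa [hx1'] using h1.symm
      exact h2
    · have h : D.gradeGE 1 ≤ (D.gradeGE 1).comap (br D.h) := gradeGE_le fun j hj x hx => by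
        rw [Submodule.mem_comap, (D.mem_grade).1 hx]
        exact Submodule.smul_mem _ _ (grade_le_gradeGE hj hx)
      exact h hx2
  have : Nontrivial K := Submodule.nontrivial_iff_ne_bot.2 hne
  obtain ⟨μ, hμ⟩ := Module.End.exists_eigenvalue ((br D.h).restrict hinv)
  obtain ⟨v, hv⟩ := hμ.exists_hasEigenvector
  have hv1 : br D.h (v : g) = μ • (v : g) := by
    have := congrArg (fun x : K => (x : g)) hv.apply_eq_smul
    simpa using this
  have hv0 : (v : g) ≠ 0 := fun h => hv.2 (Subtype.ext h)
  -- An eigenvector in `n` has an integral eigenvalue `≥ 1`: `n` is a sum of such eigenspaces, and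
  -- these are independent of every other eigenspace.
  by_cases hj : ∃ j : ℤ, 1 ≤ j ∧ μ = j
  · obtain ⟨j, hj, rfl⟩ := hj
    exact hv0 (eq_zero_of_br_f_eq_zero_of_mem_grade hj ((D.mem_grade).2 hv1) v.2.1)
  · have hind := Module.End.eigenspaces_iSupIndep (br D.h : Module.End ℂ g) μ
    have h1 : D.gradeGE 1 ≤ ⨆ ν, ⨆ (_ : ν ≠ μ), Module.End.eigenspace (br D.h) ν :=
      gradeGE_le fun j hj1 x hx => by
        refine Submodule.mem_iSup_of_mem (j : ℂ) (Submodule.mem_iSup_of_mem ?_ ?_)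
        · rintro rfl
          exact hj ⟨j, hj1, rfl⟩
        · exact Module.End.mem_eigenspace_iff.2 ((D.mem_grade).1 hx)
    exact hv0 ((Submodule.disjoint_def.1 hind) _ (Module.End.mem_eigenspace_iff.2 hv1) (h1 v.2.2))

/-- A functional that vanishes on `p + m` is `(w | ·)` for some `w`. Vanishing on `m` puts `w` into
`m^⊥`, and vanishing on the basis of `p` kills all coordinates of `w` in the dual basis. So the dual
bases already force `g` to be spanned by integral weight spaces of `ad h`. -/
theorem p_sup_m {I : Type*} [Fintype I] [DecidableEq I] (b : Module.Basis I ℂ D.mPerp)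
    (b' : Module.Basis I ℂ D.p)
    (hdual : ∀ i j, D.form (b i : g) (b' j : g) = if i = j then 1 else 0) : D.p ⊔ D.m = ⊤ := by
  by_contra hne
  obtain ⟨φ, hφ0, hφ⟩ := Submodule.exists_le_ker_of_lt_top _ (lt_top_iff_ne_top.2 hne)
  obtain ⟨w, rfl⟩ := (D.form.toDual D.form_nondegenerate).surjective φ
  have hw : ∀ x ∈ D.p ⊔ D.m, D.form w x = 0 := fun x hx => by
    have := hφ hx
    simpa [LinearMap.BilinForm.toDual_def] using this
  have hwm : w ∈ D.mPerp := fun v hv => hw v (Submodule.mem_sup_right hv)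
  apply hφ0
  have h0 : (⟨w, hwm⟩ : D.mPerp) = 0 := by
    rw [← b.sum_repr ⟨w, hwm⟩]
    refine Finset.sum_eq_zero fun j _ => ?_
    have h1 := hw (b' j) (Submodule.mem_sup_left (b' j).2)
    have h2 : w = ∑ i, b.repr ⟨w, hwm⟩ i • (b i : g) := by
      have := congrArg (fun y : D.mPerp => (y : g)) (b.sum_repr ⟨w, hwm⟩)
      simp only [AddSubmonoidClass.coe_finsetSum, Submodule.coe_smul] at this
      exact this.symm
    rw [h2] at h1
    have h3 : b.repr ⟨w, hwm⟩ j = 0 := by simpa [hdual] using h1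
    rw [h3, zero_smul]
  have h4 : w = 0 := congrArg (fun y : D.mPerp => (y : g)) h0
  rw [h4, map_zero]

/-- Split `w ∈ m^⊥` into `u` of degrees `≤ -2` and `v` of degrees `≥ -1`. Then `u` is orthogonal to
`p` by degree and to `m` because `w` and `v` are, so `u = 0` by nondegeneracy. -/
theorem mPerp_eq (h : D.p ⊔ D.m = ⊤) : D.mPerp = D.gradeGE (-1) := by
  refine le_antisymm (fun w hw => ?_) gradeGE_neg_one_le_mPerp
  have hp : D.p ≤ (⨆ j ∈ {j : ℤ | j ≤ -2}, D.grade j) ⊔ D.gradeGE (-1) := iSup₂_le fun j _ => by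
    rcases le_or_gt j (-2) with hj | hj
    · exact le_sup_of_le_left (le_iSup₂_of_le j hj le_rfl)
    · exact le_sup_of_le_right (grade_le_gradeGE (by omega))
  have htop : (⨆ j ∈ {j : ℤ | j ≤ -2}, D.grade j) ⊔ D.gradeGE (-1) = ⊤ := by
    rw [eq_top_iff, ← h]
    exact sup_le hp (le_sup_of_le_right (gradeGE_anti (by norm_num)))
  obtain ⟨u, hu, v, hv, rfl⟩ := Submodule.mem_sup.1 (htop ▸ Submodule.mem_top : w ∈ _)
  have hum : u ∈ D.mPerp := by
    have := D.mPerp.sub_mem hw (gradeGE_neg_one_le_mPerp hv)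
    simpa using this
  have hup : ∀ y ∈ D.p, D.form u y = 0 := by
    intro y hy
    have h1 : ∀ s, s ≤ -2 → ∀ x ∈ D.grade s, D.p ≤ LinearMap.ker (D.form x) :=
      fun s hs x hx => iSup₂_le fun t ht y hy => D.form_grade hx hy (by
        have : t ≤ 1 := ht
        omega)
    have h2 : (⨆ j ∈ {j : ℤ | j ≤ -2}, D.grade j) ≤ LinearMap.ker (D.form.flip y) :=
      iSup₂_le fun s hs x hx => h1 s hs x hx hy
    exact h2 hu
  have hu0 : u = 0 := by
    refine D.form_nondegenerate.1 u fun y => ?_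
    obtain ⟨y1, hy1, y2, hy2, rfl⟩ := Submodule.mem_sup.1 (h ▸ Submodule.mem_top : y ∈ _)
    rw [map_add, hup y1 hy1, hum y2 hy2, add_zero]
  rw [hu0, zero_add]
  exact hv

/-- `ad h` has finitely many eigenvalues. This bound `M` makes the degree inductions stop and `ad X`
nilpotent. -/
theorem exists_gradeGE_eq (h : D.p ⊔ D.m = ⊤) :
    ∃ M : ℕ, D.gradeGE (-M) = ⊤ ∧ D.gradeGE M = ⊥ := by
  have hfin : Set.Finite {j : ℤ | D.grade j ≠ ⊥} := by
    refine Set.Finite.of_finite_image (f := fun j : ℤ => (j : ℂ)) ?_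
      (fun _ _ _ _ h => Int.cast_injective h)
    refine (Module.End.finite_hasEigenvalue (br D.h : Module.End ℂ g)).subset ?_
    rintro _ ⟨j, hj, rfl⟩
    obtain ⟨v, hv, hv0⟩ := Submodule.exists_mem_ne_zero_of_ne_bot hj
    exact Module.End.hasEigenvalue_of_hasEigenvector
      ⟨Module.End.mem_eigenspace_iff.2 ((D.mem_grade).1 hv), hv0⟩
  obtain ⟨M, hM⟩ : ∃ M : ℕ, ∀ j : ℤ, D.grade j ≠ ⊥ → -(M : ℤ) ≤ j ∧ j < M := by
    obtain ⟨a, ha⟩ := hfin.bddAbove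
    obtain ⟨c, hc⟩ := hfin.bddBelow
    refine ⟨a.natAbs + c.natAbs + 1, fun j hj => ?_⟩
    have h1 := ha hj
    have h2 := hc hj
    omega
  refine ⟨M, ?_, ?_⟩
  · rw [eq_top_iff, ← h]
    have key : ∀ j, D.grade j ≤ D.gradeGE (-M) := by
      intro j
      by_cases hj : D.grade j = ⊥
      · simp [hj]
      · exact grade_le_gradeGE (hM j hj).1
    exact sup_le (iSup₂_le fun j _ => key j) (iSup₂_le fun j _ => key j)
  · rw [eq_bot_iff]
    refine gradeGE_le fun j hj => ?_
    by_contra h1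
    have := (hM j fun h2 => h1 (by simp [h2])).2
    omega

end FiniteDimensional

end SlTriple

/-! ### Projecting `m^⊥ = V_f ⊕ [f, n]` to `n` -/

/-- A linear map that inverts `ad f` on `[f, n]` and is zero on `V_f`. -/
structure SlTriple.Homotopy (D : SlTriple g) (Vf : Submodule ℂ g) where
  toFun : g →ₗ[ℂ] g
  apply_br_f : ∀ z ∈ D.n, toFun (br D.f z) = z
  apply_Vf : ∀ u ∈ Vf, toFun u = 0
  apply_sgn : ∀ x ∈ D.gradeGE (-1), toFun (sgn g x) = sgn g (toFun x)
  mem_gradeGE : ∀ j, -1 ≤ j → ∀ x ∈ D.gradeGE j, toFun x ∈ D.gradeGE (j + 2)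
  sub_br_f_mem : ∀ x ∈ D.gradeGE (-1), x - br D.f (toFun x) ∈ Vf

/-- The sum `V_f ⊕ [f, n]` is direct and `ad f` is injective on `n`, so an element `u + [f, z]` of
`m^⊥` determines `z`. Since `V_f` and `n` are stable under `ad h` and parity, the assignment of `z`
respects both gradings. -/
theorem SlTriple.exists_homotopy [FiniteDimensional ℂ g] {D : SlTriple g} (h : D.p ⊔ D.m = ⊤)
    {Vf : Submodule ℂ g} (hVh : ∀ v ∈ Vf, br D.h v ∈ Vf) (hVs : ∀ v ∈ Vf, sgn g v ∈ Vf)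
    (hVdisj : Disjoint Vf (D.n.map (br D.f))) (hVsup : Vf ⊔ D.n.map (br D.f) = D.mPerp) :
    Nonempty (D.Homotopy Vf) := by
  have hinj : ∀ u ∈ Vf, ∀ z ∈ D.n, u + br D.f z = 0 → u = 0 ∧ z = 0 := by
    intro u hu z hz h0
    have hu' : u = br D.f (-z) := by rw [map_neg]; exact eq_neg_of_add_eq_zero_left h0
    have hu0 : u = 0 := Submodule.disjoint_def.1 hVdisj u hu
      (hu' ▸ Submodule.mem_map_of_mem (D.n.neg_mem hz))
    refine ⟨hu0, eq_zero_of_br_f_eq_zero hz ?_⟩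
    rwa [hu0, zero_add] at h0
  -- A left inverse of `(u, z) ↦ u + [f, z]`. Its values outside `m^⊥` are arbitrary and never
  -- matter.
  obtain ⟨T, hT⟩ := ((Vf.subtype).coprod ((br D.f).domRestrict D.n)).exists_leftInverse_of_injective
    (by
      rw [LinearMap.ker_eq_bot']
      rintro ⟨u, z⟩ h0
      obtain ⟨h1, h2⟩ := hinj u u.2 z z.2 (by simpa using h0)
      exact Prod.ext (Subtype.ext h1) (Subtype.ext h2))
  set ρ : g →ₗ[ℂ] g := D.n.subtype ∘ₗ LinearMap.snd ℂ _ _ ∘ₗ T with hρ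
  have key : ∀ u ∈ Vf, ∀ z ∈ D.n, ρ (u + br D.f z) = z := by
    intro u hu z hz
    have h1 := LinearMap.congr_fun hT (⟨u, hu⟩, ⟨z, hz⟩)
    simp only [LinearMap.comp_apply, LinearMap.coprod_apply, LinearMap.id_apply,
      LinearMap.domRestrict_apply, Submodule.subtype_apply] at h1
    simp [hρ, h1]
  have hdec : ∀ x ∈ D.gradeGE (-1), ∃ u ∈ Vf, ∃ z ∈ D.n, x = u + br D.f z := by
    intro x hx
    rw [← mPerp_eq h, ← hVsup] at hx
    obtain ⟨u, hu, _, ⟨z, hz, rfl⟩, rfl⟩ := Submodule.mem_sup.1 hx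
    exact ⟨u, hu, z, hz, rfl⟩
  have hns : ∀ z ∈ D.n, sgn g z ∈ D.n := fun z hz => sgn_mem_gradeGE hz
  refine ⟨⟨ρ, fun z hz => ?_, fun u hu => ?_, fun x hx => ?_, fun j hj x hx => ?_,
    fun x hx => ?_⟩⟩
  · simpa using key 0 Vf.zero_mem z hz
  · simpa using key u hu 0 D.n.zero_mem
  · obtain ⟨u, hu, z, hz, rfl⟩ := hdec x hx
    rw [map_add (sgn g), sgn_br_even D.f_even, key u hu z hz, key _ (hVs u hu) _ (hns z hz)]
  · have hle : D.gradeGE j ≤ (D.gradeGE (j + 2)).comap ρ := gradeGE_le fun s hs x hx => by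
      refine grade_le_gradeGE (j := s + 2) (by omega) ?_
      obtain ⟨u, hu, z, hz, rfl⟩ := hdec x (grade_le_gradeGE (by omega) hx)
      rw [key u hu z hz]
      rw [mem_grade] at hx ⊢
      have hhz : br D.h z ∈ D.n := by
        have h' : D.gradeGE 1 ≤ (D.gradeGE 1).comap (br D.h) := gradeGE_le fun j hj x hx => by
          rw [Submodule.mem_comap, (D.mem_grade).1 hx]
          exact Submodule.smul_mem _ _ (grade_le_gradeGE hj hx)
        exact h' hz
      -- Apply `ad h - s` to `u + [f, z]`, a vector of weight `s`. As `f` has weight `-2`,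
      -- uniqueness of the decomposition gives `[h, z] = (s + 2) z`.
      have h1 : (br D.h u - (s : ℂ) • u) + br D.f (br D.h z - ((s + 2 : ℤ) : ℂ) • z) = 0 := by
        rw [map_add, br_even_jacobi D.h_even, D.br_h_f] at hx
        rw [← sub_eq_zero] at hx
        rw [← hx]
        simp only [map_sub, map_smul, map_neg, LinearMap.neg_apply, LinearMap.smul_apply]
        push_cast
        module
      exact sub_eq_zero.1 (hinj _ (Vf.sub_mem (hVh u hu) (Vf.smul_mem _ hu)) _
        (D.n.sub_mem hhz (D.n.smul_mem _ hz)) h1).2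
    exact hle hx
  · obtain ⟨u, hu, z, hz, rfl⟩ := hdec x hx
    rw [key u hu z hz, add_sub_cancel_right]
    exact hu

end Grading

open SlTriple

/-! ### Exponentials of nilpotent elements -/

section TruncExp

variable {R : Type*} [Ring R] [Algebra ℂ R]

/-- The partial sum of the exponential series; it is the exponential of `A` if `A ^ N = 0`. -/
noncomputable def truncExp (N : ℕ) (A : R) : R :=
  ∑ t ∈ Finset.range N, ((t.factorial : ℂ)⁻¹) • A ^ t

theorem truncExp_succ_of_pow_eq_zero {N : ℕ} {A : R} (h : A ^ N = 0) :
    truncExp (N + 1) A = truncExp N A := by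
  simp [truncExp, Finset.sum_range_succ, h]

theorem truncExp_succ_zero (N : ℕ) : truncExp (N + 1) (0 : R) = 1 := by
  simp [truncExp, Finset.sum_range_succ']

theorem mul_pow_of_commute {A δ A' : R} (h : δ * A - A * δ = A') (hc : A' * A = A * A') (t : ℕ) :
    δ * A ^ (t + 1) = A ^ (t + 1) * δ + (t + 1 : ℂ) • (A' * A ^ t) := by
  have hA : δ * A = A * δ + A' := by rw [← h]; abel
  have hct : ∀ t : ℕ, A ^ t * A' = A' * A ^ t := fun t =>
    ((show Commute A' A from hc).pow_right t).symm.eq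
  induction t with
  | zero => simp [hA]
  | succ t ih =>
    rw [pow_succ A (t + 1), ← mul_assoc, ih, add_mul, mul_assoc (A ^ (t + 1)), hA, mul_add,
      ← mul_assoc, hct (t + 1), smul_mul_assoc, mul_assoc A', ← pow_succ A t, ← pow_succ A (t + 1)]
    push_cast
    module

/-- The rule `(e^A)' = A' e^A` when `A' = [δ, A]` commutes with `A`. Differentiation lowers the
power, so the truncation on the right is one shorter. -/
theorem mul_truncExp_of_commute {A δ A' : R} (h : δ * A - A * δ = A') (hc : A' * A = A * A')
    (N : ℕ) : δ * truncExp (N + 1) A = truncExp (N + 1) A * δ + A' * truncExp N A := by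
  simp only [truncExp]
  rw [Finset.sum_range_succ', mul_add, add_mul, Finset.mul_sum, Finset.sum_mul, Finset.mul_sum,
    add_right_comm, ← Finset.sum_add_distrib]
  congr 1
  · refine Finset.sum_congr rfl fun t _ => ?_
    rw [mul_smul_comm, mul_pow_of_commute h hc, smul_mul_assoc, mul_smul_comm, smul_add, smul_smul]
    congr 2
    have h1 : (t + 1 : ℂ) ≠ 0 := by exact_mod_cast t.succ_ne_zero
    have h2 : (t.factorial : ℂ) ≠ 0 := by exact_mod_cast t.factorial_ne_zero
    rw [Nat.factorial_succ]
    push_cast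
    field_simp
  · simp

/-- `e^A δ e^{-A} = δ + [A, δ] + ½ [A, [A, δ]] + ⋯`. -/
theorem truncExp_mul {A δ : R} {N : ℕ} (hA : A ^ N = 0) {S : Submodule ℂ R}
    (hδ : A * δ - δ * A ∈ S) (hS : ∀ s ∈ S, A * s - s * A ∈ S) :
    ∃ s ∈ S, truncExp N A * δ = (δ + s) * truncExp N A := by
  let _ : Module ℚ (Module.End ℂ R) := Module.compHom _ (algebraMap ℚ ℂ)
  have hsmul : ∀ (c : ℚ) (T : Module.End ℂ R), c • T = (c : ℂ) • T := fun c T => rfl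
  set l : Module.End ℂ R := LinearMap.mulLeft ℂ A
  set r : Module.End ℂ R := LinearMap.mulRight ℂ A
  have hl : ∀ t : ℕ, l ^ t = LinearMap.mulLeft ℂ (A ^ t) := fun t => by
    rw [LinearMap.pow_mulLeft]
  have hr : ∀ t : ℕ, r ^ t = LinearMap.mulRight ℂ (A ^ t) := fun t => by
    rw [LinearMap.pow_mulRight]
  have hl0 : l ^ N = 0 := by rw [hl, hA, LinearMap.mulLeft_zero_eq_zero]
  have hr0 : r ^ N = 0 := by rw [hr, hA, LinearMap.mulRight_zero_eq_zero]
  have hlr : Commute l r := LinearMap.commute_mulLeft_right A A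
  have hnl : IsNilpotent l := ⟨N, hl0⟩
  have hnr : IsNilpotent r := ⟨N, hr0⟩
  obtain ⟨K, hK⟩ := hlr.isNilpotent_sub hnl hnr
  -- Left and right multiplication by `A` commute, and `l - r` is the commutator with `A`, so `e^l =
  -- e^r e^{l - r}`. At `δ` this reads `e^A δ = (e^{ad A} δ) e^A`.
  have h1 : IsNilpotent.exp l = IsNilpotent.exp r * IsNilpotent.exp (l - r) := by
    rw [← IsNilpotent.exp_add_of_commute (hlr.symm.sub_right (Commute.refl r)) hnr ⟨K, hK⟩,
      add_sub_cancel]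
  -- For `l - r` the sum has `K + 1` terms, so that the term `t = 0`, which is `δ` itself, can be
  -- split off. The remaining terms form `s`.
  rw [IsNilpotent.exp_eq_sum hl0, IsNilpotent.exp_eq_sum hr0,
    IsNilpotent.exp_eq_sum (pow_eq_zero_of_le (Nat.le_succ K) hK)] at h1
  have h2 := LinearMap.congr_fun h1 δ
  simp only [hsmul, hl, hr, Module.End.mul_apply, LinearMap.sum_apply, LinearMap.smul_apply,
    LinearMap.mulLeft_apply, LinearMap.mulRight_apply] at h2
  refine ⟨∑ t ∈ Finset.range K, (((t + 1).factorial : ℂ)⁻¹) • ((l - r) ^ (t + 1)) δ, ?_, ?_⟩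
  · refine S.sum_mem fun t ht => S.smul_mem _ ?_
    clear ht
    induction t with
    | zero => simpa [l, r] using hδ
    | succ t ih =>
      rw [pow_succ', Module.End.mul_apply]
      simpa [l, r] using hS _ ih
  · rw [Finset.sum_range_succ'] at h2
    simp only [truncExp, Finset.sum_mul, Finset.mul_sum, smul_mul_assoc, mul_smul_comm]
    have e1 : ∀ t : ℕ, (((t.factorial : ℚ)⁻¹ : ℚ) : ℂ) = (t.factorial : ℂ)⁻¹ := fun t => by simp
    simp only [e1] at h2
    rw [h2]
    refine Finset.sum_congr rfl fun t _ => ?_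
    congr 2
    simp [add_comm]

theorem finsum_exp_eq {V : Type*} [AddCommGroup V] [Module ℂ V] {A : Module.End ℂ V} {N : ℕ}
    (hA : A ^ N = 0) (v : V) :
    ∑ᶠ t : ℕ, ((t.factorial : ℂ)⁻¹) • ((A ^ t) v) = truncExp N A v := by
  rw [finsum_eq_sum_of_support_subset (s := Finset.range N)]
  · simp [truncExp, LinearMap.sum_apply]
  · intro t ht
    by_contra h
    refine ht ?_
    have h0 : A ^ t = 0 := pow_eq_zero_of_le (by simpa using h) hA
    simp [h0]

end TruncExp

/-! ### The canonical form of a Lax operator -/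

section CanonicalForm

variable {g : Type*} [AddCommGroup g] [Module ℂ g] [Superspace g] [LieSuperalg g]
  (D : SlTriple g) {B : Type*} [Ring B] [Algebra ℂ B] [Superspace B] [DiffSuperalg B]

variable (B) in
/-- The filtration of `ℂ∂ ⋉ (g ⊗ B)` by the grading of `g`, `∂` having degree zero. -/
noncomputable def filt (d : ℤ) : Submodule ℂ (ℂ × (g ⊗[ℂ] B)) where
  carrier := {v | v.2 ∈ tSub B (D.gradeGE d) ∧ (1 ≤ d → v.1 = 0)}
  zero_mem' := ⟨zero_mem _, fun _ => rfl⟩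
  add_mem' hx hy := ⟨add_mem hx.1 hy.1, fun h => by simp [hx.2 h, hy.2 h]⟩
  smul_mem' c x hx := ⟨Submodule.smul_mem _ c hx.1, fun h => by simp [hx.2 h]⟩

variable {D}

theorem tSub_gradeGE_anti {d d' : ℤ} (h : d ≤ d') :
    tSub B (D.gradeGE d') ≤ tSub B (D.gradeGE d) :=
  tSub_mono (gradeGE_anti h)

theorem filt_anti {d d' : ℤ} (h : d ≤ d') : filt D B d' ≤ filt D B d :=
  fun _ hv => ⟨tSub_gradeGE_anti h hv.1, fun h' => hv.2 (h'.trans h)⟩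

/-- The bracket adds degrees. The term `-c ∂Z` has only the degree of `Z`, but it occurs only if `j
≤ 0`, when that is enough. -/
theorem adG_mem_filt {d j : ℤ} {Z : g ⊗[ℂ] B} (hZ : Z ∈ tSub B (D.gradeGE d))
    {v : ℂ × (g ⊗[ℂ] B)} (hv : v ∈ filt D B j) : adG Z v ∈ filt D B (j + d) := by
  rw [adG_apply]
  refine ⟨sub_mem ?_ ?_, fun _ => rfl⟩
  · rw [add_comm]
    exact tensorBr_mem (fun x hx y hy => br_mem_gradeGE hx hy) (fun _ h => sgn_mem_gradeGE h) hZ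
        hv.1
  · by_cases hj : 1 ≤ j
    · rw [hv.2 hj, zero_smul]
      exact zero_mem _
    · exact Submodule.smul_mem _ _ (tSub_gradeGE_anti (by omega) (lTensor_mem_tSub _ hZ))

theorem adG_pow_mem_filt {j : ℤ} {X : g ⊗[ℂ] B} (hX : X ∈ tSub B (D.gradeGE 1))
    {v : ℂ × (g ⊗[ℂ] B)} (hv : v ∈ filt D B j) (t : ℕ) : (adG X ^ t) v ∈ filt D B (j + t) := by
  induction t with
  | zero => simpa using hv
  | succ t ih =>
    rw [pow_succ', Module.End.mul_apply]
    have := adG_mem_filt hX ih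
    rw [add_assoc] at this
    exact_mod_cast this

/-- Each `ad X` raises the degree by one. The exponent is `2M + 1` and not `2M` so that the final
degree is at least `1` even for `M = 0`, and hence the `∂`-component is zero as well. -/
theorem adG_pow_eq_zero {M : ℕ} (h1 : D.gradeGE (-M) = ⊤) (h2 : D.gradeGE M = ⊥)
    {X : g ⊗[ℂ] B} (hX : X ∈ tSub B (D.gradeGE 1)) : adG X ^ (2 * M + 1) = 0 := by
  refine LinearMap.ext fun v => ?_
  have hv : v ∈ filt D B (-M) := ⟨by rw [h1, tSub_top]; trivial, fun h => by omega⟩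
  have h := adG_pow_mem_filt hX hv (2 * M + 1)
  obtain ⟨h3, h4⟩ := h
  have h5 := tSub_gradeGE_anti (d := M) (by push_cast; omega) h3
  rw [h2, tSub_bot] at h5
  exact Prod.ext (h4 (by push_cast; omega)) h5

variable (D) in
/-- `k ∂ + q - f ⊗ 1`. -/
noncomputable def laxG (k : ℂ) (q : g ⊗[ℂ] B) : ℂ × (g ⊗[ℂ] B) := (k, q - D.f ⊗ₜ 1)

theorem f_tmul_one_even : sgn _ (D.f ⊗ₜ[ℂ] (1 : B)) = D.f ⊗ₜ[ℂ] (1 : B) :=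
  tmul_mem_even D.f_even one_mem_part

theorem laxG_mem_filt (k : ℂ) {q : g ⊗[ℂ] B} (hq : q ∈ tSub B (D.gradeGE (-1))) :
    laxG D k q ∈ filt D B (-2) :=
  ⟨sub_mem (tSub_gradeGE_anti (by norm_num) hq) (tmul_mem_tSub f_mem_gradeGE _),
    fun h => by norm_num at h⟩

/-- `ad Z` applied to a Lax operator is `[f, Z]` up to terms of higher degree. -/
theorem adG_laxG_sub_mem (k : ℂ) {q : g ⊗[ℂ] B} (hq : q ∈ tSub B (D.gradeGE (-1))) {d : ℤ}
    {Z : g ⊗[ℂ] B} (hZ : Z ∈ tSub B (D.gradeGE d)) (hZe : sgn _ Z = Z) :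
    adG Z (laxG D k q) - (0, (br D.f).rTensor B Z) ∈ filt D B (d - 1) := by
  have h1 : (k, q) ∈ filt D B (-1) := ⟨hq, fun h => by norm_num at h⟩
  have h2 := adG_mem_filt hZ h1
  rw [show (-1 : ℤ) + d = d - 1 by ring] at h2
  convert h2 using 1
  rw [adG_apply, adG_apply, ← tensorBr_tmul_one D.f, tensorBr_skew f_tmul_one_even hZe]
  simp only [laxG, map_sub, Prod.mk_sub_mk, sub_zero]
  congr 1
  abel

/-- `A^{t+1} - A'^{t+1} = A (A^t - A'^t) + (A - A') A'^t`, where `A - A'` raises degrees by `d`, `A`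
and `A'` raise them by one, and the Lax operator starts in degree `-2`. -/
theorem pow_sub_pow_mem (k : ℂ) {q : g ⊗[ℂ] B} (hq : q ∈ tSub B (D.gradeGE (-1))) {d : ℤ}
    {X X' : g ⊗[ℂ] B} (hX : X ∈ tSub B (D.gradeGE 1)) (hX' : X' ∈ tSub B (D.gradeGE 1))
    (hd : X - X' ∈ tSub B (D.gradeGE d)) (t : ℕ) :
    (adG X ^ (t + 1)) (laxG D k q) - (adG X' ^ (t + 1)) (laxG D k q)
      ∈ filt D B (d - 2 + t) := by
  have hL := laxG_mem_filt k hq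
  induction t with
  | zero =>
    have := adG_mem_filt hd hL
    rw [adG_sub, LinearMap.sub_apply] at this
    rw [show (-2 : ℤ) + d = d - 2 + (0 : ℕ) by push_cast; ring] at this
    simpa using this
  | succ t ih =>
    have h1 := adG_mem_filt hX ih
    have h2 := adG_mem_filt hd (adG_pow_mem_filt hX' hL (t + 1))
    have h3 := add_mem (S := Submodule ℂ (ℂ × (g ⊗[ℂ] B)))
      (filt_anti (d := d - 2 + (t + 1 : ℕ)) (by push_cast; omega) h1)
      (filt_anti (d := d - 2 + (t + 1 : ℕ)) (by push_cast; omega) h2)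
    convert h3 using 1
    rw [pow_succ' _ (t + 1), pow_succ' _ (t + 1), Module.End.mul_apply, Module.End.mul_apply,
      adG_sub, LinearMap.sub_apply, map_sub]
    abel

/-- `e^{ad X} L` depends on the component of degree `d` of `X` through `[f, X_d]`, up to terms of
higher degree. -/
theorem truncExp_sub_mem (k : ℂ) {q : g ⊗[ℂ] B} (hq : q ∈ tSub B (D.gradeGE (-1))) {d : ℤ}
    {X X' : g ⊗[ℂ] B} (hX : X ∈ tSub B (D.gradeGE 1)) (hX' : X' ∈ tSub B (D.gradeGE 1))
    (hXe : sgn _ X = X) (hXe' : sgn _ X' = X')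
    (hd : X - X' ∈ tSub B (D.gradeGE d)) (N : ℕ) :
    truncExp (N + 2) (adG X) (laxG D k q) - truncExp (N + 2) (adG X') (laxG D k q)
      - (0, (br D.f).rTensor B (X - X')) ∈ filt D B (d - 1) := by
  have h1 := adG_laxG_sub_mem k hq hd (by rw [map_sub, hXe, hXe'])
  -- From the quadratic term of the exponential on, at least one further `ad X` or `ad X'` is
  -- applied, so these differences have degree `≥ d - 1`. Only the linear term contributes in degree
  -- `d - 2`.
  have h2 : ∑ t ∈ Finset.range N, (((t + 2).factorial : ℂ)⁻¹) •
      ((adG X ^ (t + 2)) (laxG D k q) - (adG X' ^ (t + 2)) (laxG D k q)) ∈ filt D B (d - 1) := by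
    refine Submodule.sum_mem _ fun t _ => Submodule.smul_mem _ _ ?_
    exact filt_anti (by push_cast; omega) (pow_sub_pow_mem k hq hX hX' hd (t + 1))
  convert add_mem h1 h2 using 1
  simp only [truncExp, LinearMap.sum_apply, LinearMap.smul_apply, Finset.sum_range_succ', adG_sub,
    LinearMap.sub_apply, smul_sub, Finset.sum_sub_distrib, LinearMap.add_apply]
  simp
  abel

theorem truncExp_laxG_fst (k : ℂ) (q X : g ⊗[ℂ] B) (N : ℕ) :
    (truncExp (N + 1) (adG X) (laxG D k q)).1 = k := by
  simp only [truncExp, LinearMap.sum_apply, LinearMap.smul_apply, Finset.sum_range_succ',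
    LinearMap.add_apply, Prod.fst_add, Prod.fst_sum]
  rw [Finset.sum_eq_zero]
  · simp [laxG]
  · intro t _
    rw [pow_succ', Module.End.mul_apply, adG_apply]
    simp

theorem truncExp_even {X : g ⊗[ℂ] B} (hX : sgn _ X = X) {v : ℂ × (g ⊗[ℂ] B)}
    (hv : sgn _ v.2 = v.2) (N : ℕ) :
    sgn _ (truncExp N (adG X) v).2 = (truncExp N (adG X) v).2 := by
  have key : ∀ t : ℕ, sgn _ ((adG X ^ t) v).2 = ((adG X ^ t) v).2 := by
    intro t
    induction t with
    | zero => simpa using hv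
    | succ t ih =>
      rw [pow_succ', Module.End.mul_apply, adG_apply]
      simp only [map_sub, map_smul, sgn_tensorBr hX ih, sgn_lTensor_der hX]
  simp only [truncExp, LinearMap.sum_apply, LinearMap.smul_apply, Prod.snd_sum, map_sum,
    Prod.smul_snd, map_smul, key]

theorem mapG_truncExp {B' : Type*} [Ring B'] [Algebra ℂ B'] [Superspace B'] [DiffSuperalg B']
    {φ : B →ₐ[ℂ] B'} (hφ : IsDiffSuperHom φ) (X : g ⊗[ℂ] B) (v : ℂ × (g ⊗[ℂ] B)) (N : ℕ) :
    mapG g φ (truncExp N (adG X) v)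
      = truncExp N (adG (φ.toLinearMap.lTensor g X)) (mapG g φ v) := by
  have key : ∀ t : ℕ, mapG g φ ((adG X ^ t) v)
      = (adG (φ.toLinearMap.lTensor g X) ^ t) (mapG g φ v) := by
    intro t
    induction t with
    | zero => simp
    | succ t ih => rw [pow_succ', pow_succ', Module.End.mul_apply, Module.End.mul_apply,
        mapG_adG hφ, ih]
  simp only [truncExp, LinearMap.sum_apply, LinearMap.smul_apply, map_sum, map_smul, key]

theorem mapG_laxG {B' : Type*} [Ring B'] [Algebra ℂ B'] (φ : B →ₐ[ℂ] B') (k : ℂ)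
    (q : g ⊗[ℂ] B) : mapG g φ (laxG D k q) = laxG D k (φ.toLinearMap.lTensor g q) := by
  simp [mapG, laxG]

/-! ### Gauge fixing by iteration. -/

variable {Vf : Submodule ℂ g}

theorem SlTriple.Homotopy.rTensor_br_f (H : D.Homotopy Vf) {Z : g ⊗[ℂ] B}
    (hZ : Z ∈ tSub B (D.gradeGE 1)) :
    H.toFun.rTensor B ((br D.f).rTensor B Z) = Z := by
  induction hZ using tSub_induction with
  | zero => simp
  | add x y _ _ hx hy => simp only [map_add, hx, hy]
  | tmul u hu G => simp [H.apply_br_f u hu]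

theorem SlTriple.Homotopy.rTensor_Vf (H : D.Homotopy Vf) {u : g ⊗[ℂ] B} (hu : u ∈ tSub B Vf) :
    H.toFun.rTensor B u = 0 := by
  induction hu using tSub_induction with
  | zero => simp
  | add x y _ _ hx hy => simp only [map_add, hx, hy, add_zero]
  | tmul u hu G => simp [H.apply_Vf u hu]

theorem SlTriple.Homotopy.rTensor_sgn (H : D.Homotopy Vf) {x : g ⊗[ℂ] B}
    (hx : x ∈ tSub B (D.gradeGE (-1))) :
    H.toFun.rTensor B (sgn _ x) = sgn _ (H.toFun.rTensor B x) := by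
  induction hx using tSub_induction with
  | zero => simp
  | add x y _ _ hx hy => simp only [map_add, hx, hy]
  | tmul u hu G => simp [sgn_tmul, H.apply_sgn u hu]

theorem SlTriple.Homotopy.rTensor_mem (H : D.Homotopy Vf) {j : ℤ} (hj : -1 ≤ j) {x : g ⊗[ℂ] B}
    (hx : x ∈ tSub B (D.gradeGE j)) :
    H.toFun.rTensor B x ∈ tSub B (D.gradeGE (j + 2)) :=
  rTensor_mem_tSub _ (H.mem_gradeGE j hj) hx

theorem SlTriple.Homotopy.rTensor_sub_mem (H : D.Homotopy Vf) {x : g ⊗[ℂ] B}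
    (hx : x ∈ tSub B (D.gradeGE (-1))) :
    x - (br D.f).rTensor B (H.toFun.rTensor B x) ∈ tSub B Vf := by
  induction hx using tSub_induction with
  | zero => simp
  | add x y _ _ hx hy =>
    have := add_mem hx hy
    rwa [sub_add_sub_comm, ← map_add, ← map_add] at this
  | tmul u hu G =>
    have := tmul_mem_tSub (H.sub_br_f_mem u hu) G
    rwa [TensorProduct.sub_tmul] at this

/-- The component of `e^{ad X} L + f ⊗ 1` in `g ⊗ B`. -/
noncomputable def transformed (D : SlTriple g) (N : ℕ) (k : ℂ) (q X : g ⊗[ℂ] B) :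
    g ⊗[ℂ] B :=
  (truncExp (N + 2) (adG X) (laxG D k q)).2 + D.f ⊗ₜ 1

theorem truncExp_eq_laxG (N : ℕ) (k : ℂ) (q X : g ⊗[ℂ] B) :
    truncExp (N + 2) (adG X) (laxG D k q) = laxG D k (transformed D N k q X) := by
  refine Prod.ext (truncExp_laxG_fst k q X (N + 1)) ?_
  simp [transformed, laxG]

theorem laxG_injective {k : ℂ} {q q' : g ⊗[ℂ] B} (h : laxG D k q = laxG D k q') :
    q = q' := by
  have := congrArg Prod.snd h
  simpa [laxG] using this

section

variable {k : ℂ} {q : g ⊗[ℂ] B} (hq : q ∈ tSub B (D.gradeGE (-1))) (N : ℕ)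
include hq

theorem transformed_sub_mem {d : ℤ}
    {X X' : g ⊗[ℂ] B} (hX : X ∈ tSub B (D.gradeGE 1)) (hX' : X' ∈ tSub B (D.gradeGE 1))
    (hXe : sgn _ X = X) (hXe' : sgn _ X' = X')
    (hd : X - X' ∈ tSub B (D.gradeGE d)) :
    transformed D N k q X - transformed D N k q X' - (br D.f).rTensor B (X - X')
      ∈ tSub B (D.gradeGE (d - 1)) := by
  have h := (truncExp_sub_mem k hq hX hX' hXe hXe' hd N).1
  simpa [transformed] using h

omit hq in
theorem transformed_zero : transformed D N k q (0 : g ⊗[ℂ] B) = q := by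
  have hz : adG (0 : g ⊗[ℂ] B) = 0 := by
    have := adG_sub (0 : g ⊗[ℂ] B) 0
    rwa [sub_zero, sub_self] at this
  simp [transformed, hz, truncExp_succ_zero, laxG]

theorem transformed_mem {X : g ⊗[ℂ] B} (hX : X ∈ tSub B (D.gradeGE 1))
    (hXe : sgn _ X = X) : transformed D N k q X ∈ tSub B (D.gradeGE (-1)) := by
  have hX0 : X - 0 ∈ tSub B (D.gradeGE 1) := by rwa [sub_zero]
  have h := transformed_sub_mem (k := k) hq N hX (Submodule.zero_mem _) hXe
    (LinearMap.map_zero _) hX0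
  have hfX : (br D.f).rTensor B X ∈ tSub B (D.gradeGE (-1)) :=
    rTensor_mem_tSub (br D.f) (fun u hu => br_mem_gradeGE (i := -2) (j := 1) f_mem_gradeGE hu) hX
  rw [transformed_zero, sub_zero] at h
  have h1 := (tSub B (D.gradeGE (-1))).add_mem
    (tSub_gradeGE_anti (d := -1) (by norm_num) h) ((tSub _ _).add_mem hfX hq)
  rwa [sub_sub, add_comm q, sub_add_cancel] at h1

theorem transformed_even (hqe : sgn _ q = q) {X : g ⊗[ℂ] B} (hXe : sgn _ X = X) :
    sgn _ (transformed D N k q X) = transformed D N k q X := by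
  have h : sgn _ (laxG D k q).2 = (laxG D k q).2 := by simp [laxG, hqe, f_tmul_one_even]
  simp [transformed, truncExp_even hXe h, f_tmul_one_even]

/-- The contraction property of `X ↦ X - ρ(q^X)`. The leading change of `q^X` is `[f, X - X']`,
which `ρ` turns into `X - X'` and so cancels. The error has degree `≥ d - 1`, and `ρ` lifts it to `d
+ 1`. -/
theorem SlTriple.Homotopy.step_sub_mem (H : D.Homotopy Vf) {d : ℤ} (hd1 : 0 ≤ d)
    {X X' : g ⊗[ℂ] B} (hX : X ∈ tSub B (D.gradeGE 1)) (hX' : X' ∈ tSub B (D.gradeGE 1))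
    (hXe : sgn _ X = X) (hXe' : sgn _ X' = X')
    (hd : X - X' ∈ tSub B (D.gradeGE d)) :
    (X - H.toFun.rTensor B (transformed D N k q X))
      - (X' - H.toFun.rTensor B (transformed D N k q X')) ∈ tSub B (D.gradeGE (d + 1)) := by
  have h1 := H.rTensor_mem (by omega) (transformed_sub_mem (k := k) hq N hX hX' hXe hXe' hd)
  rw [map_sub, H.rTensor_br_f (sub_mem hX hX'), map_sub, show d - 1 + 2 = d + 1 by ring] at h1
  convert neg_mem h1 using 1
  abel

/-- Existence of the canonical form. -/
theorem SlTriple.Homotopy.exists_canonical (H : D.Homotopy Vf) {M : ℕ} (hM : D.gradeGE M = ⊥)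
    (hqe : sgn _ q = q) :
    ∃ X : g ⊗[ℂ] B, X ∈ tSub B (D.gradeGE 1) ∧ sgn _ X = X ∧
      transformed D N k q X ∈ tSub B Vf := by
  set T : g ⊗[ℂ] B → g ⊗[ℂ] B := fun X => X - H.toFun.rTensor B (transformed D N k q X) with hT
  have hT1 : ∀ X, X ∈ tSub B (D.gradeGE 1) → sgn _ X = X →
      T X ∈ tSub B (D.gradeGE 1) ∧ sgn _ (T X) = T X := by
    intro X hX hXe
    have h1 := transformed_mem (k := k) hq N hX hXe
    refine ⟨sub_mem hX (H.rTensor_mem le_rfl h1), ?_⟩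
    rw [hT, map_sub, ← H.rTensor_sgn h1, transformed_even hq N hqe hXe, hXe]
  have hseq : ∀ n : ℕ, T^[n] 0 ∈ tSub B (D.gradeGE 1) ∧ sgn _ (T^[n] 0) = T^[n] 0 ∧
      T (T^[n] 0) - T^[n] 0 ∈ tSub B (D.gradeGE (n + 1)) := by
    intro n
    induction n with
    | zero =>
      have h0 := hT1 0 (zero_mem _) (map_zero _)
      refine ⟨zero_mem _, map_zero _, ?_⟩
      simpa using h0.1
    | succ n ih =>
      obtain ⟨h1, h2, h3⟩ := ih
      obtain ⟨h4, h5⟩ := hT1 _ h1 h2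
      rw [Function.iterate_succ_apply']
      refine ⟨h4, h5, ?_⟩
      have := H.step_sub_mem hq N (by omega) h4 h1 h5 h2 h3 (k := k)
      exact_mod_cast this
  obtain ⟨h1, h2, h3⟩ := hseq M
  -- The next increment has degree `≥ M + 1` and is zero, so this iterate is a fixed point of `T`.
  -- Hence `ρ` kills the transformed element `x`, and `x - [f, ρ x] ∈ V_f ⊗ B` says that `x` itself
  -- is canonical.
  refine ⟨T^[M] 0, h1, h2, ?_⟩
  have h4 := tSub_gradeGE_anti (show (M : ℤ) ≤ M + 1 by omega) h3
  rw [hM, tSub_bot, Submodule.mem_bot, hT] at h4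
  have h5 : H.toFun.rTensor B (transformed D N k q (T^[M] 0)) = 0 := by simpa using h4
  have h6 := H.rTensor_sub_mem (transformed_mem (k := k) hq N h1 h2)
  rwa [h5, map_zero, sub_zero] at h6

/-- Uniqueness of the element `X` that brings a Lax operator to canonical form. -/
theorem SlTriple.Homotopy.eq_of_canonical (H : D.Homotopy Vf) {M : ℕ} (hM : D.gradeGE M = ⊥)
    {X X' : g ⊗[ℂ] B}
    (hX : X ∈ tSub B (D.gradeGE 1)) (hX' : X' ∈ tSub B (D.gradeGE 1))
    (hXe : sgn _ X = X) (hXe' : sgn _ X' = X')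
    (h : transformed D N k q X ∈ tSub B Vf) (h' : transformed D N k q X' ∈ tSub B Vf) :
    X = X' := by
  -- As `ρ` vanishes on `V_f`, both `X` and `X'` are fixed by the iteration map, so the contraction
  -- property raises the degree of their difference without end.
  have key : ∀ n : ℕ, X - X' ∈ tSub B (D.gradeGE n) := by
    intro n
    induction n with
    | zero => exact tSub_gradeGE_anti (by norm_num) (sub_mem hX hX')
    | succ n ih =>
      have := H.step_sub_mem (k := k) hq N (by omega) hX hX' hXe hXe' ih
      rw [H.rTensor_Vf h, H.rTensor_Vf h', sub_zero, sub_zero] at this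
      exact_mod_cast this
  have h1 := key M
  rw [hM, tSub_bot, Submodule.mem_bot] at h1
  exact sub_eq_zero.1 h1

/-- An infinitesimal gauge transformation that preserves the canonical form is zero. -/
theorem SlTriple.Homotopy.eq_zero_of_adG_laxG_mem (H : D.Homotopy Vf) {M : ℕ} (hM : D.gradeGE M = ⊥)
    {U : g ⊗[ℂ] B}
    (hU : U ∈ tSub B (D.gradeGE 1)) (hUe : sgn _ U = U)
    (h : (adG U (laxG D k q)).2 ∈ tSub B Vf) : U = 0 := by
  -- If `U` has degree `≥ n`, then `ad U` of the Lax operator is `[f, U]` up to degree `≥ n - 1`.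
  -- Here `ρ` kills the left side and returns `U` from `[f, U]`, so `U` equals an error of degree `≥
  -- n + 1`.
  have key : ∀ n : ℕ, U ∈ tSub B (D.gradeGE n) := by
    intro n
    induction n with
    | zero => exact tSub_gradeGE_anti (by norm_num) hU
    | succ n ih =>
      have h1 := H.rTensor_mem (by omega) (adG_laxG_sub_mem k hq ih hUe).1
      rw [Prod.snd_sub, map_sub, H.rTensor_Vf h, H.rTensor_br_f hU, zero_sub,
        show (n : ℤ) - 1 + 2 = (n + 1 : ℕ) by push_cast; ring] at h1
      simpa using neg_mem h1
  have h1 := key M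
  rwa [hM, tSub_bot, Submodule.mem_bot] at h1

end

/-- An even derivation of `B` that acts on the Lax operator by an infinitesimal gauge
transformation is zero on the canonical form. -/
theorem derivation_canonical_eq_zero {M : ℕ} (hM1 : D.gradeGE (-M) = ⊤) (hM : D.gradeGE M = ⊥)
    {k : ℂ} {q X Z v : g ⊗[ℂ] B} (hX : X ∈ tSub B (D.gradeGE 1)) (hXe : sgn _ X = X)
    (hZ : Z ∈ tSub B (D.gradeGE 1)) (hZe : sgn _ Z = Z)
    (hv : v ∈ tSub B Vf) (hVf : Vf ≤ D.gradeGE (-1))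
    (hXv : truncExp (2 * M + 2) (adG X) (laxG D k q) = laxG D k v)
    (δ : B →ₗ[ℂ] B) (hδ : ∀ x y, δ (x * y) = δ x * y + x * δ y)
    (hs : ∀ x, δ (sgn B x) = sgn B (δ x)) (hd : ∀ x, δ (der x) = der (δ x))
    (hq : derG g δ (laxG D k q) = adG Z (laxG D k q)) (H : D.Homotopy Vf) :
    δ.lTensor g v = 0 := by
  -- The operators `ad Y` with `Y ∈ n ⊗ B` even. They are stable under commutators with `ad X` and
  -- contain `[ad X, δ] = -ad(δX)`, so conjugation by `e^{ad X}` changes `δ` and `ad Z` only within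
  -- `S`.
  set S : Submodule ℂ (Module.End ℂ (ℂ × (g ⊗[ℂ] B))) :=
    { carrier := {T | ∃ Y : g ⊗[ℂ] B, Y ∈ tSub B (D.gradeGE 1) ∧ sgn _ Y = Y ∧ T = adG Y}
      zero_mem' := ⟨0, zero_mem _, map_zero _, by
        have := adG_sub (0 : g ⊗[ℂ] B) 0
        simpa using this.symm⟩
      add_mem' := by
        rintro _ _ ⟨Y, h1, h2, rfl⟩ ⟨Y', h1', h2', rfl⟩
        exact ⟨Y + Y', add_mem h1 h1', by rw [map_add, h2, h2'], (adG_add Y Y').symm⟩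
      smul_mem' := by
        rintro c _ ⟨Y, h1, h2, rfl⟩
        exact ⟨c • Y, Submodule.smul_mem _ c h1, by rw [map_smul, h2], (adG_smul c Y).symm⟩ }
  have hbr : ∀ Y ∈ tSub B (D.gradeGE 1), tensorBr g B X Y ∈ tSub B (D.gradeGE 1) := fun Y hY =>
    tSub_gradeGE_anti (by norm_num)
      (tensorBr_mem (fun x hx y hy => br_mem_gradeGE hx hy) (fun _ h => sgn_mem_gradeGE h) hX hY)
  have hS : ∀ s ∈ S, adG X * s - s * adG X ∈ S := by
    rintro _ ⟨Y, h1, h2, rfl⟩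
    exact ⟨tensorBr g B X Y, hbr Y h1, sgn_tensorBr hXe h2, (adG_tensorBr hXe h2).symm⟩
  have hnil : adG X ^ (2 * M + 2) = 0 := by
    rw [pow_succ, adG_pow_eq_zero hM1 hM hX, zero_mul]
  have hδS : adG X * derG g δ - derG g δ * adG X ∈ S := by
    refine ⟨-δ.lTensor g X, neg_mem (lTensor_mem_tSub _ hX), ?_, ?_⟩
    · rw [map_neg, sgn_lTensor δ hs, hXe]
    · rw [← neg_sub, derG_mul_adG δ hδ hs hd hXe, ← neg_one_smul ℂ, ← adG_smul, neg_one_smul]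
  obtain ⟨_, ⟨Y1, a1, b1, rfl⟩, h1⟩ := truncExp_mul hnil hδS hS
  have hZS : adG Z ∈ S := ⟨Z, hZ, hZe, rfl⟩
  obtain ⟨_, ⟨Y2, a2, b2, rfl⟩, h2⟩ := truncExp_mul hnil (hS _ hZS) hS
  have h3 := LinearMap.congr_fun h1 (laxG D k q)
  have h4 := LinearMap.congr_fun h2 (laxG D k q)
  simp only [Module.End.mul_apply, hXv] at h3 h4
  rw [hq, h4] at h3
  -- Conjugating `δL = [Z, L]` shows that `δ` acts on the canonical form by an infinitesimal gauge
  -- transformation too. The left side lies in `V_f ⊗ B` because `δ` acts on coefficients only.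
  have h5 : derG g δ (laxG D k v) = adG (Z + Y2 - Y1) (laxG D k v) := by
    rw [adG_sub, adG_add]
    simp only [LinearMap.add_apply, LinearMap.sub_apply] at h3 ⊢
    rw [h3]
    abel
  have hone : δ 1 = 0 := by
    have := hδ 1 1
    simpa using this
  have h6 : derG g δ (laxG D k v) = (0, δ.lTensor g v) := by
    simp [derG_apply, laxG, hone]
  rw [h6] at h5
  have hU := H.eq_zero_of_adG_laxG_mem (k := k) (tSub_mono hVf hv) hM
    (U := Z + Y2 - Y1) (sub_mem (add_mem hZ a2) a1) (by rw [map_sub, map_add, hZe, b1, b2])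
    (by rw [← h5]; exact lTensor_mem_tSub _ hv)
  rw [hU] at h5
  have h7 := congrArg Prod.snd h5
  simpa [adG_apply] using h7

end CanonicalForm

/-! ### Examples of differential superalgebras -/

section DiffSymInstance

variable {M : Type*} [AddCommGroup M] [Module ℂ M] [Superspace M]

/-- For fixed `y`, required for all `x`, the identity is additive in `y` and passes to products, so
it reduces to the defining relations on generators. -/
theorem SuperSym.two_smul_mul (x y : SuperSym M) :
    (2 : ℂ) • (x * y) = (y + inv y) * x + (y - inv y) * inv x := by
  induction y using SuperSym.induction generalizing x with
  | algebraMap r =>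
    rw [AlgHom.commutes, sub_self, zero_mul, add_zero, ← two_smul ℂ (algebraMap ℂ _ r),
      smul_mul_assoc, Algebra.commutes]
  | ι b =>
    have h0 := mul_ι 0 (projEven_mem b) x
    have h1 := mul_ι 1 (projOdd_mem b) x
    simp only [ZMod.val_zero, pow_zero, AlgHom.one_apply, ZMod.val_one, pow_one] at h0 h1
    have e0 : ι M b + ι M (sgn M b) = (2 : ℂ) • ι M (projEven M b) := by
      rw [projEven_eq, map_smul, smul_smul, map_add]
      norm_num
    have e1 : ι M b - ι M (sgn M b) = (2 : ℂ) • ι M (projOdd M b) := by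
      rw [projOdd_eq, map_smul, smul_smul, map_sub]
      norm_num
    rw [inv_ι, e0, e1, smul_mul_assoc, smul_mul_assoc, ← smul_add, ← h0, ← h1, ← mul_add,
      ← map_add, projEven_add_projOdd]
  | mul a b ha hb =>
    -- Each of the two factors of `y` costs a factor `2`, so the identity is proved after doubling
    -- it.
    apply smul_right_injective _ (two_ne_zero' ℂ)
    calc (2 : ℂ) • ((2 : ℂ) • (x * (a * b))) = (2 : ℂ) • (((2 : ℂ) • (x * a)) * b) := by
          rw [smul_mul_assoc, mul_assoc]
      _ = (a + inv a) * ((2 : ℂ) • (x * b)) + (a - inv a) * ((2 : ℂ) • (inv x * b)) := by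
          rw [ha, add_mul, smul_add, mul_assoc, mul_assoc, mul_smul_comm, mul_smul_comm]
      _ = (2 : ℂ) • ((a * b + inv (a * b)) * x + (a * b - inv (a * b)) * inv x) := by
          rw [hb, hb, SuperSym.inv_inv, map_mul, two_smul]
          noncomm_ring
  | add a b ha hb =>
    rw [mul_add, smul_add, ha, hb, map_add]
    noncomm_ring

noncomputable instance : DiffSuperalg (DiffSym M) where
  der := DiffSym.der M
  der_mul := DiffSym.der_mul
  sgn_mul x y := by simp only [SuperSym.sgn_eq, map_mul]
  sgn_one := by rw [SuperSym.sgn_eq, map_one]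
  sgn_der x := by rw [SuperSym.sgn_eq, SuperSym.sgn_eq, DiffSym.inv_der]
  supercomm x y := by rw [SuperSym.sgn_eq, SuperSym.sgn_eq, SuperSym.two_smul_mul]

/-! ### Universal property of differential polynomials. -/

namespace DiffSym

@[elab_as_elim]
theorem induction_der {motive : DiffSym M → Prop}
    (algebraMap : ∀ r, motive (algebraMap ℂ (DiffSym M) r)) (gen : ∀ x, motive (gen M x))
    (der : ∀ a, motive a → motive (der M a))
    (mul : ∀ a b, motive a → motive b → motive (a * b))
    (add : ∀ a b, motive a → motive b → motive (a + b)) (a : DiffSym M) : motive a := by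
  have hsmul : ∀ (c : ℂ) (a : DiffSym M), motive a → motive (c • a) := fun c a ha => by
    rw [Algebra.smul_def]
    exact mul _ _ (algebraMap c) ha
  have hgen : ∀ (n : ℕ) (y : M),
      motive (SuperSym.ι _ ((Polynomial.X ^ n : ℂ[X]) ⊗ₜ[ℂ] y)) := by
    intro n y
    induction n with
    | zero => simpa [DiffSym.gen] using gen y
    | succ n ih =>
      have h := der _ ih
      rw [der_ι] at h
      simpa [shift, pow_succ'] using h
  induction a using SuperSym.induction with
  | algebraMap r => exact algebraMap r
  | mul a b ha hb => exact mul a b ha hb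
  | add a b ha hb => exact add a b ha hb
  | ι x =>
    induction x with
    | zero => simpa using algebraMap 0
    | add a b ha hb => rw [map_add]; exact add _ _ ha hb
    | tmul P y =>
      induction P using Polynomial.induction_on' with
      | add P Q hP hQ => rw [TensorProduct.add_tmul, map_add]; exact add _ _ hP hQ
      | monomial n c =>
        rw [← Polynomial.smul_X_eq_monomial, ← TensorProduct.smul_tmul', map_smul]
        exact hsmul c _ (hgen n y)

variable {B : Type*} [Ring B] [Algebra ℂ B] [Superspace B] [DiffSuperalg B]

/-- The extension of `d : M → B` to `ℂ[∂] ⊗ M`. -/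
noncomputable def liftLin (d : M →ₗ[ℂ] B) : ℂ[X] ⊗[ℂ] M →ₗ[ℂ] B :=
  TensorProduct.lift ((LinearMap.lcomp ℂ _ d) ∘ₗ
    (Polynomial.aeval (DiffSuperalg.der (B := B) : Module.End ℂ B)).toLinearMap)

theorem liftLin_tmul (d : M →ₗ[ℂ] B) (P : ℂ[X]) (y : M) :
    liftLin d (P ⊗ₜ y) = Polynomial.aeval (DiffSuperalg.der (B := B) : Module.End ℂ B) P (d y) := by
  simp [liftLin]

theorem liftLin_shift (d : M →ₗ[ℂ] B) (x : ℂ[X] ⊗[ℂ] M) :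
    liftLin d (shift M x) = DiffSuperalg.der (liftLin d x) := by
  induction x with
  | zero => simp
  | add a b ha hb => simp only [map_add, ha, hb]
  | tmul P y => simp [shift, liftLin_tmul]

theorem sgn_aeval_der (P : ℂ[X]) (x : B) :
    sgn B (Polynomial.aeval (DiffSuperalg.der (B := B) : Module.End ℂ B) P x)
      = Polynomial.aeval (DiffSuperalg.der (B := B) : Module.End ℂ B) P (sgn B x) := by
  induction P using Polynomial.induction_on generalizing x with
  | C c => simp [Module.algebraMap_end_apply]
  | add P Q hP hQ => simp [hP, hQ]
  | monomial n c h =>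
    rw [pow_succ, ← mul_assoc, map_mul, Polynomial.aeval_X, Module.End.mul_apply,
      Module.End.mul_apply, h, sgn_der]

theorem sgn_liftLin {d : M →ₗ[ℂ] B} (hd : ∀ y, sgn B (d y) = d (sgn M y)) (x : ℂ[X] ⊗[ℂ] M) :
    sgn B (liftLin d x) = liftLin d (sgn _ x) := by
  induction x with
  | zero => simp
  | add a b ha hb => simp only [map_add, ha, hb]
  | tmul P y => rw [sgn_tmul, sgn_polynomial, liftLin_tmul, liftLin_tmul, sgn_aeval_der, hd]

/-- The homomorphism of differential superalgebras out of `S(ℂ[∂] ⊗ M)` that extends an even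
linear map. -/
noncomputable def lift (d : M →ₗ[ℂ] B) (hd : ∀ y, sgn B (d y) = d (sgn M y)) :
    DiffSym M →ₐ[ℂ] B :=
  SuperSym.lift (liftLin d) fun _ _ _ _ ha hb =>
    mul_comm_of_mem (mem_part_of_sgn_comm _ (sgn_liftLin hd) ha)
      (mem_part_of_sgn_comm _ (sgn_liftLin hd) hb)

variable (d : M →ₗ[ℂ] B) (hd : ∀ y, sgn B (d y) = d (sgn M y))

theorem lift_gen (y : M) : lift d hd (gen M y) = d y := by
  rw [gen, LinearMap.comp_apply, lift, SuperSym.lift_ι]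
  simp [liftLin_tmul]

theorem isDiffSuperHom_lift : IsDiffSuperHom (lift d hd) := by
  refine ⟨fun x => ?_, fun x => ?_⟩
  · change lift d hd (DiffSym.der M x) = _
    induction x using SuperSym.induction with
    | algebraMap r =>
      rw [DiffSym.der_algebraMap, AlgHom.commutes, DiffSuperalg.der_algebraMap, map_zero]
    | ι x => rw [der_ι, lift, SuperSym.lift_ι, SuperSym.lift_ι, liftLin_shift]
    | mul a b ha hb => rw [DiffSym.der_mul, map_mul, map_add, map_mul, map_mul,
        DiffSuperalg.der_mul, ha, hb]
    | add a b ha hb => simp only [map_add, ha, hb]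
  · rw [SuperSym.sgn_eq]
    induction x using SuperSym.induction with
    | algebraMap r => rw [AlgHom.commutes, AlgHom.commutes, sgn_algebraMap]
    | ι x => rw [SuperSym.inv_ι, lift, SuperSym.lift_ι, SuperSym.lift_ι, sgn_liftLin hd]
    | mul a b ha hb => rw [map_mul, map_mul, map_mul, sgn_mul, ha, hb]
    | add a b ha hb => simp only [map_add, ha, hb]

end DiffSym

end DiffSymInstance

/-! ### The differential superalgebra `B[t]`. -/

section Poly

variable (B : Type*) [Ring B] [Algebra ℂ B] [Superspace B] [DiffSuperalg B]

theorem mapAlgHom_sgnHom_involutive (x : B[X]) :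
    (Polynomial.mapAlgHom (sgnHom B)).toLinearMap ((Polynomial.mapAlgHom (sgnHom B)).toLinearMap x)
      = x := by
  induction x using Polynomial.induction_on' with
  | add p q hp hq => simp only [map_add, hp, hq]
  | monomial n b => simp [Polynomial.map_monomial, sgnHom_apply, sgn_sgn]

/-- The parity of `B[t]`, where `t` is even. -/
noncomputable instance polySuperspace : Superspace B[X] :=
  ofInvolution (Polynomial.mapAlgHom (sgnHom B)).toLinearMap (mapAlgHom_sgnHom_involutive B)

variable {B}

theorem sgn_poly (P : B[X]) : sgn B[X] P = Polynomial.mapAlgHom (sgnHom B) P := by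
  have h : sgn B[X] = (Polynomial.mapAlgHom (sgnHom B)).toLinearMap :=
    sgn_ofInvolution _ (mapAlgHom_sgnHom_involutive B)
  rw [h]
  rfl

theorem sgn_monomial (n : ℕ) (b : B) :
    sgn B[X] (Polynomial.monomial n b) = Polynomial.monomial n (sgn B b) := by
  rw [sgn_poly]
  simp [Polynomial.map_monomial, sgnHom_apply]

theorem sgn_C (b : B) : sgn B[X] (Polynomial.C b) = Polynomial.C (sgn B b) := sgn_monomial 0 b

theorem mapCoeff_mul {T : B →ₗ[ℂ] B} (hT : ∀ x y, T (x * y) = T x * y + x * T y) (x y : B[X]) :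
    mapCoeff T (x * y) = mapCoeff T x * y + x * mapCoeff T y := by
  induction x using Polynomial.induction_on' with
  | add p q hp hq => simp only [map_add, add_mul, hp, hq]; abel
  | monomial n b =>
    induction y using Polynomial.induction_on' with
    | add p q hp hq => simp only [map_add, mul_add, hp, hq]; abel
    | monomial m c =>
      simp only [Polynomial.monomial_mul_monomial, mapCoeff_monomial, hT, map_add]

theorem sgn_mapCoeff {T : B →ₗ[ℂ] B} (hT : ∀ x, sgn B (T x) = T (sgn B x)) (x : B[X]) :
    sgn B[X] (mapCoeff T x) = mapCoeff T (sgn B[X] x) := by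
  induction x using Polynomial.induction_on' with
  | add p q hp hq => simp only [map_add, hp, hq]
  | monomial n b => simp only [mapCoeff_monomial, sgn_monomial, hT]

/-- `∂` acts on coefficients, so the variable is a constant for `∂`. The same ring serves for the
parameter `t` of the gauge path and for the coefficients in `λ` of `ε` in the square-zero extension.
-/
noncomputable instance polyDiffSuperalg : DiffSuperalg B[X] where
  der := mapCoeff der
  der_mul := mapCoeff_mul der_mul
  sgn_mul x y := by simp only [sgn_poly, map_mul]
  sgn_one := by rw [sgn_poly, map_one]
  sgn_der := sgn_mapCoeff sgn_der
  supercomm x y := by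
    induction x using Polynomial.induction_on' with
    | add p q hp hq => simp only [map_add, add_mul, mul_add, smul_add, hp, hq]; abel
    | monomial n b =>
      induction y using Polynomial.induction_on' with
      | add p q hp hq =>
        simp only [map_add, mul_add, smul_add, hp, hq]
        noncomm_ring
      | monomial m c =>
        simp only [sgn_monomial, ← map_add, ← map_sub, Polynomial.monomial_mul_monomial,
          Polynomial.smul_monomial, supercomm]
        rw [add_comm n m, map_add]

theorem der_monomial (n : ℕ) (b : B) :
    der (Polynomial.monomial n b) = Polynomial.monomial n (der b) := mapCoeff_monomial _ _ _

theorem der_C (b : B) : der (Polynomial.C b) = Polynomial.C (der b) := der_monomial 0 b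

end Poly

/-! ### Square-zero extensions -/

/-- `B ⊕ B[λ] ε`, where `ε` has parity `i`, `ε² = 0`, `F ε = (-1)^{i p(F)} ε F` and
`∂(ε P) = ε (λ + ∂) P`. -/
def SqZero (_i : ZMod 2) (B : Type*) [Ring B] : Type _ := B × B[X]

namespace SqZero

variable {i : ZMod 2} {B : Type*} [Ring B]

noncomputable instance : AddCommGroup (SqZero i B) := inferInstanceAs (AddCommGroup (B × B[X]))

variable [Algebra ℂ B]

noncomputable instance : Module ℂ (SqZero i B) := inferInstanceAs (Module ℂ (B × B[X]))

@[ext]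
theorem ext' {x y : SqZero i B} (h1 : x.1 = y.1) (h2 : x.2 = y.2) : x = y := Prod.ext h1 h2

@[simp] theorem fst_add (x y : SqZero i B) : (x + y).1 = x.1 + y.1 := rfl
@[simp] theorem snd_add (x y : SqZero i B) : (x + y).2 = x.2 + y.2 := rfl
@[simp] theorem fst_sub (x y : SqZero i B) : (x - y).1 = x.1 - y.1 := rfl
@[simp] theorem snd_sub (x y : SqZero i B) : (x - y).2 = x.2 - y.2 := rfl
@[simp] theorem fst_zero : (0 : SqZero i B).1 = 0 := rfl
@[simp] theorem snd_zero : (0 : SqZero i B).2 = 0 := rfl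
@[simp] theorem fst_smul (c : ℂ) (x : SqZero i B) : (c • x).1 = c • x.1 := rfl
@[simp] theorem snd_smul (c : ℂ) (x : SqZero i B) : (c • x).2 = c • x.2 := rfl

/-- The element `F + ε P`. -/
def mk (F : B) (P : B[X]) : SqZero i B := (F, P)

@[simp] theorem fst_mk (F : B) (P : B[X]) : (mk F P : SqZero i B).1 = F := rfl
@[simp] theorem snd_mk (F : B) (P : B[X]) : (mk F P : SqZero i B).2 = P := rfl

variable [Superspace B] [DiffSuperalg B]

variable (i B) in
/-- `F ↦ (-1)^{i p(F)} F`. -/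
noncomputable def twist : B →ₐ[ℂ] B := (sgnHom B) ^ i.val

theorem twist_zero (x : B) : twist 0 B x = x := by simp [twist]

theorem twist_one (x : B) : twist 1 B x = sgn B x := by simp [twist, ZMod.val_one, sgnHom_apply]

theorem twist_der (x : B) : twist i B (der x) = der (twist i B x) := by
  rcases zmod2_cases i with rfl | rfl
  · simp only [twist_zero]
  · simp only [twist_one, sgn_der]

theorem twist_sgn (x : B) : twist i B (sgn B x) = sgn B (twist i B x) := by
  rcases zmod2_cases i with rfl | rfl
  · simp only [twist_zero]
  · simp only [twist_one]

noncomputable instance : Mul (SqZero i B) :=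
  ⟨fun x y => mk (x.1 * y.1) (x.2 * Polynomial.C y.1 + Polynomial.C (twist i B x.1) * y.2)⟩

noncomputable instance : One (SqZero i B) := ⟨mk 1 0⟩

@[simp] theorem fst_mul (x y : SqZero i B) : (x * y).1 = x.1 * y.1 := rfl
@[simp] theorem snd_mul (x y : SqZero i B) :
    (x * y).2 = x.2 * Polynomial.C y.1 + Polynomial.C (twist i B x.1) * y.2 := rfl
@[simp] theorem fst_one : (1 : SqZero i B).1 = 1 := rfl
@[simp] theorem snd_one : (1 : SqZero i B).2 = 0 := rfl

noncomputable instance : Ring (SqZero i B) :=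
  { (inferInstance : AddCommGroup (SqZero i B)) with
    left_distrib := fun x y z => by
      refine ext' (mul_add _ _ _) ?_
      simp only [snd_mul, snd_add, fst_add, map_add, mul_add]; abel
    right_distrib := fun x y z => by
      refine ext' (add_mul _ _ _) ?_
      simp only [snd_mul, snd_add, fst_add, map_add, add_mul]; abel
    zero_mul := fun x => ext' (zero_mul _) (by simp)
    mul_zero := fun x => ext' (mul_zero _) (by simp)
    mul_assoc := fun x y z => by
      refine ext' (mul_assoc _ _ _) ?_
      simp only [snd_mul, fst_mul, map_mul, mul_add, add_mul, mul_assoc, add_assoc]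
    one_mul := fun x => ext' (one_mul _) (by simp)
    mul_one := fun x => ext' (mul_one _) (by simp) }

noncomputable instance : Algebra ℂ (SqZero i B) :=
  Algebra.ofModule
    (fun r x y => by
      refine ext' (smul_mul_assoc _ _ _) ?_
      simp [smul_add, ← Polynomial.smul_C])
    (fun r x y => by
      refine ext' (mul_smul_comm _ _ _) ?_
      simp [smul_add, ← Polynomial.smul_C])

/-- The parity involution. -/
noncomputable def invo : SqZero i B →ₗ[ℂ] SqZero i B where
  toFun x := mk (sgn B x.1) ((-1 : ℂ) ^ i.val • sgn B[X] x.2)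
  map_add' x y := ext' (map_add _ _ _) (by simp)
  map_smul' c x := ext' (map_smul _ _ _) (by simp [smul_comm c])

theorem invo_invo (x : SqZero i B) : invo (invo x) = x :=
  ext' (sgn_sgn _) (by simp [invo, sgn_sgn, smul_smul, ← mul_pow])

noncomputable instance : Superspace (SqZero i B) :=
  ofInvolution invo invo_invo

theorem sgn_eq (x : SqZero i B) :
    sgn (SqZero i B) x = mk (sgn B x.1) ((-1 : ℂ) ^ i.val • sgn B[X] x.2) := by
  have h : sgn (SqZero i B) = invo := sgn_ofInvolution _ invo_invo
  rw [h]
  rfl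

@[simp] theorem fst_sgn (x : SqZero i B) : (sgn (SqZero i B) x).1 = sgn B x.1 := by rw [sgn_eq]; rfl
@[simp] theorem snd_sgn (x : SqZero i B) :
    (sgn (SqZero i B) x).2 = (-1 : ℂ) ^ i.val • sgn B[X] x.2 := by rw [sgn_eq]; rfl

variable (i B) in
/-- The derivation `∂`. -/
noncomputable def derivation : SqZero i B →ₗ[ℂ] SqZero i B where
  toFun x := mk (der x.1) (Polynomial.X * x.2 + der x.2)
  map_add' x y := ext' (map_add _ _ _) (by simp only [snd_add, snd_mk, map_add, mul_add]; abel)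
  map_smul' c x := ext' (map_smul _ _ _) (by simp)

@[simp] theorem fst_derivation (x : SqZero i B) : (derivation i B x).1 = der x.1 := rfl
@[simp] theorem snd_derivation (x : SqZero i B) :
    (derivation i B x).2 = Polynomial.X * x.2 + der x.2 := rfl

theorem C_supercomm (x : B) (P : B[X]) : (2 : ℂ) • (P * Polynomial.C x)
    = Polynomial.C (x + sgn B x) * P + Polynomial.C (x - sgn B x) * sgn B[X] P := by
  rw [supercomm, sgn_C, map_add, map_sub]

theorem supercomm_C (x : B) (P : B[X]) : (2 : ℂ) • (Polynomial.C x * P)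
    = (P + sgn B[X] P) * Polynomial.C x + (P - sgn B[X] P) * Polynomial.C (sgn B x) := by
  rw [supercomm, sgn_C]

noncomputable instance : DiffSuperalg (SqZero i B) where
  der := derivation i B
  der_mul x y := by
    refine ext' (der_mul _ _) ?_
    simp only [snd_derivation, snd_mul, snd_add, fst_derivation, map_add, der_mul, der_C,
      twist_der, mul_add, add_mul, ← mul_assoc, Polynomial.X_mul_C]
    abel
  sgn_mul x y := by
    refine ext' (by simp [sgn_mul]) ?_
    simp only [snd_sgn, snd_mul, fst_sgn, map_add, sgn_mul, sgn_C, twist_sgn, smul_add,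
      smul_mul_assoc, mul_smul_comm]
  sgn_one := ext' (by simp [sgn_one]) (by simp)
  sgn_der x := by
    refine ext' (by simp [sgn_der]) ?_
    have hX : sgn B[X] (Polynomial.X : B[X]) = Polynomial.X := by
      rw [Polynomial.X, sgn_monomial, sgn_one]
    simp only [snd_sgn, snd_derivation, map_add, sgn_mul, hX, sgn_der, smul_add, mul_smul_comm,
      map_smul]
  supercomm x y := by
    refine ext' (by simp [supercomm]) ?_
    have h1 := C_supercomm y.1 x.2
    have h2 := supercomm_C x.1 y.2
    have h3 := supercomm_C (sgn B x.1) y.2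
    simp only [snd_smul, snd_mul, snd_add, snd_sub, fst_add, fst_sub, fst_sgn, snd_sgn, smul_add,
      h1]
    rcases zmod2_cases i with rfl | rfl
    · simp only [twist_zero, h2, ZMod.val_zero, pow_zero, one_smul, map_add, map_sub]
      noncomm_ring
    · simp only [twist_one, h3, ZMod.val_one, pow_one, neg_smul, one_smul, map_add, map_sub,
        sgn_sgn]
      noncomm_ring

theorem der_eq (x : SqZero i B) : der x = derivation i B x := rfl

variable (i B) in
/-- The inclusion of `B`. -/
noncomputable def inl : B →ₐ[ℂ] SqZero i B :=
  AlgHom.ofLinearMap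
    { toFun := fun x => mk x 0
      map_add' := fun x y => ext' rfl (by simp)
      map_smul' := fun c x => ext' rfl (by simp) } rfl
    fun x y => ext' rfl (by simp)

@[simp] theorem fst_inl (x : B) : (inl i B x).1 = x := rfl
@[simp] theorem snd_inl (x : B) : (inl i B x).2 = 0 := rfl

theorem isDiffSuperHom_inl : IsDiffSuperHom (inl i B) :=
  ⟨fun x => ext' rfl (by simp [der_eq]), fun x => ext' (by simp) (by simp)⟩

end SqZero

/-! ### The differential superalgebra `V_I(p)` -/

section VIStructure

variable {g : Type*} [AddCommGroup g] [Module ℂ g] [Superspace g] [LieSuperalg g]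
  (D : SlTriple g)

namespace VI

theorem sgn_eq (x : VI D) : sgn (VI D) x = inv D x := by
  have h : sgn (VI D) = (inv D).toLinearMap := sgn_ofInvolution _ (inv_inv D)
  rw [h]
  rfl

noncomputable instance : DiffSuperalg (VI D) where
  der := der D
  der_mul x y := by
    obtain ⟨x, rfl⟩ := π_surjective D x
    obtain ⟨y, rfl⟩ := π_surjective D y
    rw [← map_mul, der_π, der_π, der_π, DiffSym.der_mul, map_add, map_mul, map_mul]
  sgn_mul x y := by simp only [sgn_eq, map_mul]
  sgn_one := by rw [sgn_eq, map_one]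
  sgn_der x := by
    obtain ⟨x, rfl⟩ := π_surjective D x
    rw [der_π, sgn_π, sgn_π, der_π, SuperSym.sgn_eq, SuperSym.sgn_eq, DiffSym.inv_der]
  supercomm x y := by
    obtain ⟨x, rfl⟩ := π_surjective D x
    obtain ⟨y, rfl⟩ := π_surjective D y
    have h := congrArg (π D) (supercomm x y)
    rw [sgn_π, sgn_π]
    simpa only [map_add, map_sub, map_mul, map_smul] using h

/-- The generator of `V_I(p)` given by an element of `g`. -/
noncomputable def gen : g →ₗ[ℂ] VI D := (π D).toLinearMap ∘ₗ DiffSym.gen g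

theorem sgn_gen (y : g) : sgn (VI D) (gen D y) = gen D (sgn g y) := by
  change sgn (VI D) (π D _) = π D _
  rw [sgn_π, SuperSym.sgn_eq, DiffSym.inv_gen]

theorem gen_of_mem_m {v : g} (hv : v ∈ D.m) :
    gen D v = -algebraMap ℂ (VI D) (D.form D.f v) := by
  have h := π_rel D (Rel.mk 0 v hv)
  rw [pow_zero, Module.End.one_apply, map_add, AlgHom.commutes, map_zero] at h
  exact eq_neg_of_add_eq_zero_left h

@[elab_as_elim]
theorem induction_der {motive : VI D → Prop}
    (algebraMap : ∀ r, motive (algebraMap ℂ (VI D) r)) (gen : ∀ x, motive (gen D x))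
    (der : ∀ a, motive a → motive (DiffSuperalg.der a))
    (mul : ∀ a b, motive a → motive b → motive (a * b))
    (add : ∀ a b, motive a → motive b → motive (a + b)) (a : VI D) : motive a := by
  obtain ⟨a, rfl⟩ := π_surjective D a
  induction a using DiffSym.induction_der with
  | algebraMap r => rw [AlgHom.commutes]; exact algebraMap r
  | gen x => exact gen x
  | der a ha => rw [← der_π]; exact der _ ha
  | mul a b ha hb => rw [map_mul]; exact mul _ _ ha hb
  | add a b ha hb => rw [map_add]; exact add _ _ ha hb

/-! ### Homomorphisms out of `V_I(p)` as Lax operators. -/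

section Lift

variable {D} {B : Type*} [Ring B] [Algebra ℂ B] [Superspace B] [DiffSuperalg B]

/-- The homomorphism of differential superalgebras out of `V_I(p)` that extends an even linear map
on `g` with the value `-(f | v)` at `v ∈ m`. -/
noncomputable def diffLift (d : g →ₗ[ℂ] B) (hd : ∀ y, sgn B (d y) = d (sgn g y))
    (hm : ∀ v ∈ D.m, d v + algebraMap ℂ B (D.form D.f v) = 0) : VI D →ₐ[ℂ] B :=
  lift D (DiffSym.lift d hd) (by
    rintro _ _ ⟨t, v, hv⟩
    have key : ∀ (t : ℕ) (x : DiffSym g), DiffSym.lift d hd x = 0 →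
        DiffSym.lift d hd ((DiffSym.der g ^ t) x) = 0 := by
      intro t x hx
      induction t with
      | zero => simpa using hx
      | succ t ih =>
        rw [pow_succ', Module.End.mul_apply]
        exact ((DiffSym.isDiffSuperHom_lift d hd).1 _).trans (by rw [ih, map_zero])
    rw [map_zero]
    refine key t _ ?_
    rw [map_add, DiffSym.lift_gen, AlgHom.commutes, hm v hv])

variable (d : g →ₗ[ℂ] B) (hd : ∀ y, sgn B (d y) = d (sgn g y))
  (hm : ∀ v ∈ D.m, d v + algebraMap ℂ B (D.form D.f v) = 0)

theorem diffLift_π (x : DiffSym g) : diffLift d hd hm (π D x) = DiffSym.lift d hd x :=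
  lift_π D _ _ x

theorem diffLift_gen (y : g) : diffLift d hd hm (gen D y) = d y :=
  (diffLift_π d hd hm _).trans (DiffSym.lift_gen d hd y)

theorem isDiffSuperHom_diffLift : IsDiffSuperHom (diffLift d hd hm) := by
  refine ⟨fun x => ?_, fun x => ?_⟩
  · obtain ⟨x, rfl⟩ := π_surjective D x
    have h : DiffSuperalg.der (π D x) = π D (DiffSym.der g x) := der_π D x
    rw [h, diffLift_π, diffLift_π]
    exact (DiffSym.isDiffSuperHom_lift d hd).1 x
  · obtain ⟨x, rfl⟩ := π_surjective D x
    rw [sgn_π, diffLift_π, diffLift_π]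
    exact (DiffSym.isDiffSuperHom_lift d hd).2 x

/-- The homomorphism `V_I(p) → B` that sends the universal Lax operator to `k ∂ + q - f ⊗ 1`. -/
theorem exists_evalHom {q : g ⊗[ℂ] B} (hq : q ∈ tSub B (D.gradeGE (-1))) (hqe : sgn _ q = q) :
    ∃ τ : VI D →ₐ[ℂ] B, IsDiffSuperHom τ ∧
      ∀ y, τ (gen D y) = pairing D y (q - D.f ⊗ₜ 1) := by
  have hd : ∀ y, sgn B ((pairingL D B).flip (q - D.f ⊗ₜ 1) y)
      = (pairingL D B).flip (q - D.f ⊗ₜ 1) (sgn g y) := fun y =>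
    (pairing_sgn D y (by rw [map_sub, hqe, f_tmul_one_even])).symm
  -- The defining relations `v = -(f | v)` hold because `q` is orthogonal to `m`, which leaves the
  -- contribution of `-f ⊗ 1`.
  have hm : ∀ v ∈ D.m, (pairingL D B).flip (q - D.f ⊗ₜ 1) v
      + algebraMap ℂ B (D.form D.f v) = 0 := by
    intro v hv
    have h : pairing D v q = 0 :=
      pairing_eq_zero D (fun u hu => form_gradeGE (by norm_num) hu hv) hq
    rw [LinearMap.flip_apply, pairingL_apply, map_sub, h, pairing_tmul,
      Algebra.algebraMap_eq_smul_one]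
    abel
  exact ⟨diffLift _ hd hm, isDiffSuperHom_diffLift _ hd hm, diffLift_gen _ hd hm⟩

end Lift

/-! ### The universal Lax operator. -/

section QUniv

variable {D} {I : Type*} [Fintype I] [DecidableEq I] (b : Module.Basis I ℂ D.mPerp)
    (b' : Module.Basis I ℂ D.p)
    (hdual : ∀ i j, D.form (b i : g) (b' j : g) = if i = j then 1 else 0)
include hdual

theorem qUniv_mem : qUniv D b b' ∈ tSub (VI D) D.mPerp :=
  Submodule.sum_mem _ fun i _ => tmul_mem_tSub (b i).2 _

variable [FiniteDimensional ℂ g]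

/-- On `p` this is the expansion in dual bases, with no contribution of `f`. On `m` the part in
`m^⊥` drops out and `-(f | y)` is the relation in `V_I(p)`. By `p + m = g` the Lax operator packages
all generators at once. -/
theorem pairing_qUniv (y : g) : pairing D y (qUniv D b b' - D.f ⊗ₜ 1) = gen D y := by
  have hp : ∀ y ∈ D.p, pairing D y (qUniv D b b' - D.f ⊗ₜ 1) = gen D y := by
    intro y hy
    have h1 : y = ∑ i, b'.repr ⟨y, hy⟩ i • (b' i : g) := by
      have := congrArg (fun y : D.p => (y : g)) (b'.sum_repr ⟨y, hy⟩)
      simp only [AddSubmonoidClass.coe_finsetSum, Submodule.coe_smul] at this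
      exact this.symm
    have h2 : ∀ i, D.form (b i : g) y = b'.repr ⟨y, hy⟩ i := by
      intro i
      conv_lhs => rw [h1]
      simp [hdual]
    rw [map_sub, pairing_tmul, form_f_p hy, zero_smul, sub_zero, qUniv, map_sum]
    simp only [pairing_tmul, h2]
    conv_rhs => rw [h1]
    rw [map_sum]
    simp only [map_smul]
    rfl
  have hm : ∀ y ∈ D.m, pairing D y (qUniv D b b' - D.f ⊗ₜ 1) = gen D y := by
    intro y hy
    rw [map_sub, pairing_eq_zero D (U := D.mPerp) (fun u hu => hu y hy) (qUniv_mem b b' hdual),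
        pairing_tmul,
      gen_of_mem_m D hy, Algebra.algebraMap_eq_smul_one, zero_sub]
  obtain ⟨y1, hy1, y2, hy2, rfl⟩ :=
    Submodule.mem_sup.1 (p_sup_m b b' hdual ▸ Submodule.mem_top : y ∈ _)
  have h := map_add ((pairingL D (VI D)).flip (qUniv D b b' - D.f ⊗ₜ 1)) y1 y2
  simp only [LinearMap.flip_apply, pairingL_apply] at h
  rw [h, hp y1 hy1, hm y2 hy2, map_add]

/-- The dual bases need not be homogeneous. Evenness holds because the pairing with `y` is the
generator `y`, which depends on `y` compatibly with parity. -/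
theorem qUniv_even : sgn _ (qUniv D b b') = qUniv D b b' := by
  have key : sgn _ (qUniv D b b' - D.f ⊗ₜ 1) = qUniv D b b' - D.f ⊗ₜ 1 := by
    refine eq_of_pairing_eq D fun y => ?_
    have h := pairing_sgn_apply D (sgn g y) (sgn _ (qUniv D b b' - D.f ⊗ₜ 1))
    rw [sgn_sgn, sgn_sgn, pairing_qUniv b b' hdual, sgn_gen, sgn_sgn] at h
    rw [h, pairing_qUniv b b' hdual]
  rw [map_sub, f_tmul_one_even] at key
  exact sub_left_injective key

/-- The image of the universal Lax operator under the evaluation homomorphism. -/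
theorem lTensor_qUniv {B : Type*} [Ring B] [Algebra ℂ B] {τ : VI D →ₐ[ℂ] B} {q : g ⊗[ℂ] B}
    (hτ : ∀ y, τ (gen D y) = pairing D y (q - D.f ⊗ₜ 1)) :
    τ.toLinearMap.lTensor g (qUniv D b b') = q := by
  have key : τ.toLinearMap.lTensor g (qUniv D b b' - D.f ⊗ₜ 1) = q - D.f ⊗ₜ 1 := by
    refine eq_of_pairing_eq D fun y => ?_
    rw [pairing_lTensor, pairing_qUniv b b' hdual]
    exact hτ y
  rw [map_sub, LinearMap.lTensor_tmul, AlgHom.toLinearMap_apply, map_one] at key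
  exact sub_left_injective key

end QUniv

end VI

/-! ### The operators `{a_λ ·}` on `V_I(p)` -/

section LambdaVI

variable {D} (k : ℂ) (i : ZMod 2) (a : g)

variable (D) in
/-- The values of `F ↦ F + ε {a_λ F}` on `g`. -/
noncomputable def lamVIGen : g →ₗ[ℂ] SqZero i (VI D) where
  toFun y := SqZero.mk (VI.gen D y) (Polynomial.C (VI.gen D (br a y))
    + Polynomial.X * Polynomial.C (algebraMap ℂ (VI D) (k * D.form a y)))
  map_add' x y := SqZero.ext' (by simp) (by simp [mul_add]; abel)
  map_smul' c x := by
    refine SqZero.ext' (by simp) ?_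
    have h : ∀ z : ℂ, algebraMap ℂ (VI D) (c • z) = c • algebraMap ℂ (VI D) z := fun z => by
      rw [Algebra.algebraMap_eq_smul_one, Algebra.algebraMap_eq_smul_one, smul_assoc]
    simp only [SqZero.snd_mk, SqZero.snd_smul, RingHom.id_apply, map_smul, smul_add, h,
      ← Polynomial.smul_C, mul_smul_comm]

variable {i a}

theorem sgn_lamVIGen (ha : a ∈ part (M := g) i) (y : g) :
    sgn _ (lamVIGen D k i a y) = lamVIGen D k i a (sgn g y) := by
  refine SqZero.ext' (by simp [lamVIGen, VI.sgn_gen]) ?_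
  have h1 : sgn g (br a y) = (-1 : ℂ) ^ i.val • br a (sgn g y) := by
    have key : ∀ (j : ZMod 2) (y : g), y ∈ part (M := g) j →
        sgn g (br a y) = (-1 : ℂ) ^ i.val • br a (sgn g y) := by
      intro j y hy
      rw [sgn_part hy, sgn_part (br_mem ha hy), map_smul, smul_smul]
      have h11 : (1 + 1 : ZMod 2) = 0 := by decide
      rcases zmod2_cases i with rfl | rfl <;> rcases zmod2_cases j with rfl | rfl <;>
        simp [ZMod.val_one, h11]
    rw [← projEven_add_projOdd y]
    simp only [map_add, smul_add, key 0 _ (projEven_mem y), key 1 _ (projOdd_mem y)]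
  have h2 : D.form a (sgn g y) = (-1 : ℂ) ^ i.val * D.form a y := by
    rw [← form_sgn, sgn_part ha]
    simp
  have hX : sgn (VI D)[X] (Polynomial.X : (VI D)[X]) = Polynomial.X := by
    rw [Polynomial.X, sgn_monomial, sgn_one]
  have h3 : (-1 : ℂ) ^ i.val * (-1 : ℂ) ^ i.val = 1 := by
    rw [← mul_pow]
    simp
  have h4 : algebraMap ℂ (VI D) (k * D.form a (sgn g y))
      = (-1 : ℂ) ^ i.val • algebraMap ℂ (VI D) (k * D.form a y) := by
    rw [h2, Algebra.smul_def ((-1 : ℂ) ^ i.val), ← map_mul]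
    ring_nf
  simp only [lamVIGen, LinearMap.coe_mk, AddHom.coe_mk, SqZero.snd_sgn, SqZero.snd_mk, map_add,
    sgn_mul, sgn_C, hX, VI.sgn_gen, sgn_algebraMap, h1, h4, map_smul, ← Polynomial.smul_C,
    mul_smul_comm, smul_add, smul_smul, h3, one_smul]

/-- `{a_λ ·}` preserves `I` for `a ∈ n`: the bracket `[a, v]` has `ad h`-degree `≥ 3`, so its class
`-(f | [a, v])` is zero, and `(a | v) = 0` by degree. -/
theorem lamVIGen_of_mem_m (han : a ∈ D.n) (v : g) (hv : v ∈ D.m) :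
    lamVIGen D k i a v + algebraMap ℂ _ (D.form D.f v) = 0 := by
  have h1 : br a v ∈ D.gradeGE (1 + 2) := br_mem_gradeGE han hv
  have h2 : D.form D.f (br a v) = 0 := form_gradeGE (by norm_num) f_mem_gradeGE h1
  have h3 : D.form a v = 0 := form_gradeGE (by norm_num) han hv
  rw [Algebra.algebraMap_eq_smul_one]
  refine SqZero.ext' ?_ ?_
  · simp [lamVIGen, VI.gen_of_mem_m D hv, Algebra.algebraMap_eq_smul_one]
  · have h4 : VI.gen D (br a v) = 0 := by
      rw [VI.gen_of_mem_m D (gradeGE_anti (by norm_num) h1), h2, map_zero, neg_zero]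
    simp [lamVIGen, h3, h4]

/-- The homomorphism `F ↦ F + ε {a_λ F}` on `V_I(p)`, for `a ∈ n`. -/
noncomputable def lamVI (ha : a ∈ part (M := g) i) (han : a ∈ D.n) : VI D →ₐ[ℂ] SqZero i (VI D) :=
  VI.diffLift (lamVIGen D k i a) (sgn_lamVIGen k ha) (lamVIGen_of_mem_m k han)

theorem map_π_lamAddDer (P : (DiffSym g)[X]) :
    Polynomial.map (VI.π D).toRingHom (lamAddDer P)
      = Polynomial.X * Polynomial.map (VI.π D).toRingHom P
        + der (Polynomial.map (VI.π D).toRingHom P) := by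
  induction P using Polynomial.induction_on' with
  | add p q hp hq => simp only [map_add, Polynomial.map_add, mul_add, hp, hq]; abel
  | monomial n b =>
    have h : (der (VI.π D b) : VI D) = VI.π D (DiffSym.der g b) := VI.der_π D b
    simp [lamAddDer, mapCoeff_monomial, Polynomial.map_monomial, der_monomial, h]

/-- Both sides are multiplicative in `F` by the Leibniz rule and intertwine `∂` with `λ + ∂` on the
`ε`-part by sesquilinearity, so they agree once they agree on `g`. -/
theorem lamVI_π (ha : a ∈ part (M := g) i) (han : a ∈ D.n) (F : DiffSym g) :
    lamVI k ha han (VI.π D F) = SqZero.mk (VI.π D F)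
      (Polynomial.map (VI.π D).toRingHom (lamBracket D k i a ha F)) := by
  rw [lamVI, VI.diffLift_π]
  induction F using SuperSym.induction with
  | algebraMap r =>
    have h : lamBracket D k i a ha (algebraMap ℂ _ r) = 0 := SuperSym.ext_algebraMap _ _ _ _ r
    rw [h, AlgHom.commutes, AlgHom.commutes, Polynomial.map_zero,
      Algebra.algebraMap_eq_smul_one, Algebra.algebraMap_eq_smul_one]
    exact SqZero.ext' (by simp) (by simp)
  | add a b ha hb =>
    rw [map_add, ha, hb]
    exact SqZero.ext' (by simp) (by simp)
  | mul x y hx hy =>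
    rw [map_mul, hx, hy, lamBracket_mul]
    refine SqZero.ext' (by simp) ?_
    have h : SqZero.twist i (VI D) (VI.π D x)
        = VI.π D ((SuperSym.inv ^ i.val : DiffSym g →ₐ[ℂ] DiffSym g) x) := by
      rcases zmod2_cases i with rfl | rfl
      · simp [SqZero.twist_zero]
      · rw [SqZero.twist_one, VI.sgn_π, SuperSym.sgn_eq]
        simp [ZMod.val_one]
    simp [Polynomial.map_add, Polynomial.map_mul, h]
  | ι x =>
    have h1 : lamBracket D k i a ha (SuperSym.ι _ x) = lamLin D k a x := SuperSym.ext_ι _ _ _ _ x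
    rw [h1, DiffSym.lift, SuperSym.lift_ι]
    induction x with
    | zero => exact SqZero.ext' (by simp) (by simp)
    | add x y hx hy =>
      rw [map_add, hx (SuperSym.ext_ι _ _ _ _ x), hy (SuperSym.ext_ι _ _ _ _ y)]
      exact SqZero.ext' (by simp) (by simp)
    | tmul P y =>
      have h2 : ∀ n : ℕ, DiffSym.liftLin (lamVIGen D k i a) ((Polynomial.X ^ n : ℂ[X]) ⊗ₜ[ℂ] y)
          = SqZero.mk (VI.π D (SuperSym.ι _ ((Polynomial.X ^ n : ℂ[X]) ⊗ₜ[ℂ] y)))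
            (Polynomial.map (VI.π D).toRingHom
              (lamLin D k a ((Polynomial.X ^ n : ℂ[X]) ⊗ₜ[ℂ] y))) := by
        intro n
        induction n with
        | zero =>
          rw [DiffSym.liftLin_tmul, lamLin_tmul]
          refine SqZero.ext' ?_ ?_
          · simp [lamVIGen, VI.gen, DiffSym.gen]
          · simp [lamVIGen, VI.gen, lamGen]
        | succ n ih =>
          have e1 : (Polynomial.X ^ (n + 1) : ℂ[X]) ⊗ₜ[ℂ] y
              = DiffSym.shift g ((Polynomial.X ^ n : ℂ[X]) ⊗ₜ[ℂ] y) := by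
            simp [DiffSym.shift, pow_succ']
          have e2 : lamLin D k a (DiffSym.shift g ((Polynomial.X ^ n : ℂ[X]) ⊗ₜ[ℂ] y))
              = lamAddDer (lamLin D k a ((Polynomial.X ^ n : ℂ[X]) ⊗ₜ[ℂ] y)) := by
            simp [DiffSym.shift, lamLin_tmul]
          rw [e1, DiffSym.liftLin_shift, ih, e2, map_π_lamAddDer, ← DiffSym.der_ι, ← VI.der_π]
          rfl
      clear h1
      induction P using Polynomial.induction_on' with
      | add P Q hP hQ =>
        rw [TensorProduct.add_tmul, map_add, hP, hQ]
        exact SqZero.ext' (by simp) (by simp)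
      | monomial n c =>
        rw [← Polynomial.smul_X_eq_monomial, ← TensorProduct.smul_tmul', map_smul, h2]
        refine SqZero.ext' (by simp) ?_
        have h3 := map_smul (Polynomial.mapAlgHom (VI.π D)) c
          (lamLin D k a ((Polynomial.X ^ n : ℂ[X]) ⊗ₜ[ℂ] y))
        simp only [SqZero.snd_smul, SqZero.snd_mk, map_smul]
        exact h3.symm

theorem fst_lamVI (ha : a ∈ part (M := g) i) (han : a ∈ D.n) (F : VI D) :
    (lamVI k ha han F).1 = F := by
  obtain ⟨F, rfl⟩ := VI.π_surjective D F
  rw [lamVI_π]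
  rfl

theorem isDiffSuperHom_lamVI (ha : a ∈ part (M := g) i) (han : a ∈ D.n) :
    IsDiffSuperHom (lamVI (D := D) k ha han) := VI.isDiffSuperHom_diffLift _ _ _

theorem lamVI_gen (ha : a ∈ part (M := g) i) (han : a ∈ D.n) (y : g) :
    lamVI k ha han (VI.gen D y) = SqZero.mk (VI.gen D y) (Polynomial.C (VI.gen D (br a y))
      + Polynomial.X * Polynomial.C (algebraMap ℂ (VI D) (k * D.form a y))) :=
  VI.diffLift_gen _ _ _ y

/-- For `a ∈ n` the bracket descends to `V_I(p)`, so the condition on a representative depends only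
on its class. -/
theorem mem_WAlg_iff {F : VI D} : F ∈ WAlg D k ↔ ∀ (i : ZMod 2) (a : g)
    (ha : a ∈ part (M := g) i) (han : a ∈ D.n), (lamVI k ha han F).2 = 0 := by
  constructor
  · rintro ⟨F, hF, rfl⟩ i a ha han
    change (lamVI k ha han (VI.π D F)).2 = 0
    rw [lamVI_π]
    exact hF i a ha han
  · intro h
    obtain ⟨F, rfl⟩ := VI.π_surjective D F
    refine ⟨F, fun i a ha han => ?_, rfl⟩
    have := h i a ha han
    rwa [lamVI_π] at this

theorem der_mem_WAlg {F : VI D} (hF : F ∈ WAlg D k) : der F ∈ WAlg D k := by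
  rw [mem_WAlg_iff] at hF ⊢
  intro i a ha han
  rw [(isDiffSuperHom_lamVI k ha han).1, SqZero.der_eq, SqZero.snd_derivation, hF i a ha han]
  simp

end LambdaVI

end VIStructure

/-! ### Gauge derivations -/

section GaugeDerivation

variable {B B' : Type*} [Ring B] [Algebra ℂ B] [Superspace B] [DiffSuperalg B]
  [Ring B'] [Algebra ℂ B'] [Superspace B'] [DiffSuperalg B']

/-- `∑ P_n λ^n ↦ ∑ (∂^n ε) τ(P_n)`. -/
noncomputable def contract (τ : B →ₐ[ℂ] B') (ε : B') : B[X] →ₗ[ℂ] B' :=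
  Polynomial.lsum fun n =>
    LinearMap.mulLeft ℂ (((der (B := B') : Module.End ℂ B') ^ n) ε) ∘ₗ τ.toLinearMap

theorem contract_monomial (τ : B →ₐ[ℂ] B') (ε : B') (n : ℕ) (b : B) :
    contract τ ε (Polynomial.monomial n b)
      = ((der (B := B') : Module.End ℂ B') ^ n) ε * τ b := by
  simp [contract, Polynomial.lsum_apply, Polynomial.sum_monomial_index]

theorem contract_C (τ : B →ₐ[ℂ] B') (ε : B') (b : B) :
    contract τ ε (Polynomial.C b) = ε * τ b := by
  rw [← Polynomial.monomial_zero_left, contract_monomial, pow_zero, Module.End.one_apply]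

theorem contract_X_mul_C (τ : B →ₐ[ℂ] B') (ε : B') (b : B) :
    contract τ ε (Polynomial.X * Polynomial.C b) = der ε * τ b := by
  rw [Polynomial.X_mul_C, Polynomial.C_mul_X_eq_monomial, contract_monomial, pow_one]

theorem contract_mul_C (τ : B →ₐ[ℂ] B') (ε : B') (P : B[X]) (b : B) :
    contract τ ε (P * Polynomial.C b) = contract τ ε P * τ b := by
  induction P using Polynomial.induction_on' with
  | add p q hp hq => simp only [add_mul, map_add, hp, hq]
  | monomial n c => rw [Polynomial.monomial_mul_C, contract_monomial, contract_monomial, map_mul,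
      mul_assoc]

theorem pow_der_mem_part {i : ZMod 2} {ε : B'} (hε : ε ∈ part (M := B') i) (n : ℕ) :
    ((der (B := B') : Module.End ℂ B') ^ n) ε ∈ part (M := B') i := by
  induction n with
  | zero => simpa using hε
  | succ n ih =>
    rw [pow_succ', Module.End.mul_apply]
    exact der_mem_part ih

/-- Moving `τ(b)` past `∂^n ε`, which has the parity of `ε`, absorbs the sign of the twisted Leibniz
rule. So contraction turns `{a_λ ·}` into an untwisted derivation along `τ`. -/
theorem contract_C_mul {τ : B →ₐ[ℂ] B'} (hτ : IsDiffSuperHom τ) {i : ZMod 2} {ε : B'}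
    (hε : ε ∈ part (M := B') i) (P : B[X]) (b : B) :
    contract τ ε (Polynomial.C (SqZero.twist i B b) * P) = τ b * contract τ ε P := by
  induction P using Polynomial.induction_on' with
  | add p q hp hq => simp only [mul_add, map_add, hp, hq]
  | monomial n c =>
    rw [Polynomial.C_mul_monomial, contract_monomial, contract_monomial, map_mul, ← mul_assoc,
      ← mul_assoc]
    congr 1
    have h := pow_der_mem_part hε n
    rcases zmod2_cases i with rfl | rfl
    · rw [SqZero.twist_zero, mul_even _ h]
    · rw [SqZero.twist_one, mul_odd _ h, hτ.2]

/-- With `λ^n` replaced by `∂^n ε`, the operator `λ + ∂` becomes `∂` by the Leibniz rule. -/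
theorem contract_der {τ : B →ₐ[ℂ] B'} (hτ : IsDiffSuperHom τ) (ε : B') (P : B[X]) :
    contract τ ε (Polynomial.X * P + der P) = der (contract τ ε P) := by
  induction P using Polynomial.induction_on' with
  | add p q hp hq =>
    rw [map_add (contract τ ε) p q, map_add (der (B := B')), ← hp, ← hq, ← map_add, mul_add,
      map_add (der (B := B[X])), add_add_add_comm]
  | monomial n c =>
    rw [Polynomial.X_mul_monomial, der_monomial, map_add, contract_monomial, contract_monomial,
      contract_monomial, der_mul, hτ.1, pow_succ', Module.End.mul_apply]

variable {g : Type*} [AddCommGroup g] [Module ℂ g] [Superspace g] [LieSuperalg g]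
  {D : SlTriple g}

/-- For an even `X ∈ n ⊗ B`, the derivation of `V_I(p)` with values in `B` that acts on the Lax
operator by `ad X`. It is zero on the W-superalgebra. -/
theorem exists_gaugeDerivation (k : ℂ) {τ : VI D →ₐ[ℂ] B} (hτ : IsDiffSuperHom τ)
    {Q : g ⊗[ℂ] B} (hQ : ∀ y, τ (VI.gen D y) = pairing D y Q) {X : g ⊗[ℂ] B}
    (hX : X ∈ tSub B D.n) (hXe : sgn _ X = X) :
    ∃ E : VI D →ₗ[ℂ] B, (∀ x y, E (x * y) = E x * τ y + τ x * E y) ∧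
      (∀ x, E (der x) = der (E x)) ∧
      (∀ y, E (VI.gen D y) = pairing D y (adG X (k, Q)).2) ∧ ∀ F ∈ WAlg D k, E F = 0 := by
  -- All conditions on `E` are additive in `X`, so it suffices to treat `X = a ⊗ ε` with `p(a) =
  -- p(ε)`.
  refine even_tSub_induction (U := D.n) (fun u hu => sgn_mem_gradeGE (D := D) (d := 1) hu)
    (motive := fun X => ∃ E : VI D →ₗ[ℂ] B, (∀ x y, E (x * y) = E x * τ y + τ x * E y) ∧
      (∀ x, E (der x) = der (E x)) ∧
      (∀ y, E (VI.gen D y) = pairing D y (adG X (k, Q)).2) ∧ ∀ F ∈ WAlg D k, E F = 0)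
    ?_ ?_ ?_ hX hXe
  · exact ⟨0, by simp, by simp, by simp [adG_apply], by simp⟩
  · rintro X Y ⟨E, h1, h2, h3, h4⟩ ⟨E', h1', h2', h3', h4'⟩
    refine ⟨E + E', fun x y => ?_, fun x => ?_, fun y => ?_, fun F hF => ?_⟩
    · simp only [LinearMap.add_apply, h1, h1', add_mul, mul_add]
      abel
    · simp only [LinearMap.add_apply, h2, h2', map_add]
    · simp only [LinearMap.add_apply, h3, h3', adG_add, Prod.snd_add, map_add]
    · simp only [LinearMap.add_apply, h4 F hF, h4' F hF, add_zero]
  · intro i a ε han ha hε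
    let σ : VI D →ₗ[ℂ] (VI D)[X] :=
      { toFun := fun F => (lamVI k ha han F).2
        map_add' := fun x y => by simp
        map_smul' := fun c x => by simp }
    have hσ : ∀ F, σ F = (lamVI k ha han F).2 := fun F => rfl
    -- The sign comes from `pairing_tensorBr` and from `[X, k∂] = -k ∂X`: the gauge action on the
    -- generator `y` is `-(ε τ([a, y]) + k (a | y) ∂ε)`, the negative of the contracted `{a_λ y}`.
    refine ⟨-(contract τ ε ∘ₗ σ), fun x y => ?_, fun x => ?_, fun y => ?_, fun F hF => ?_⟩
    · simp only [LinearMap.neg_apply, LinearMap.comp_apply, hσ, map_mul, SqZero.snd_mul, map_add,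
        fst_lamVI, contract_mul_C, contract_C_mul hτ hε]
      noncomm_ring
    · simp only [LinearMap.neg_apply, LinearMap.comp_apply, hσ,
        (isDiffSuperHom_lamVI k ha han).1, SqZero.der_eq, SqZero.snd_derivation,
        contract_der hτ, map_neg]
    · rw [LinearMap.neg_apply, LinearMap.comp_apply, hσ, lamVI_gen, SqZero.snd_mk, map_add,
        contract_C, contract_X_mul_C, AlgHom.commutes, hQ, adG_apply, map_sub,
        pairing_tensorBr D ha hε, map_smul, LinearMap.lTensor_tmul, pairing_tmul, smul_smul,
        ← Algebra.commutes, ← Algebra.smul_def]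
      abel
    · rw [LinearMap.neg_apply, LinearMap.comp_apply, hσ, (mem_WAlg_iff k).1 hF i a ha han,
        map_zero, neg_zero]

end GaugeDerivation

/-! ### Evaluation of `B[t]` -/

section EvalAt

variable {B : Type*} [Ring B] [Algebra ℂ B]

/-- Evaluation at a complex number. -/
noncomputable def evalLin (s : ℂ) : B[X] →ₗ[ℂ] B :=
  Polynomial.lsum fun n => s ^ n • LinearMap.id

theorem evalLin_monomial (s : ℂ) (n : ℕ) (b : B) :
    evalLin s (Polynomial.monomial n b) = s ^ n • b := by
  simp [evalLin, Polynomial.lsum_apply, Polynomial.sum_monomial_index]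

theorem evalLin_C (s : ℂ) (b : B) : evalLin s (Polynomial.C b) = b := by
  rw [← Polynomial.monomial_zero_left, evalLin_monomial, pow_zero, one_smul]

/-- Evaluation at a complex number as an algebra map. -/
noncomputable def evalAt (s : ℂ) : B[X] →ₐ[ℂ] B :=
  AlgHom.ofLinearMap (evalLin s) (by rw [← Polynomial.C_1, evalLin_C]) (by
    intro x y
    induction x using Polynomial.induction_on' with
    | add p q hp hq => simp only [map_add, add_mul, hp, hq]
    | monomial n b =>
      induction y using Polynomial.induction_on' with
      | add p q hp hq => simp only [map_add, mul_add, hp, hq]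
      | monomial m c => rw [Polynomial.monomial_mul_monomial, evalLin_monomial, evalLin_monomial,
          evalLin_monomial, smul_mul_smul_comm, pow_add])

theorem evalAt_monomial (s : ℂ) (n : ℕ) (b : B) :
    evalAt s (Polynomial.monomial n b) = s ^ n • b := evalLin_monomial s n b

theorem evalAt_C (s : ℂ) (b : B) : evalAt s (Polynomial.C b) = b := evalLin_C s b

theorem evalAt_X_mul_C (s : ℂ) (b : B) :
    evalAt s (Polynomial.X * Polynomial.C b) = s • b := by
  rw [Polynomial.X_mul_C, Polynomial.C_mul_X_eq_monomial, evalAt_monomial, pow_one]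

variable [Superspace B] [DiffSuperalg B]

theorem isDiffSuperHom_evalAt (s : ℂ) : IsDiffSuperHom (evalAt (B := B) s) := by
  refine ⟨fun x => ?_, fun x => ?_⟩
  · induction x using Polynomial.induction_on' with
    | add p q hp hq => simp only [map_add, hp, hq]
    | monomial n b => rw [der_monomial, evalAt_monomial, evalAt_monomial, map_smul]
  · induction x using Polynomial.induction_on' with
    | add p q hp hq => simp only [map_add, hp, hq]
    | monomial n b => rw [sgn_monomial, evalAt_monomial, evalAt_monomial, map_smul]

variable (B) in
/-- The inclusion of the constants. -/
noncomputable def constHom : B →ₐ[ℂ] B[X] := Polynomial.CAlgHom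

theorem constHom_apply (b : B) : constHom B b = Polynomial.C b := rfl

theorem isDiffSuperHom_constHom : IsDiffSuperHom (constHom B) :=
  ⟨fun x => (der_C x).symm, fun x => (sgn_C x).symm⟩

variable (B) in
/-- Differentiation by `t`. -/
noncomputable def derivT : B[X] →ₗ[ℂ] B[X] :=
  (Polynomial.derivative : B[X] →ₗ[B] B[X]).restrictScalars ℂ

theorem derivT_apply (P : B[X]) : derivT B P = Polynomial.derivative P := rfl

theorem derivT_mul (x y : B[X]) : derivT B (x * y) = derivT B x * y + x * derivT B y :=
  Polynomial.derivative_mul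

theorem derivT_monomial (n : ℕ) (b : B) :
    derivT B (Polynomial.monomial n b) = Polynomial.monomial (n - 1) ((n : ℂ) • b) := by
  rw [derivT_apply, Polynomial.derivative_monomial, ← nsmul_eq_mul', Nat.cast_smul_eq_nsmul]

theorem derivT_sgn (x : B[X]) : derivT B (sgn _ x) = sgn _ (derivT B x) := by
  induction x using Polynomial.induction_on' with
  | add p q hp hq => simp only [map_add, hp, hq]
  | monomial n b => rw [derivT_monomial, sgn_monomial, sgn_monomial, derivT_monomial, map_smul
      (sgn B)]

theorem derivT_der (x : B[X]) : derivT B (der x) = der (derivT B x) := by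
  induction x using Polynomial.induction_on' with
  | add p q hp hq => simp only [map_add, hp, hq]
  | monomial n b => rw [derivT_monomial, der_monomial, der_monomial, derivT_monomial, map_smul
      (der (B := B))]

theorem tensorBr_mulLeft_X {g : Type*} [AddCommGroup g] [Module ℂ g] [Superspace g]
    [LieSuperalg g] (x z : g ⊗[ℂ] B[X]) :
    tensorBr g B[X] x ((LinearMap.mulLeft ℂ (Polynomial.X : B[X])).lTensor g z)
      = (LinearMap.mulLeft ℂ (Polynomial.X : B[X])).lTensor g (tensorBr g B[X] x z) := by
  have h : ∀ F H : B[X], F * (Polynomial.X * H) = Polynomial.X * (F * H) := fun F H => by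
    rw [← mul_assoc, ← Polynomial.X_mul, mul_assoc]
  induction x with
  | zero => simp
  | add x y hx hy => simp only [map_add, LinearMap.add_apply, hx, hy]
  | tmul a F =>
    induction z with
    | zero => simp
    | add x y hx hy => simp only [map_add, hx, hy]
    | tmul c H => simp [tensorBr, h]

end EvalAt

/-! ### The W-superalgebra in terms of the canonical form -/

section WCanonical

variable {g : Type*} [AddCommGroup g] [Module ℂ g] [Superspace g] [LieSuperalg g]
  {D : SlTriple g}

theorem adG_zero {B : Type*} [Ring B] [Algebra ℂ B] [Superspace B] [DiffSuperalg B] :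
    adG (0 : g ⊗[ℂ] B) = 0 := by
  have := adG_sub (0 : g ⊗[ℂ] B) 0
  rwa [sub_zero, sub_self] at this

/-- The path `e^{t ad X} L` from `L` to `e^{ad X} L`, and its derivative. -/
theorem exists_gaugePath {M : ℕ} (hM1 : D.gradeGE (-M) = ⊤) (hM : D.gradeGE M = ⊥)
    {B : Type*} [Ring B] [Algebra ℂ B] [Superspace B] [DiffSuperalg B] (k : ℂ) {q X : g ⊗[ℂ] B}
    (hq : q ∈ tSub B (D.gradeGE (-1))) (hqe : sgn _ q = q) (hX : X ∈ tSub B (D.gradeGE 1))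
    (hXe : sgn _ X = X) :
    ∃ Q : g ⊗[ℂ] B[X], Q ∈ tSub B[X] (D.gradeGE (-1)) ∧ sgn _ Q = Q ∧
      (∀ s : ℂ, laxG D k ((evalAt s).toLinearMap.lTensor g Q)
        = truncExp (2 * M + 2) (adG (s • X)) (laxG D k q)) ∧
      (derivT B).lTensor g (Q - D.f ⊗ₜ 1)
        = (adG ((constHom B).toLinearMap.lTensor g X) (laxG D k Q)).2 := by
  set Y := (constHom B).toLinearMap.lTensor g X with hY
  -- The element `t X` over `B[t]`. The path is obtained by transforming the constant Lax operator
  -- with it.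
  set Z := (LinearMap.mulLeft ℂ (Polynomial.X : B[X])).lTensor g Y with hZ
  have hYm : Y ∈ tSub B[X] (D.gradeGE 1) := lTensor_mem_tSub _ hX
  have hZm : Z ∈ tSub B[X] (D.gradeGE 1) := lTensor_mem_tSub _ hYm
  have hYe : sgn _ Y = Y := by
    rw [hY, sgn_lTensor _ isDiffSuperHom_constHom.2, hXe]
  have hXX : sgn B[X] (Polynomial.X : B[X]) = Polynomial.X := by
    rw [Polynomial.X, sgn_monomial, sgn_one]
  have hZe : sgn _ Z = Z := by
    rw [hZ, sgn_lTensor _ (fun x => by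
      rw [LinearMap.mulLeft_apply, LinearMap.mulLeft_apply, sgn_mul, hXX]), hYe]
  have hqm := lTensor_mem_tSub (constHom B).toLinearMap hq
  have hqe' : sgn _ ((constHom B).toLinearMap.lTensor g q) = (constHom B).toLinearMap.lTensor g q :=
      by
    rw [sgn_lTensor _ isDiffSuperHom_constHom.2, hqe]
  have hL := truncExp_eq_laxG (D := D) (2 * M) k ((constHom B).toLinearMap.lTensor g q) Z
  refine ⟨transformed D (2 * M) k ((constHom B).toLinearMap.lTensor g q) Z,
    transformed_mem hqm _ hZm hZe, transformed_even hqm _ hqe' hZe, fun s => ?_, ?_⟩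
  · have h1 : (evalAt s).toLinearMap.lTensor g ((constHom B).toLinearMap.lTensor g q) = q := by
      rw [← LinearMap.lTensor_comp_apply]
      convert LinearMap.lTensor_id_apply g B q
      ext x
      exact evalAt_C s x
    have h2 : (evalAt s).toLinearMap.lTensor g Z = s • X := by
      rw [hZ, hY, ← LinearMap.lTensor_comp_apply, ← LinearMap.lTensor_comp_apply]
      have : ((evalAt s).toLinearMap ∘ₗ LinearMap.mulLeft ℂ (Polynomial.X : B[X])) ∘ₗ
          (constHom B).toLinearMap = s • LinearMap.id := by
        ext x
        exact evalAt_X_mul_C s x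
      rw [this, LinearMap.lTensor_smul]
      simp
    rw [← mapG_laxG, ← hL, mapG_truncExp (isDiffSuperHom_evalAt s), mapG_laxG, h1, h2]
  · have hYY : tensorBr g B[X] Y Y = 0 := by
      have h := tensorBr_skew hYe hYe
      rw [eq_neg_iff_add_eq_zero, ← two_smul ℂ] at h
      exact (smul_eq_zero.1 h).resolve_left two_ne_zero
    -- `[X, tX] = t [X, X] = 0`, as `t` is central and `X` is even. So `d/dt` of `e^{t ad X}` is `ad
    -- X · e^{t ad X}`.
    have hc : adG Y * adG Z = adG Z * adG Y := by
      rw [← sub_eq_zero, ← adG_tensorBr hYe hZe, hZ, tensorBr_mulLeft_X, hYY, map_zero, adG_zero]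
    have hδZ : (derivT B).lTensor g Z = Y := by
      rw [hZ, hY, ← LinearMap.lTensor_comp_apply, ← LinearMap.lTensor_comp_apply]
      congr 2
      ext x
      simp [derivT_apply, constHom_apply]
    have hcomm := derG_mul_adG (derivT B) derivT_mul derivT_sgn derivT_der hZe
    rw [hδZ] at hcomm
    have h1 := mul_truncExp_of_commute hcomm hc (2 * M + 1)
    have hnil := adG_pow_eq_zero hM1 hM hZm
    have h2 := LinearMap.congr_fun h1 (laxG D k ((constHom B).toLinearMap.lTensor g q))
    -- Differentiation has shortened the truncated series by one term. The restored term is zero by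
    -- nilpotency.
    rw [← truncExp_succ_of_pow_eq_zero hnil] at h2
    have h0 : derG g (derivT B) (laxG D k ((constHom B).toLinearMap.lTensor g q)) = 0 := by
      have e1 : (derivT B) ∘ₗ (constHom B).toLinearMap = 0 := by
        ext x
        simp [derivT_apply, constHom_apply]
      have e2 : derivT B 1 = 0 := by simp [derivT_apply]
      rw [derG_apply, laxG, map_sub, ← LinearMap.lTensor_comp_apply, e1, LinearMap.lTensor_tmul, e2]
      simp
    rw [LinearMap.add_apply, Module.End.mul_apply, Module.End.mul_apply, Module.End.mul_apply, h0,
      map_zero, zero_add, hL, derG_apply] at h2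
    exact congrArg Prod.snd h2

section

variable [FiniteDimensional ℂ g] {I : Type*} [Fintype I] [DecidableEq I]
    (b : Module.Basis I ℂ D.mPerp) (b' : Module.Basis I ℂ D.p)
    (hdual : ∀ i j, D.form (b i : g) (b' j : g) = if i = j then 1 else 0)
    {k : ℂ} {Vf : Submodule ℂ g} {M : ℕ} (hM1 : D.gradeGE (-M) = ⊤) (hM : D.gradeGE M = ⊥)
    {X v : g ⊗[ℂ] VI D} (hX : X ∈ tSub (VI D) (D.gradeGE 1)) (hXe : sgn _ X = X)
    (hXv : truncExp (2 * M + 2) (adG X) (laxG D k (qUniv D b b')) = laxG D k v)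
include hdual hM1 hM hX hXe hXv

/-- An element of the W-superalgebra is invariant under the gauge transformation that brings the
universal Lax operator to canonical form. -/
theorem mem_of_mem_WAlg {S : Subalgebra ℂ (VI D)} (hSder : ∀ x ∈ S, der x ∈ S)
    (hS : ∀ y, pairing D y v ∈ S) {F : VI D} (hF : F ∈ WAlg D k) : F ∈ S := by
  have hq := VI.qUniv_mem b b' hdual
  rw [mPerp_eq (p_sup_m b b' hdual)] at hq
  have hqe := VI.qUniv_even b b' hdual
  obtain ⟨Q, hQ, hQe, hQs, hQd⟩ := exists_gaugePath hM1 hM k hq hqe hX hXe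
  -- The homomorphism `V_I(p) → V_I(p)[t]` that sends the universal Lax operator to the path.
  obtain ⟨τ, hτ, hτg⟩ := VI.exists_evalHom hQ hQe
  have hYe : sgn _ ((constHom (VI D)).toLinearMap.lTensor g X)
      = (constHom (VI D)).toLinearMap.lTensor g X := by
    rw [sgn_lTensor _ isDiffSuperHom_constHom.2, hXe]
  obtain ⟨E, h1, h2, h3, h4⟩ := exists_gaugeDerivation k hτ hτg
    (lTensor_mem_tSub (constHom (VI D)).toLinearMap hX) hYe
  have hE1 : E 1 = 0 := by
    have := h1 1 1
    simpa using this
  -- Both sides are derivations along `τ` that commute with `∂`, and on generators they agree by the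
  -- differential equation of the path.
  have key : ∀ x, derivT (VI D) (τ x) = E x := by
    intro x
    induction x using VI.induction_der with
    | algebraMap r =>
      rw [AlgHom.commutes, Algebra.algebraMap_eq_smul_one, Algebra.algebraMap_eq_smul_one,
        map_smul, map_smul, hE1]
      simp [derivT_apply]
    | gen y =>
      rw [hτg, h3, ← pairing_lTensor, hQd]
      rfl
    | der a ha => rw [h2, hτ.1, derivT_der, ha]
    | mul a b ha hb => rw [h1, map_mul, derivT_mul, ha, hb]
    | add a b ha hb => simp only [map_add, ha, hb]
  -- `E` kills the W-superalgebra, so the `t`-derivative is zero, and in characteristic zero `τ F`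
  -- is constant.
  have hconst : τ F = Polynomial.C ((τ F).coeff 0) := by
    have := (key F).trans (h4 F hF)
    rw [derivT_apply] at this
    have : Module ℚ (VI D) := Module.compHom _ (algebraMap ℚ ℂ)
    have : IsAddTorsionFree (VI D) := .of_module_rat _
    exact Polynomial.eq_C_of_derivative_eq_zero ‹_›
  have hev : ∀ s s' : ℂ, evalAt s (τ F) = evalAt s' (τ F) := fun s s' => by
    rw [hconst, evalAt_C, evalAt_C]
  have hs : ∀ s y, evalAt s (τ (VI.gen D y))
      = pairing D y (laxG D k ((evalAt s).toLinearMap.lTensor g Q)).2 := by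
    intro s y
    rw [hτg]
    have h := pairing_lTensor D (evalAt s).toLinearMap y (Q - D.f ⊗ₜ[ℂ] (1 : (VI D)[X]))
    rw [map_sub, LinearMap.lTensor_tmul, AlgHom.toLinearMap_apply, map_one] at h
    exact h.symm
  -- At `t = 0` the path is at the universal Lax operator itself.
  have h0 : ∀ x, evalAt 0 (τ x) = x := by
    intro x
    induction x using VI.induction_der with
    | algebraMap r => rw [AlgHom.commutes, AlgHom.commutes]
    | gen y =>
      rw [hs, hQs, zero_smul, adG_zero, truncExp_succ_zero]
      exact VI.pairing_qUniv b b' hdual y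
    | der a ha => rw [hτ.1, (isDiffSuperHom_evalAt 0).1, ha]
    | mul a b ha hb => rw [map_mul, map_mul, ha, hb]
    | add a b ha hb => rw [map_add, map_add, ha, hb]
  -- At `t = 1` the path is at the canonical form, so every generator goes to a coefficient of it
  -- plus a scalar.
  have h1 : ∀ x, evalAt 1 (τ x) ∈ S := by
    intro x
    induction x using VI.induction_der with
    | algebraMap r => rw [AlgHom.commutes, AlgHom.commutes]; exact S.algebraMap_mem r
    | gen y =>
      rw [hs, hQs, one_smul, hXv]
      simp only [laxG, map_sub, pairing_tmul, ← Algebra.algebraMap_eq_smul_one]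
      exact S.sub_mem (hS y) (S.algebraMap_mem _)
    | der a ha => rw [hτ.1, (isDiffSuperHom_evalAt 1).1]; exact hSder _ ha
    | mul a b ha hb => rw [map_mul, map_mul]; exact S.mul_mem ha hb
    | add a b ha hb => rw [map_add, map_add]; exact S.add_mem ha hb
  rw [← h0 F, hev 0 1]
  exact h1 F

/-- The canonical form is gauge invariant. -/
theorem lamVI_canonical (hv : v ∈ tSub (VI D) Vf) (hVf : Vf ≤ D.gradeGE (-1))
    (H : D.Homotopy Vf) {i : ZMod 2} {a : g}
    (ha : a ∈ part (M := g) i) (han : a ∈ D.n) :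
    ∃ δ : SqZero i (VI D) →ₗ[ℂ] SqZero i (VI D),
      (∀ x, δ x = SqZero.mk 0 (lamVI k ha han x.1).2) ∧
      δ.lTensor g ((SqZero.inl i (VI D)).toLinearMap.lTensor g v) = 0 := by
  -- The derivation `F + εP ↦ ε {a_λ F}`. It is even because `ε` has the parity of `a`, and it
  -- commutes with `∂` because `∂ε = ελ`.
  let δ : SqZero i (VI D) →ₗ[ℂ] SqZero i (VI D) :=
    { toFun := fun x => SqZero.mk 0 (lamVI k ha han x.1).2
      map_add' := fun x y => SqZero.ext' (by simp) (by simp)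
      map_smul' := fun c x => SqZero.ext' (by simp) (by simp) }
  have hδ : ∀ x, δ x = SqZero.mk 0 (lamVI k ha han x.1).2 := fun x => rfl
  refine ⟨δ, hδ, ?_⟩
  have hq := VI.qUniv_mem b b' hdual
  rw [mPerp_eq (p_sup_m b b' hdual)] at hq
  have hι := SqZero.isDiffSuperHom_inl (i := i) (B := VI D)
  -- This element is `ε`.
  have hε : (SqZero.mk 0 1 : SqZero i (VI D)) ∈ part (M := SqZero i (VI D)) i := by
    rw [mem_part_iff]
    exact SqZero.ext' (by simp) (by simp [sgn_one])
  have hXv' := congrArg (mapG g (SqZero.inl i (VI D))) hXv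
  rw [mapG_truncExp hι, mapG_laxG, mapG_laxG] at hXv'
  refine derivation_canonical_eq_zero hM1 hM (lTensor_mem_tSub _ hX)
    (by rw [sgn_lTensor _ hι.2, hXe])
    (neg_mem (tmul_mem_tSub han (SqZero.mk 0 1 : SqZero i (VI D))))
    (by rw [map_neg, tmul_mem_even ha hε])
    (lTensor_mem_tSub _ hv) hVf hXv' δ (fun x y => ?_) (fun x => ?_) (fun x => ?_) ?_ H
  · refine SqZero.ext' (by simp [hδ]) ?_
    simp only [hδ, SqZero.fst_mul, map_mul, SqZero.snd_mk, SqZero.snd_mul, SqZero.snd_add,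
      fst_lamVI, SqZero.fst_mk, map_zero, mul_zero, zero_mul, add_zero, zero_add]
  · refine SqZero.ext' (by simp [hδ]) ?_
    simp only [hδ, SqZero.fst_sgn, (isDiffSuperHom_lamVI k ha han).2, SqZero.snd_mk,
      SqZero.snd_sgn]
  · refine SqZero.ext' (by simp [hδ, SqZero.der_eq]) ?_
    simp only [hδ, SqZero.der_eq, SqZero.fst_derivation, (isDiffSuperHom_lamVI k ha han).1,
      SqZero.snd_mk, SqZero.snd_derivation]
  -- The equation `δL = [-a ⊗ ε, L]`, tested by pairing with `y`: both sides are `ε ([a, y] + k λ (a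
  -- | y))`, with `λ` arising from `∂ε` on the right.
  · rw [derG_apply, adG_apply]
    refine Prod.ext rfl (eq_of_pairing_eq D fun y => ?_)
    have hp : ∀ y, pairing D y (laxG D k
        ((SqZero.inl i (VI D)).toLinearMap.lTensor g (qUniv D b b'))).2
          = SqZero.inl i (VI D) (VI.gen D y) := by
      intro y
      have h := pairing_lTensor D (SqZero.inl i (VI D)).toLinearMap y
        (qUniv D b b' - D.f ⊗ₜ[ℂ] (1 : VI D))
      rw [map_sub, LinearMap.lTensor_tmul, AlgHom.toLinearMap_apply, map_one,
        VI.pairing_qUniv b b' hdual] at h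
      exact h
    have hk : (laxG D k ((SqZero.inl i (VI D)).toLinearMap.lTensor g (qUniv D b b'))).1 = k := rfl
    change pairing D y (δ.lTensor g _) = pairing D y (tensorBr g _ _ _ - _ • der.lTensor g _)
    rw [pairing_lTensor, hp, hδ, SqZero.fst_inl, lamVI_gen, hk]
    simp only [map_neg, map_sub, LinearMap.neg_apply, map_smul, LinearMap.lTensor_tmul,
      pairing_tmul, pairing_tensorBr D ha hε, smul_neg]
    rw [hp]
    refine SqZero.ext' ?_ ?_
    · simp [SqZero.der_eq]
    · simp [SqZero.der_eq, der_one, Algebra.algebraMap_eq_smul_one, ← Polynomial.smul_C, smul_smul]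

end

end WCanonical

/-! ### Differential polynomials and the main theorem -/

namespace SuperFree

variable {J : Type*} (par : J → ZMod 2)

theorem single_mem (j : J) : single par j ∈ part (M := SuperFree par) (par j) :=
  Finsupp.single_mem_supported ℂ 1 rfl

@[elab_as_elim]
theorem induction {motive : SuperFree par → Prop} (zero : motive 0)
    (add : ∀ x y, motive x → motive y → motive (x + y))
    (smul_single : ∀ (c : ℂ) j, motive (c • single par j)) (x : SuperFree par) : motive x := by
  refine Finsupp.induction_linear (motive := motive) x zero add fun j c => ?_
  have h : (Finsupp.single j c : J →₀ ℂ) = c • Finsupp.single j 1 := by simp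
  rw [h]
  exact smul_single c j

variable {B : Type*} [Ring B] [Algebra ℂ B] (w : J → B)

/-- The linear map on the superspace with basis `w_j` that is given on the basis. -/
noncomputable def linearLift : SuperFree par →ₗ[ℂ] B := Finsupp.linearCombination ℂ w

theorem linearLift_single (j : J) : linearLift par w (single par j) = w j :=
  (Finsupp.linearCombination_single ℂ 1 j).trans (one_smul ℂ _)

theorem sgn_linearLift [Superspace B] (hw : ∀ j, w j ∈ part (M := B) (par j))
    (x : SuperFree par) : sgn B (linearLift par w x) = linearLift par w (sgn _ x) := by
  induction x using induction with
  | zero => simp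
  | add x y hx hy => simp only [map_add, hx, hy]
  | smul_single c j =>
    simp only [map_smul, sgn_part (single_mem par j), linearLift_single, sgn_part (hw j)]

end SuperFree

/-! ### Coefficients with respect to a homogeneous basis of `V_f`. -/

section Canonical

variable {g : Type*} [AddCommGroup g] [Module ℂ g] [Superspace g] {Vf : Submodule ℂ g}
  {J : Type*} [Fintype J] (q : Module.Basis J ℂ Vf) (par : J → ZMod 2)

theorem linearIndependent_coe_basis : LinearIndependent ℂ fun j => (q j : g) :=
  q.linearIndependent.map' Vf.subtype (Submodule.ker_subtype Vf)

theorem sum_tmul_mem_tSub {B : Type*} [Ring B] [Algebra ℂ B] (w : J → B) :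
    ∑ j, (q j : g) ⊗ₜ[ℂ] w j ∈ tSub B Vf :=
  Submodule.sum_mem _ fun j _ => tmul_mem_tSub (q j).2 _

variable {par} (hpar : ∀ j, (q j : g) ∈ part (M := g) (par j))
include hpar

theorem sgn_mem_of_homogeneous_basis {v : g} (hv : v ∈ Vf) : sgn g v ∈ Vf := by
  have h := congrArg (fun v : Vf => (v : g)) (q.sum_repr ⟨v, hv⟩)
  simp only [AddSubmonoidClass.coe_finsetSum, Submodule.coe_smul] at h
  rw [← h, map_sum]
  refine Submodule.sum_mem _ fun j _ => ?_
  rw [map_smul, sgn_part (hpar j)]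
  exact Submodule.smul_mem _ _ (Submodule.smul_mem _ _ (q j).2)

theorem sgn_sum_tmul {B : Type*} [Ring B] [Algebra ℂ B] [Superspace B] (w : J → B) :
    sgn _ (∑ j, (q j : g) ⊗ₜ[ℂ] w j)
      = ∑ j, (q j : g) ⊗ₜ[ℂ] ((-1 : ℂ) ^ (par j).val • sgn B (w j)) := by
  rw [map_sum]
  refine Finset.sum_congr rfl fun j _ => ?_
  rw [sgn_tmul, sgn_part (hpar j), TensorProduct.smul_tmul]

theorem sgn_sum_tmul_eq_iff {B : Type*} [Ring B] [Algebra ℂ B] [Superspace B] {w : J → B} :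
    sgn _ (∑ j, (q j : g) ⊗ₜ[ℂ] w j) = ∑ j, (q j : g) ⊗ₜ[ℂ] w j
      ↔ ∀ j, w j ∈ part (M := B) (par j) := by
  have hs : ∀ i : ZMod 2, (-1 : ℂ) ^ i.val * (-1 : ℂ) ^ i.val = 1 := fun i => by
    rw [← mul_pow]
    simp
  rw [sgn_sum_tmul q hpar]
  constructor
  · intro h j
    have h' := congrFun (sum_tmul_injective (linearIndependent_coe_basis q) h) j
    rw [mem_part_iff]
    conv_rhs => rw [← h']
    rw [smul_smul, hs, one_smul]
  · intro h
    refine Finset.sum_congr rfl fun j _ => ?_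
    rw [sgn_part (h j), smul_smul, hs, one_smul]

end Canonical

theorem proposition3p14 {g : Type*} [AddCommGroup g] [Module ℂ g] [FiniteDimensional ℂ g]
    [Superspace g] [LieSuperalg g] (hsimple : LieSuperalg.IsSimple g)
    (D : SlTriple g) (k : ℂ)
    -- dual bases of `m^⊥` and `p`
    {I : Type*} [Fintype I] [DecidableEq I]
    (b : Module.Basis I ℂ D.mPerp) (b' : Module.Basis I ℂ D.p)
    (hdual : ∀ i j, D.form (b i : g) (b' j : g) = if i = j then 1 else 0)
    -- an `ad h`-invariant complement `V_f` of `[f, n]` in `m^⊥` with a homogeneous basis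
    (Vf : Submodule ℂ g) (hVh : ∀ v ∈ Vf, LieSuperalg.br D.h v ∈ Vf)
    (hVdisj : Disjoint Vf (D.n.map (LieSuperalg.br D.f)))
    (hVsup : Vf ⊔ D.n.map (LieSuperalg.br D.f) = D.mPerp)
    {J : Type*} [Fintype J] (q : Module.Basis J ℂ Vf) (par : J → ZMod 2)
    (hpar : ∀ j, (q j : g) ∈ Superspace.part (M := g) (par j)) :
    ∃ (X : g ⊗[ℂ] VI D) (w : J → VI D),
      -- `X` is an even element of `n ⊗ V_I(p)` that brings the universal Lax operator
      -- to canonical form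
      X ∈ Superspace.part (M := g ⊗[ℂ] VI D) 0 ∧ X ∈ tensorSub D D.n ∧
      expAd D X (lax D k (qUniv D b b')) = lax D k (∑ j, (q j : g) ⊗ₜ[ℂ] w j) ∧
      -- uniqueness of the canonical form and of `X`
      (∀ (X' : g ⊗[ℂ] VI D) (w' : J → VI D),
        X' ∈ Superspace.part (M := g ⊗[ℂ] VI D) 0 → X' ∈ tensorSub D D.n →
        expAd D X' (lax D k (qUniv D b b')) = lax D k (∑ j, (q j : g) ⊗ₜ[ℂ] w' j) →
        X' = X ∧ w' = w) ∧
      (∀ j, w j ∈ Superspace.part (M := VI D) (par j)) ∧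
      -- `W(g, f, k) = ℂ_diff[w^j | j ∈ J]`
      ∃ φ : DiffPoly par →ₐ[ℂ] VI D,
        (∀ F, φ (DiffSym.der _ F) = VI.der D (φ F)) ∧
        (∀ F, φ (Superspace.sgn _ F) = Superspace.sgn _ (φ F)) ∧
        (∀ j, φ (DiffSym.gen _ (SuperFree.single par j)) = w j) ∧
        Function.Injective φ ∧
        φ.range = WAlg D k := by
  have hpm := p_sup_m b b' hdual
  have hVs : ∀ v ∈ Vf, sgn g v ∈ Vf := fun v hv => sgn_mem_of_homogeneous_basis q hpar hv
  obtain ⟨H⟩ := exists_homotopy hpm hVh hVs hVdisj hVsup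
  obtain ⟨M, hM1, hM⟩ := D.exists_gradeGE_eq hpm
  have hVf : Vf ≤ D.gradeGE (-1) := by
    rw [← mPerp_eq hpm, ← hVsup]
    exact le_sup_left
  have hind := linearIndependent_coe_basis q
  have hqm := VI.qUniv_mem b b' hdual
  rw [mPerp_eq hpm] at hqm
  have hqe := VI.qUniv_even b b' hdual
  -- The exponential series is finite because `(ad X)^{2M+1} = 0`. One more term is kept to match
  -- `transformed` with `N = 2M`.
  have hexp : ∀ X ∈ tSub (VI D) (D.gradeGE 1), ∀ L,
      expAd D X L = truncExp (2 * M + 2) (adG X) L := fun X hX L =>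
    finsum_exp_eq (pow_eq_zero_of_le (Nat.le_succ _) (adG_pow_eq_zero hM1 hM hX)) L
  have htr : ∀ X ∈ tSub (VI D) (D.gradeGE 1), ∀ w : J → VI D,
      expAd D X (lax D k (qUniv D b b')) = lax D k (∑ j, (q j : g) ⊗ₜ[ℂ] w j)
        ↔ transformed D (2 * M) k (qUniv D b b') X = ∑ j, (q j : g) ⊗ₜ[ℂ] w j := by
    intro X hX w
    rw [hexp X hX]
    exact (truncExp_eq_laxG (2 * M) k (qUniv D b b') X).congr_left.trans
      ⟨laxG_injective, fun h => congrArg (laxG D k) h⟩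
  obtain ⟨X, hX, hXe, hXV⟩ := H.exists_canonical (k := k) hqm (2 * M) hM hqe
  obtain ⟨w, hw⟩ := exists_sum_of_mem_tSub q hXV
  have hwe : ∀ j, w j ∈ part (M := VI D) (par j) := by
    rw [← sgn_sum_tmul_eq_iff q hpar, ← hw, transformed_even hqm _ hqe hXe]
  have hXw : truncExp (2 * M + 2) (adG X) (laxG D k (qUniv D b b'))
      = laxG D k (∑ j, (q j : g) ⊗ₜ[ℂ] w j) := by
    rw [truncExp_eq_laxG, hw]
  have hsgn := SuperFree.sgn_linearLift par w hwe
  let φ : DiffPoly par →ₐ[ℂ] VI D := DiffSym.lift (SuperFree.linearLift par w) hsgn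
  have hφ : IsDiffSuperHom φ := DiffSym.isDiffSuperHom_lift _ _
  have hφg : ∀ x, φ (DiffSym.gen _ x) = SuperFree.linearLift par w x := DiffSym.lift_gen _ _
  have hφj : ∀ j, φ (DiffSym.gen _ (SuperFree.single par j)) = w j := fun j => by
    rw [hφg, SuperFree.linearLift_single]
  refine ⟨X, w, mem_part_zero.2 hXe, hX, (htr X hX w).2 hw, ?_, hwe, φ, hφ.1,
    fun F => hφ.2 F, hφj, ?_, ?_⟩
  · intro X' w' hXe' hX' h'
    have hw' := (htr X' hX' w').1 h'
    have hXX : X' = X := H.eq_of_canonical hqm (2 * M) hM hX' hX (mem_part_zero.1 hXe') hXe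
      (hw' ▸ sum_tmul_mem_tSub q w') hXV
    subst hXX
    exact ⟨rfl, sum_tmul_injective hind (hw'.symm.trans hw)⟩
  -- Injectivity: the operator with the free variables as coefficients is a Lax operator over
  -- `ℂ_diff[x_j]`, and `ψ` is the homomorphism it defines.
  · have hq0 : ∑ j, (q j : g) ⊗ₜ[ℂ] DiffSym.gen _ (SuperFree.single par j)
        ∈ tSub (DiffPoly par) Vf := sum_tmul_mem_tSub q _
    have hq0e : sgn _ (∑ j, (q j : g) ⊗ₜ[ℂ] DiffSym.gen _ (SuperFree.single par j))
        = ∑ j, (q j : g) ⊗ₜ[ℂ] DiffSym.gen _ (SuperFree.single par j) := by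
      rw [sgn_sum_tmul_eq_iff q hpar]
      intro j
      exact mem_part_of_sgn_comm _ (fun x => by rw [SuperSym.sgn_eq, DiffSym.inv_gen])
        (SuperFree.single_mem par j)
    have hq0m := tSub_mono hVf hq0
    obtain ⟨ψ, hψ, hψg⟩ := VI.exists_evalHom hq0m hq0e
    have hψq := VI.lTensor_qUniv b b' hdual hψg
    have h1 := congrArg (mapG g ψ) hXw
    rw [mapG_truncExp hψ, mapG_laxG, mapG_laxG, hψq, truncExp_eq_laxG] at h1
    have h2 := laxG_injective h1
    have h3 : ψ.toLinearMap.lTensor g (∑ j, (q j : g) ⊗ₜ[ℂ] w j)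
        = ∑ j, (q j : g) ⊗ₜ[ℂ] ψ (w j) := by
      simp
    rw [h3] at h2
    -- `ψ(X)` brings this operator to canonical form, and so does `0`, since it is already
    -- canonical. Uniqueness over `ℂ_diff[x_j]` gives `ψ(X) = 0`, hence `ψ(w^j) = x_j`.
    have h4 : ψ.toLinearMap.lTensor g X = 0 := by
      refine H.eq_of_canonical (k := k) hq0m (2 * M) hM (lTensor_mem_tSub _ hX) (zero_mem _)
        (by rw [sgn_lTensor _ hψ.2, hXe]) (map_zero _) (h2 ▸ sum_tmul_mem_tSub q _) ?_
      rw [transformed_zero]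
      exact hq0
    rw [h4, transformed_zero] at h2
    have h5 := sum_tmul_injective hind h2
    refine Function.LeftInverse.injective (g := ψ) fun F => ?_
    induction F using DiffSym.induction_der with
    | algebraMap r => rw [AlgHom.commutes, AlgHom.commutes]
    | gen x =>
      induction x using SuperFree.induction with
      | zero => simp
      | add x y hx hy => simp only [map_add, hx, hy]
      | smul_single c j => rw [map_smul, map_smul, map_smul, hφj, ← congrFun h5 j]
    | der F hF => 
      have h6 := hφ.1 F
      have h7 := hψ.1 (φ F)
      rw [hF] at h7
      exact (congrArg ψ h6).trans h7
    | mul x y hx hy => rw [map_mul, map_mul, hx, hy]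
    | add x y hx hy => rw [map_add, map_add, hx, hy]
  · refine le_antisymm ?_ fun F hF => ?_
    · have hwW : ∀ j, w j ∈ WAlg D k := by
        intro j
        rw [mem_WAlg_iff]
        intro i a ha han
        obtain ⟨δ, hδ, h⟩ := lamVI_canonical b b' hdual hM1 hM hX hXe hXw
          (sum_tmul_mem_tSub q w) hVf H ha han
        -- `δ` annihilates the canonical form as a whole. Linear independence of the `v_j` separates
        -- this into `{a_λ w^j} = 0` for each `j`.
        have h' : ∑ j, (q j : g) ⊗ₜ[ℂ] δ (SqZero.inl i (VI D) (w j))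
            = ∑ j, (q j : g) ⊗ₜ[ℂ] (0 : SqZero i (VI D)) := by
          simpa using h
        have h0 := congrFun (sum_tmul_injective hind h') j
        rw [hδ] at h0
        exact congrArg Prod.snd h0
      rintro _ ⟨F, rfl⟩
      change φ F ∈ _
      induction F using DiffSym.induction_der with
      | algebraMap r => rw [AlgHom.commutes]; exact Subalgebra.algebraMap_mem _ r
      | gen x =>
        induction x using SuperFree.induction with
        | zero => rw [map_zero, map_zero]; exact zero_mem _
        | add x y hx hy => rw [map_add, map_add]; exact add_mem hx hy
        | smul_single c j =>
          rw [map_smul, map_smul, hφj]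
          exact Subalgebra.smul_mem _ (hwW j) c
      | der F hF =>
        have h6 : φ (DiffSym.der _ F) = der (φ F) := hφ.1 F
        rw [h6]
        exact der_mem_WAlg k hF
      | mul x y hx hy => rw [map_mul]; exact mul_mem hx hy
      | add x y hx hy => rw [map_add]; exact add_mem hx hy
    -- The image of `φ` is stable under `∂` and contains all pairings with the canonical form, as
    -- these are linear combinations of the `w^j`.
    · refine mem_of_mem_WAlg b b' hdual hM1 hM hX hXe hXw (S := φ.range) ?_ (fun y => ?_) hF
      · rintro _ ⟨x, rfl⟩
        exact ⟨der x, hφ.1 x⟩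
      · rw [map_sum]
        refine Subalgebra.sum_mem _ fun j _ => ?_
        rw [pairing_tmul]
        exact φ.range.smul_mem (AlgHom.mem_range _ |>.2 ⟨_, hφj j⟩) _
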